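/- Throughout, $\mathbb N$ is the set of positive integers. Let $n\neq 1$ be a square-free integer (so $n\ne 0$), let $\omega_n=\frac{1+\sqrt n}{2}$ if $n\equiv 1\pmod 4$ and $\omega_n=\sqrt n$ otherwise, and let $d_n=n$ if $n\equiv 1\pmod 4$ and $d_n=4n$ otherwise. Let $r\in\mathbb N$ and $R=\mathbb Z[r\omega_n]$. For a prime $p$ let $\binom{d_n}{p}$ be the Kronecker symbol: the Legendre symbol if $p$ is odd, while $\binom{a}{2}$ is $0$ if $a$ is even, $1$ if $a\equiv\pm1\pmod 8$ and $-1$ if $a\equiv\pm3\pmod 8$. Definitions. Let $D$ be an integral domain with quotient field $K$. An overring of $D$ is a ring $T$ with $D\subseteq T\subseteq K$. - $D$ is a PVD (respectively, an APVD) if for every prime ideal $P$ of $D$ and all $x,y\in K$ with $xy\in P$, either $x\in P$ or $y\in P$ (respectively, either $x\in P$ or $y^m\in P$ for some $m\in\mathbb N$). - $D$ is conducive if for each overring $T\neq K$ of $D$ there is a nonzero $x\in K$ with $xT\subseteq D$. - $D$ is an LPVD (respectively, an LAPVD, locally conducive) if $D_M$ is a PVD (respectively, an APVD, conducive) for each maximal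 ideal $M$ of $D$. It is a Prüfer domain if $D_M$ is a valuation domain for each maximal ideal $M$. - $D$ is a GPVD if there is a Prüfer overring $T$ of $D$ such that (i) for each prime ideal $P$ of $D$ there is exactly one prime ideal $Q$ of $T$ with $Q\cap D=P$, and (ii) there is a nonzero set $A$ that is a radical ideal both of $D$ and of $T$ such that each prime ideal of $D$ (respectively, of $T$) containing $A$ is a maximal ideal of $D$ (respectively, of $T$). - An ideal $I$ of $D$ is $k$-absorbing ($k\in\mathbb N$) if whenever $a_1\cdots a_{k+1}\in I$ with $a_1,\dots,a_{k+1}\in D$, there is $i$ with $\prod_{j\neq i}a_j\in I$. $\text{AF-dim}(D)$ is the least $k\in\mathbb N$ such that every proper ideal of $D$ is a finite product of $k$-absorbing ideals of $D$, and $\infty$ if there is no such $k$. Then: 1. The following are equivalent: (a) $R$ is a GPVD; (b) $R$ is an LPVD; (c) $\text{AF-dim}(R)\le 2$; (d) $r$ is square-free and $\binom{d_n}{p}=-1$ for every prime factor $p$ of $r$. 2. The following are equivalent: (a) $R$ is an LAPVD; (b) $\text{AF-dim}(R)\le 3$; (c) $r$ is square-free and $\binom{d_n}{p}\neq 1$ for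 every prime factor $p$ of $r$. 3. The following are equivalent: (a) $R$ is locally conducive; (b) $\text{AF-dim}(R)<\infty$; (c) $\binom{d_n}{p}\neq 1$ for every prime factor $p$ of $r$. -/

import Mathlib

noncomputable section

section Rings

/-- A subset of the field `K` (the quotient field of `R` in every use below): the image of
the ideal `I` of `R` in `K`. -/
def idealImage {R : Type*} [CommRing R] (K : Type*) [Field K] [Algebra R K] (I : Ideal R) :
    Set K :=
  algebraMap R K '' (I : Set R)

/-- `I` is strongly prime: for `x, y` in the quotient field `K`, `x * y ∈ I` implies `x ∈ I` or
`y ∈ I`. -/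
def IsStronglyPrime {R : Type*} [CommRing R] (K : Type*) [Field K] [Algebra R K]
    [IsFractionRing R K] (I : Ideal R) : Prop :=
  ∀ x y : K, x * y ∈ idealImage K I → x ∈ idealImage K I ∨ y ∈ idealImage K I

/-- `I` is strongly primary: for `x, y` in the quotient field `K`, `x * y ∈ I` implies `x ∈ I` or
`y ^ m ∈ I` for some positive integer `m`. -/
def IsStronglyPrimary {R : Type*} [CommRing R] (K : Type*) [Field K] [Algebra R K]
    [IsFractionRing R K] (I : Ideal R) : Prop :=
  ∀ x y : K, x * y ∈ idealImage K I →
    x ∈ idealImage K I ∨ ∃ m : ℕ, 0 < m ∧ y ^ m ∈ idealImage K I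

/-- Pseudo-valuation domain: every prime ideal is strongly prime. -/
def IsPVD (R : Type*) [CommRing R] [IsDomain R] : Prop :=
  ∀ P : Ideal R, P.IsPrime → IsStronglyPrime (FractionRing R) P

/-- Almost pseudo-valuation domain: every prime ideal is strongly primary. -/
def IsAPVD (R : Type*) [CommRing R] [IsDomain R] : Prop :=
  ∀ P : Ideal R, P.IsPrime → IsStronglyPrimary (FractionRing R) P

/-- Conducive domain: every overring other than the quotient field is a fractional ideal.
The overrings of `R` are the `R`-subalgebras of the quotient field. -/
def IsConducive (R : Type*) [CommRing R] [IsDomain R] : Prop :=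
  ∀ T : Subalgebra R (FractionRing R), T ≠ ⊤ →
    IsFractional (nonZeroDivisors R) (Subalgebra.toSubmodule T)

/-- Locally pseudo-valuation domain. -/
def IsLPVD (R : Type*) [CommRing R] [IsDomain R] : Prop :=
  ∀ (M : Ideal R) [M.IsMaximal], IsPVD (Localization.AtPrime M)

/-- Locally almost pseudo-valuation domain. -/
def IsLAPVD (R : Type*) [CommRing R] [IsDomain R] : Prop :=
  ∀ (M : Ideal R) [M.IsMaximal], IsAPVD (Localization.AtPrime M)

/-- Locally conducive domain. -/
def IsLocallyConducive (R : Type*) [CommRing R] [IsDomain R] : Prop :=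
  ∀ (M : Ideal R) [M.IsMaximal], IsConducive (Localization.AtPrime M)

/-- Prüfer domain: the localization at each maximal ideal is a valuation domain. -/
def IsPruferDomain (R : Type*) [CommRing R] [IsDomain R] : Prop :=
  ∀ (M : Ideal R) [M.IsMaximal], ValuationRing (Localization.AtPrime M)

/-- Over each prime ideal of `R` there lies exactly one prime ideal of `T`. -/
def IsUnibranched (R T : Type*) [CommRing R] [CommRing T] [Algebra R T] : Prop :=
  ∀ P : Ideal R, P.IsPrime → ∃! Q : Ideal T, Q.IsPrime ∧ Q.comap (algebraMap R T) = P

/-- Globalized pseudo-valuation domain: there is a Prüfer overring `T` of `R` such that `R ⊆ T` is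
unibranched, and a nonzero radical ideal common to `R` and `T` (it is called `A` as an ideal of
`R` and `B` as an ideal of `T`) such that the prime ideals of `R` and of `T` which contain it are
maximal. -/
def IsGPVD (R : Type*) [CommRing R] [IsDomain R] : Prop :=
  ∃ T : Subalgebra R (FractionRing R), IsPruferDomain T ∧ IsUnibranched R T ∧
    ∃ (A : Ideal R) (B : Ideal T),
      idealImage (FractionRing R) A = idealImage (FractionRing R) B ∧
      A ≠ ⊥ ∧ A.IsRadical ∧ B.IsRadical ∧
      (∀ P : Ideal R, P.IsPrime → A ≤ P → P.IsMaximal) ∧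
      (∀ Q : Ideal T, Q.IsPrime → B ≤ Q → Q.IsMaximal)

/-- `I` is `n`-absorbing: if a product of `n + 1` elements lies in `I`, then so does the product of
some `n` of them. -/
def IsNAbsorbing {R : Type*} [CommRing R] (n : ℕ) (I : Ideal R) : Prop :=
  ∀ a : Fin (n + 1) → R, ∏ j, a j ∈ I → ∃ i, ∏ j ∈ Finset.univ.erase i, a j ∈ I

/-- Every proper ideal of `R` is a finite product of `n`-absorbing ideals. -/
def HasAbsorbingFactorization (R : Type*) [CommRing R] (n : ℕ) : Prop :=
  ∀ I : Ideal R, I ≠ ⊤ →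
    ∃ s : Multiset (Ideal R), (∀ J ∈ s, IsNAbsorbing n J) ∧ s.prod = I

/-- The AF-dimension: the least positive integer `n` such that every proper ideal is a finite
product of `n`-absorbing ideals, and `⊤` (infinity) if there is none. -/
def afDim (R : Type*) [CommRing R] : ℕ∞ :=
  ⨅ (n : ℕ) (_ : 0 < n ∧ HasAbsorbingFactorization R n), (n : ℕ∞)

end Rings

section Quadratic

/-- `ω_n`, namely `(1 + √n) / 2` if `n ≡ 1 (mod 4)` and `√n` otherwise, where
`√n` is the principal complex square root. -/
def quadOmega (n : ℤ) : ℂ :=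
  if n % 4 = 1 then (1 + (n : ℂ) ^ (2⁻¹ : ℂ)) / 2 else (n : ℂ) ^ (2⁻¹ : ℂ)

/-- The ring `ℤ[r ω_n]`, as a subring of `ℚ(√n) ⊆ ℂ`. -/
abbrev quadOrder (n : ℤ) (r : ℕ) : Subalgebra ℤ ℂ :=
  Algebra.adjoin ℤ {(r : ℂ) * quadOmega n}

/-- The discriminant of `ℚ(√n)` for square-free `n ≠ 1`. -/
def quadDisc (n : ℤ) : ℤ :=
  if n % 4 = 1 then n else 4 * n

/-- The Kronecker symbol `(a / p)` for a prime `p`; for `p = 2` it is `0` if `a` is even, `1` if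
`a ≡ ±1 (mod 8)` and `-1` if `a ≡ ±3 (mod 8)`; otherwise it is the Legendre symbol. -/
def kroneckerSymbol (a : ℤ) (p : ℕ) [Fact p.Prime] : ℤ :=
  if p = 2 then (if a % 2 = 0 then 0 else if a % 8 = 1 ∨ a % 8 = 7 then 1 else -1)
  else legendreSym p a

end Quadratic

end

/-! Let X² - TX + N be the minimal polynomial of ω = `quadOmega n`, put α = rω, so that R = ℤ ⊕ ℤα,
and let f(X) = X² + TX + N, so that f(t) is the norm of ω + t. The Kronecker symbol at p is -1, 0 or
1 according as f has no root, only a double root, or a simple root modulo p. The conditions (d) and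
(c) thus become conditions on f at the primes p ∣ r. Maximality of ℤ[ω] is used in the form: no t
satisfies both p² ∣ f(t) and p ∣ f'(t).

Factorization. Let p ∣ r. The only prime over p is M = (p, α), and M² ⊆ pM. If p^e (e ≥ 2) divides
the norm r² f(t) of θ = α + rt, then (p^e, θ) is not a product of two proper ideals, because θ ∉ pR;
it contains no power of p below p^e, so being n-absorbing forces e ≤ n
(`le_of_hasAbsorbingFactorization`). If p² ∣ r this gives e = 4, a root of f gives e = 3, and a
simple root gives every e by Hensel lifting. Conversely, a nonzero ideal splits into coprime
factors, each containing a power of one prime. If p^k exactly divides r, factors pR are split off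
until the remaining ideal contains M^(2k+ε), where ε = 0 for inert and ε = 1 for ramified p
(`span_pair_pow_le_of_notMem`). Over primes not dividing r the maximal ideals are invertible.

Localization. At M, with p^k exactly dividing r and θ = α/p^k, one has R_M = ℤ_(p) + p^k θ ℤ_(p)
inside V = ℤ_(p) + θ ℤ_(p), and V is a valuation ring if p does not split. Then p^k V ⊆ R_M gives
conducivity. If k = 1, the maximal ideal of R_M is pV; it is the maximal ideal of V for inert p and
contains the squares of the nonunits of V for ramified p. Conversely, the pair p/β, β with β = t + ω
violates strong primariness, and if p splits, V[1/β'] with β' the conjugate of β is an overring that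
is not fractional.

Globalization. If all p ∣ r are inert and r is square-free, ℤ[ω] and its ideal rℤ[ω] witness that R
is a GPVD. Conversely, the maximal ideal of the Prüfer overring localized over M coincides with that
of R_M, which is therefore strongly prime. -/

noncomputable section

/-! ### Absorbing ideals and the AF-dimension -/

section Absorbing

variable {R : Type*} [CommRing R]

theorem Fin.prod_erase_univ {n : ℕ} (i : Fin (n + 1)) (b : Fin (n + 1) → R) :
    ∏ j ∈ Finset.univ.erase i, b j = ∏ j, b (i.succAbove j) := by
  rw [Finset.erase_eq, Finset.sdiff_singleton_eq_erase, ← Finset.compl_singleton,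
    ← Fin.image_succAbove_univ, Finset.prod_image (Fin.succAbove_right_injective.injOn)]

/-- Merge the first two factors into one. If the merged factor is the one to be dropped, dropping
only `a 0` still leaves a multiple of the remaining product. -/
theorem IsNAbsorbing.succ {n : ℕ} {I : Ideal R} (h : IsNAbsorbing n I) :
    IsNAbsorbing (n + 1) I := by
  intro a ha
  rw [Fin.prod_univ_succ, Fin.prod_univ_succ, ← mul_assoc] at ha
  obtain ⟨i, hi⟩ := h (Fin.cons (a 0 * a 1) fun j => a j.succ.succ) (by
    rw [Fin.prod_univ_succ]; simpa using ha)
  rw [Fin.prod_erase_univ] at hi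
  simp only [Fin.prod_erase_univ]
  revert hi
  refine Fin.cases (fun hi => ⟨0, ?_⟩) (fun i hi => ⟨i.succ.succ, ?_⟩) i
  · simp only [Fin.zero_succAbove, Fin.cons_succ] at hi ⊢
    rw [Fin.prod_univ_succ]
    exact I.mul_mem_left _ hi
  · cases n with
    | zero => exact i.elim0
    | succ n =>
      rw [Fin.prod_univ_succ] at hi
      rw [Fin.prod_univ_succ, Fin.prod_univ_succ, ← mul_assoc]
      simpa using hi

theorem IsNAbsorbing.mono {m n : ℕ} (hmn : m ≤ n) {I : Ideal R} (h : IsNAbsorbing m I) :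
    IsNAbsorbing n I := by
  induction n, hmn using Nat.le_induction with
  | base => exact h
  | succ n _ ih => exact ih.succ

theorem HasAbsorbingFactorization.mono {m n : ℕ} (hmn : m ≤ n)
    (h : HasAbsorbingFactorization R m) : HasAbsorbingFactorization R n := by
  intro I hI
  obtain ⟨s, hs, hs'⟩ := h I hI
  exact ⟨s, fun J hJ => (hs J hJ).mono hmn, hs'⟩

theorem afDim_lt_top_iff :
    afDim R < ⊤ ↔ ∃ n, 0 < n ∧ HasAbsorbingFactorization R n := by
  simp only [afDim, iInf_lt_iff]
  constructor
  · rintro ⟨n, hn, -⟩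
    exact ⟨n, hn⟩
  · rintro ⟨n, hn⟩
    exact ⟨n, hn, ENat.natCast_lt_top n⟩

/-- Absorbing factorization is monotone in the exponent, so a bound on the infimum already gives the
factorization at that bound. -/
theorem afDim_le_iff {k : ℕ} (hk : 0 < k) :
    afDim R ≤ k ↔ HasAbsorbingFactorization R k := by
  constructor
  · intro h
    have h1 : afDim R < ((k + 1 : ℕ) : ℕ∞) := lt_of_le_of_lt h (by exact_mod_cast Nat.lt_succ_self k)
    simp only [afDim, iInf_lt_iff] at h1
    obtain ⟨n, hn, hlt⟩ := h1
    have : n < k + 1 := by exact_mod_cast hlt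
    exact hn.2.mono (by omega)
  · intro h
    exact iInf₂_le k ⟨hk, h⟩

theorem IsNAbsorbing.pow_mem {n N : ℕ} {I : Ideal R} (h : IsNAbsorbing n I) {x : R}
    (hx : x ^ N ∈ I) : x ^ n ∈ I := by
  induction N with
  | zero =>
    rw [pow_zero] at hx
    exact I.mem_of_one_mem hx _
  | succ N ih =>
    by_cases hN : N + 1 ≤ n
    · exact I.pow_mem_of_pow_mem hx hN
    · apply ih
      -- The power x^(N+1) is written with n + 1 factors of positive exponents, so dropping any one
      -- of them leaves an exponent of at most N.
      let e : Fin (n + 1) → ℕ := Fin.cons (N + 1 - n) fun _ => 1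
      have he : ∑ j, e j = N + 1 := by
        rw [Fin.sum_univ_succ]; simp [e]; omega
      have he1 : ∀ i, 1 ≤ e i := by
        intro i
        refine Fin.cases ?_ (fun j => ?_) i
        · simp [e]; omega
        · simp [e]
      obtain ⟨i, hi⟩ := h (fun j => x ^ e j) (by rw [Finset.prod_pow_eq_pow_sum, he]; exact hx)
      rw [Finset.prod_pow_eq_pow_sum] at hi
      refine I.pow_mem_of_pow_mem hi ?_
      have := Finset.sum_erase_add Finset.univ e (Finset.mem_univ i)
      have := he1 i
      omega

theorem isNAbsorbing_of_isPrime {n : ℕ} (hn : 0 < n) {P : Ideal R} (hP : P.IsPrime) :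
    IsNAbsorbing n P := by
  intro a ha
  obtain ⟨j, -, hj⟩ := hP.prod_mem_iff.1 ha
  have : Nontrivial (Fin (n + 1)) := Fin.nontrivial_iff_two_le.2 (by omega)
  obtain ⟨i, hi⟩ := exists_ne j
  exact ⟨i, hP.prod_mem_iff.2 ⟨j, Finset.mem_erase.2 ⟨hi.symm, Finset.mem_univ j⟩, hj⟩⟩

/-- If all factors lie in M, any n of them have product in M^n. Otherwise some factor is a unit
modulo M^n, hence modulo I, and can be dropped. -/
theorem isNAbsorbing_of_pow_le {n : ℕ} {M I : Ideal R} (hM : M.IsMaximal) (h : M ^ n ≤ I) :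
    IsNAbsorbing n I := by
  intro a ha
  by_cases hall : ∀ j, a j ∈ M
  · refine ⟨0, h ?_⟩
    have := Ideal.prod_mem_prod (s := Finset.univ.erase (0 : Fin (n + 1))) (I := fun _ => M)
      (x := a) (fun j _ => hall j)
    simpa using this
  · push Not at hall
    obtain ⟨i, hi⟩ := hall
    refine ⟨i, ?_⟩
    have hc : IsCoprime (Ideal.span {a i}) (M ^ n) := by
      apply IsCoprime.pow_right
      rw [Ideal.isCoprime_iff_sup_eq]
      refine hM.1.2 _ (lt_of_le_of_ne le_sup_right fun h => hi ?_)
      rw [h]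
      exact Ideal.mem_sup_left (Ideal.mem_span_singleton_self _)
    rw [Ideal.isCoprime_iff_exists] at hc
    obtain ⟨x, hx, y, hy, hxy⟩ := hc
    obtain ⟨c, rfl⟩ := Ideal.mem_span_singleton'.1 hx
    rw [← Finset.prod_erase_mul _ _ (Finset.mem_univ i)] at ha
    set b := ∏ j ∈ Finset.univ.erase i, a j
    have : b = c * (b * a i) + b * y := by
      linear_combination (-b) * hxy
    rw [this]
    exact I.add_mem (I.mul_mem_left _ ha) (I.mul_mem_left _ (h hy))

/-- `I` is a finite product of `n`-absorbing ideals. -/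
def IsAbsorbingProduct (n : ℕ) (I : Ideal R) : Prop :=
  ∃ s : Multiset (Ideal R), (∀ J ∈ s, IsNAbsorbing n J) ∧ s.prod = I

theorem IsNAbsorbing.isAbsorbingProduct {n : ℕ} {I : Ideal R} (h : IsNAbsorbing n I) :
    IsAbsorbingProduct n I :=
  ⟨{I}, by simpa using h, by simp⟩

theorem isAbsorbingProduct_top (n : ℕ) : IsAbsorbingProduct n (⊤ : Ideal R) :=
  ⟨0, by simp, by simp⟩

theorem IsAbsorbingProduct.mul {n : ℕ} {I J : Ideal R} (hI : IsAbsorbingProduct n I)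
    (hJ : IsAbsorbingProduct n J) : IsAbsorbingProduct n (I * J) := by
  obtain ⟨s, hs, rfl⟩ := hI
  obtain ⟨t, ht, rfl⟩ := hJ
  exact ⟨s + t, fun L hL => (Multiset.mem_add.1 hL).elim (hs L) (ht L), Multiset.prod_add s t⟩

end Absorbing

/-! ### Valuation rings are PVDs; a criterion for conducivity -/

section Valuation

theorem IsPVD.isAPVD {R : Type*} [CommRing R] [IsDomain R] (h : IsPVD R) : IsAPVD R :=
  fun P hP x y hxy => (h P hP x y hxy).imp id fun hy => ⟨1, one_pos, by simpa using hy⟩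

theorem isStronglyPrime_bot {R : Type*} [CommRing R] (K : Type*) [Field K] [Algebra R K]
    [IsFractionRing R K] : IsStronglyPrime K (⊥ : Ideal R) := by
  intro x y hxy
  have h0 : idealImage K (⊥ : Ideal R) = {0} := by simp [idealImage]
  rw [h0] at hxy ⊢
  simpa using hxy

theorem isPVD_of_valuationRing (A : Type*) [CommRing A] [IsDomain A] [ValuationRing A] :
    IsPVD A := by
  intro P hP x y hxy
  have main : ∀ x y : FractionRing A, x * y ∈ idealImage (FractionRing A) P →
      x ∉ Set.range (algebraMap A (FractionRing A)) → y ∈ idealImage (FractionRing A) P := by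
    rintro x y ⟨c, hc, hcxy⟩ hx
    rcases ValuationRing.isInteger_or_isInteger A x with ⟨a, ha⟩ | ⟨a, ha⟩
    · exact absurd ⟨a, ha⟩ hx
    · refine ⟨a * c, P.mul_mem_left _ hc, ?_⟩
      have hx0 : x ≠ 0 := by
        rintro rfl
        exact hx ⟨0, map_zero _⟩
      rw [map_mul, ha, hcxy, inv_mul_cancel_left₀ hx0]
  by_cases hx : x ∈ Set.range (algebraMap A (FractionRing A))
  · by_cases hy : y ∈ Set.range (algebraMap A (FractionRing A))
    · obtain ⟨a, rfl⟩ := hx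
      obtain ⟨b, rfl⟩ := hy
      obtain ⟨c, hc, hc'⟩ := hxy
      rw [← map_mul] at hc'
      rw [IsFractionRing.injective A (FractionRing A) hc'] at hc
      exact (hP.mem_or_mem hc).imp (fun h => ⟨a, h, rfl⟩) fun h => ⟨b, h, rfl⟩
    · exact Or.inl (main y x (mul_comm x y ▸ hxy) hy)
  · exact Or.inr (main x y hxy hx)

/-- A domain that contains a nonzero multiple of a valuation ring `V` of its quotient field is
conducive. -/
theorem isConducive_of_mul_subset {A : Type*} [CommRing A] [IsDomain A]
    (V : Set (FractionRing A)) (hV : ∀ z, z ∈ V ∨ z⁻¹ ∈ V) (c : FractionRing A) (hc : c ≠ 0)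
    (hcV : ∀ z ∈ V, c * z ∈ Set.range (algebraMap A (FractionRing A))) : IsConducive A := by
  intro T hT
  obtain ⟨z, hz⟩ : ∃ z, z ∉ T := by
    by_contra! h
    exact hT (eq_top_iff.2 fun x _ => h x)
  have hz0 : z ≠ 0 := by
    rintro rfl
    exact hz T.zero_mem
  -- If t c z⁻¹ is not in V, its inverse is, so c times the inverse, which is z/t, lies in A and z ∈
  -- T, a contradiction. Hence c² z⁻¹ carries T into A.
  have key : ∀ t ∈ T, c * (t * c * z⁻¹) ∈ Set.range (algebraMap A (FractionRing A)) := by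
    intro t ht
    by_cases ht0 : t = 0
    · exact ⟨0, by simp [ht0]⟩
    rcases hV (t * c * z⁻¹) with h | h
    · exact hcV _ h
    · exfalso
      obtain ⟨a, ha⟩ := hcV _ h
      apply hz
      have : z = algebraMap A _ a * t := by
        rw [ha]; field_simp
      rw [this]
      exact T.mul_mem (T.algebraMap_mem a) ht
  obtain ⟨u, v, hv, huv⟩ := IsFractionRing.div_surjective (A := A) (c * c * z⁻¹)
  have hv0 : algebraMap A (FractionRing A) v ≠ 0 :=
    IsFractionRing.to_map_ne_zero_of_mem_nonZeroDivisors hv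
  have hu0 : u ≠ 0 := by
    rintro rfl
    rw [map_zero, zero_div] at huv
    have : c * c * z⁻¹ ≠ 0 := by positivity
    exact this huv.symm
  refine ⟨u, mem_nonZeroDivisors_of_ne_zero hu0, fun t ht => ?_⟩
  obtain ⟨a, ha⟩ := key t ht
  refine ⟨v * a, ?_⟩
  rw [map_mul, ha, Algebra.smul_def]
  rw [div_eq_iff hv0] at huv
  rw [huv]; ring

theorem isConducive_of_valuationRing (A : Type*) [CommRing A] [IsDomain A] [ValuationRing A] :
    IsConducive A :=
  isConducive_of_mul_subset (Set.range (algebraMap A (FractionRing A)))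
    (fun z => ValuationRing.isInteger_or_isInteger A z) 1 one_ne_zero
    fun z hz => by simpa using hz

end Valuation

end

noncomputable section

/-! ### Quadratic orders in coordinates, and ideals that resist factorization -/

section QuadraticGenerators

/-- `θ` is a root of `X² - T X + N`, and `1` and `θ` are linearly independent over `ℤ`. -/
structure IsQuadElement {S : Type*} [CommRing S] (θ : S) (T N : ℤ) : Prop where
  sq : θ * θ = T * θ - N
  indep : ∀ a b : ℤ, (a : S) + b * θ = 0 → a = 0 ∧ b = 0

/-- `R` is free over `ℤ` with basis `1, θ`, where `θ` is a root of `X² - T X + N`. -/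
structure IsQuadOrderGen {R : Type*} [CommRing R] (θ : R) (T N : ℤ) : Prop
    extends IsQuadElement θ T N where
  span : ∀ x : R, ∃ a b : ℤ, x = a + b * θ

/-- The norm of `a + b θ`, where `θ` is a root of `X² - T X + N`. -/
def quadNorm (T N a b : ℤ) : ℤ := a * a + a * b * T + b * b * N

namespace IsQuadElement

variable {S : Type*} [CommRing S] {θ : S} {T N : ℤ} (h : IsQuadElement θ T N)
include h

theorem intCast_eq_zero {a : ℤ} (ha : (a : S) = 0) : a = 0 :=
  (h.indep a 0 (by simpa using ha)).1

theorem ext_iff {a b c d : ℤ} (he : (a : S) + b * θ = c + d * θ) : a = c ∧ b = d := by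
  have := h.indep (a - c) (b - d) (by push_cast; linear_combination he)
  omega

/-- The second factor is the conjugate of the first. Through this identity every ideal element
yields a rational integer in the same ideal. -/
theorem mul_conj (a b : ℤ) :
    ((a : S) + b * θ) * (((a + b * T : ℤ) : S) + ((-b : ℤ) : S) * θ) = (quadNorm T N a b : S) := by
  simp only [quadNorm]
  push_cast
  linear_combination (-(b : S) * b) * h.sq

theorem mul_eq (a b c d : ℤ) :
    ((a : S) + b * θ) * (c + d * θ) =
      ((a * c - b * d * N : ℤ) : S) + ((a * d + b * c + b * d * T : ℤ) : S) * θ := by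
  push_cast
  linear_combination ((b : S) * d) * h.sq

/-- Translation moves a root of X² + TX + N modulo a power of p to 0: the value at t becomes the new
constant term. -/
theorem shift (t : ℤ) : IsQuadElement (θ + t) (T + 2 * t) (N + T * t + t * t) where
  sq := by push_cast; linear_combination h.sq
  indep := by
    intro a b hab
    have := h.indep (a + b * t) b (by push_cast; linear_combination hab)
    refine ⟨?_, this.2⟩
    have h1 := this.1
    rw [this.2] at h1
    simpa using h1

theorem quadNorm_ne_zero [IsDomain S] {a b : ℤ} (hab : (a : S) + b * θ ≠ 0) :
    quadNorm T N a b ≠ 0 := by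
  intro h0
  have := h.mul_conj a b
  rw [h0, Int.cast_zero] at this
  have h1 := h.indep _ _ ((mul_eq_zero.1 this).resolve_left hab)
  apply hab
  have hb : b = 0 := by omega
  have ha : a = 0 := by simpa [hb] using h1.1
  simp [ha, hb]

end IsQuadElement

namespace IsQuadOrderGen

variable {R : Type*} [CommRing R] {θ : R} {T N : ℤ} (h : IsQuadOrderGen θ T N)
include h

theorem shift (t : ℤ) : IsQuadOrderGen (θ + t) (T + 2 * t) (N + T * t + t * t) where
  toIsQuadElement := h.toIsQuadElement.shift t
  span x := by
    obtain ⟨a, b, rfl⟩ := h.span x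
    exact ⟨a - b * t, b, by push_cast; ring⟩

theorem finite_int : Module.Finite ℤ R := by
  classical
  refine ⟨⟨({1, θ} : Finset R), ?_⟩⟩
  rw [eq_top_iff]
  rintro x -
  obtain ⟨a, b, rfl⟩ := h.span x
  rw [Finset.coe_insert, Finset.coe_singleton, Submodule.mem_span_pair]
  exact ⟨a, b, by simp⟩

theorem isNoetherianRing : IsNoetherianRing R := by
  have := h.finite_int
  exact IsNoetherianRing.of_finite ℤ R

theorem exists_intCast_mem [IsDomain R] {I : Ideal R} (hI : I ≠ ⊥) :
    ∃ c : ℤ, c ≠ 0 ∧ (c : R) ∈ I := by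
  obtain ⟨x, hx, hx0⟩ := Submodule.exists_mem_ne_zero_of_ne_bot hI
  obtain ⟨a, b, rfl⟩ := h.span x
  refine ⟨_, h.quadNorm_ne_zero hx0, ?_⟩
  rw [← h.mul_conj a b]
  exact I.mul_mem_right _ hx

theorem exists_prime_mem [IsDomain R] {P : Ideal R} (hP : P.IsPrime) (hP0 : P ≠ ⊥) :
    ∃ p : ℤ, Prime p ∧ (p : R) ∈ P := by
  obtain ⟨c, hc, hcP⟩ := h.exists_intCast_mem hP0
  have hpr : (P.comap (Int.castRingHom R)).IsPrime := P.comap_isPrime _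
  obtain ⟨p, hp⟩ := (IsPrincipalIdealRing.principal (P.comap (Int.castRingHom R))).principal
  have hp' : P.comap (Int.castRingHom R) = Ideal.span {p} := hp
  have hp0 : p ≠ 0 := by
    rintro rfl
    have : c ∈ P.comap (Int.castRingHom R) := hcP
    rw [hp'] at this
    simp at this
    exact hc this
  refine ⟨p, ?_, ?_⟩
  · rw [hp'] at hpr
    exact (Ideal.span_singleton_prime hp0).1 hpr
  · have : p ∈ P.comap (Int.castRingHom R) := by
      rw [hp']; exact Ideal.mem_span_singleton_self p
    exact this

/-- As c divides N, the lattice cℤ + ℤθ is stable under multiplication by θ and is already an ideal.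
-/
theorem mem_span_pair {c : ℤ} (hc : c ∣ N) {x : R} :
    x ∈ Ideal.span {(c : R), θ} ↔ ∃ a b : ℤ, x = ((c * a : ℤ) : R) + b * θ := by
  obtain ⟨d, rfl⟩ := hc
  rw [Ideal.mem_span_pair]
  constructor
  · rintro ⟨u, v, rfl⟩
    obtain ⟨a, b, rfl⟩ := h.span u
    obtain ⟨a', b', rfl⟩ := h.span v
    refine ⟨a - d * b', b * c + a' + b' * T, ?_⟩
    have := h.sq
    push_cast at this ⊢
    linear_combination (b' : R) * this
  · rintro ⟨a, b, rfl⟩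
    exact ⟨a, b, by push_cast; ring⟩

end IsQuadOrderGen

theorem Ideal.one_mem_of_isCoprime {R : Type*} [CommRing R] {I : Ideal R} {a b : ℤ}
    (hab : IsCoprime a b) (ha : (a : R) ∈ I) (hb : (b : R) ∈ I) : (1 : R) ∈ I := by
  obtain ⟨u, v, huv⟩ := hab
  have : ((u * a + v * b : ℤ) : R) ∈ I := by
    push_cast
    exact I.add_mem (I.mul_mem_left _ ha) (I.mul_mem_left _ hb)
  rwa [huv, Int.cast_one] at this

theorem Int.isCoprime_pow_of_prime {p a : ℤ} (hp : Prime p) (ha : ¬p ∣ a) (e : ℕ) :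
    IsCoprime a (p ^ e) :=
  (((Prime.coprime_iff_not_dvd hp).2 ha).symm).pow_right

theorem Int.exists_dvd_add_mul {p a : ℤ} (hp : Prime p) (ha : ¬p ∣ a) (e : ℕ) (b : ℤ) :
    ∃ u, p ^ e ∣ b + a * u := by
  obtain ⟨x, y, hxy⟩ := Int.isCoprime_pow_of_prime hp ha e
  exact ⟨-b * x, b * y, by linear_combination (-b) * hxy⟩

theorem Ideal.eq_top_of_add_mul_mem {R : Type*} [CommRing R] {θ : R} {p : ℤ} (hp : Prime p) {I : Ideal R} (hθ : θ ∈ I) {e : ℕ}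
    (he : (p : R) ^ e ∈ I) {a b : ℤ} (ha : ¬p ∣ a) (hx : (a : R) + b * θ ∈ I) : I = ⊤ := by
  rw [Ideal.eq_top_iff_one]
  refine Ideal.one_mem_of_isCoprime (Int.isCoprime_pow_of_prime hp ha e) ?_ (by exact_mod_cast he)
  have := I.sub_mem hx (I.mul_mem_left (b : R) hθ)
  simpa using this

namespace IsQuadOrderGen

variable {R : Type*} [CommRing R] {θ : R} {T N : ℤ} (h : IsQuadOrderGen θ T N)
include h

theorem intCast_mem_span_pair {c : ℤ} (hc : c ∣ N) {a : ℤ} (ha : (a : R) ∈ Ideal.span {(c : R), θ}) :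
    c ∣ a := by
  obtain ⟨u, v, huv⟩ := (h.mem_span_pair hc).1 ha
  have := h.ext_iff (a := a) (b := 0) (c := c * u) (d := v) (by simpa using huv)
  exact ⟨u, this.1⟩

theorem isMaximal_span_pair {p : ℤ} (hp : Prime p) (hpN : p ∣ N) :
    (Ideal.span {(p : R), θ}).IsMaximal := by
  rw [Ideal.isMaximal_def]
  constructor
  · intro htop
    have h1 : ((1 : ℤ) : R) ∈ Ideal.span {(p : R), θ} := by rw [htop]; trivial
    exact hp.not_dvd_one (h.intCast_mem_span_pair hpN h1)
  · intro J hJ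
    obtain ⟨x, hxJ, hx⟩ := Set.exists_of_ssubset hJ
    obtain ⟨a, b, rfl⟩ := h.span x
    refine Ideal.eq_top_of_add_mul_mem hp (hJ.le (Ideal.subset_span (by simp))) (e := 1)
      (by rw [pow_one]; exact hJ.le (Ideal.subset_span (by simp))) (a := a) (b := b) ?_ hxJ
    rintro ⟨a', rfl⟩
    exact hx ((h.mem_span_pair hpN).2 ⟨a', b, rfl⟩)

/-- Since p divides trace and norm, θ² ∈ pR, so every prime over p contains θ. -/
theorem eq_span_pair_of_mem {p : ℤ} (hp : Prime p) (hpT : p ∣ T) (hpN : p ∣ N) {P : Ideal R}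
    (hP : P.IsPrime) (hpP : (p : R) ∈ P) : P = Ideal.span {(p : R), θ} := by
  symm
  refine (h.isMaximal_span_pair hp hpN).eq_of_le hP.ne_top ?_
  rw [Ideal.span_le]
  rintro x (rfl | rfl)
  · exact hpP
  · obtain ⟨T', rfl⟩ := hpT
    obtain ⟨N', rfl⟩ := hpN
    have : x * x ∈ P := by
      rw [h.sq]
      push_cast
      exact P.sub_mem (P.mul_mem_right _ (P.mul_mem_right _ hpP)) (P.mul_mem_right _ hpP)
    exact (hP.mem_or_mem this).elim id id

/-- This is M² ⊆ pM for M = (p, θ), the feature of a non-invertible prime on which both directions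
of the factorization argument rest. -/
theorem mem_span_pair_mul_self {p : ℤ} (hpT : p ∣ T) (hpN : p * p ∣ N) {x : R}
    (hx : x ∈ Ideal.span {(p : R), θ} * Ideal.span {(p : R), θ}) :
    ∃ a b : ℤ, x = p * (((p * a : ℤ) : R) + b * θ) := by
  obtain ⟨T', rfl⟩ := hpT
  obtain ⟨N', rfl⟩ := hpN
  have hd : p ∣ p * p * N' := ⟨p * N', by ring⟩
  refine Submodule.mul_induction_on hx ?_ ?_
  · intro u hu v hv
    obtain ⟨a, b, rfl⟩ := (h.mem_span_pair hd).1 hu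
    obtain ⟨c, d, rfl⟩ := (h.mem_span_pair hd).1 hv
    refine ⟨a * c - b * d * N', a * d + b * c + b * d * T', ?_⟩
    have := h.sq
    push_cast at this ⊢
    linear_combination ((b : R) * d) * this
  · rintro u v ⟨a, b, rfl⟩ ⟨c, d, rfl⟩
    exact ⟨a + c, b + d, by push_cast; ring⟩

/-- The ideal I = (p^e, θ) has no factorization into two proper ideals, so it must itself be
n-absorbing; then p^n ∈ I, while I ∩ ℤ = p^e ℤ. -/
theorem le_of_hasAbsorbingFactorization {p : ℤ} (hp : Prime p) (hpT : p ∣ T) {e : ℕ} (he : 2 ≤ e)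
    (hpN : p ^ e ∣ N) {n : ℕ} (hn : HasAbsorbingFactorization R n) : e ≤ n := by
  have hp2 : p * p ∣ N := (pow_two p ▸ pow_dvd_pow p he).trans hpN
  have hp1 : p ∣ N := (Dvd.intro _ rfl).trans hp2
  set I : Ideal R := Ideal.span {((p ^ e : ℤ) : R), θ} with hI
  have hθI : θ ∈ I := Ideal.subset_span (by simp)
  have hpI : (p : R) ^ e ∈ I := Ideal.subset_span (by simp)
  have hItop : I ≠ ⊤ := by
    intro htop
    have h1 : ((1 : ℤ) : R) ∈ I := by rw [htop]; trivial
    have := h.intCast_mem_span_pair hpN h1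
    exact hp.not_dvd_one ((dvd_pow_self p (by omega)).trans this)
  -- An element a + bθ with p ∤ a, together with θ and p^e, generates the unit ideal; so (p, θ)
  -- contains every proper ideal over I.
  have hle : ∀ J : Ideal R, I ≤ J → J ≠ ⊤ → J ≤ Ideal.span {(p : R), θ} := by
    intro J hIJ hJ x hx
    obtain ⟨a, b, rfl⟩ := h.span x
    by_cases ha : p ∣ a
    · obtain ⟨a', rfl⟩ := ha
      exact (h.mem_span_pair hp1).2 ⟨a', b, rfl⟩
    · exact absurd (Ideal.eq_top_of_add_mul_mem hp (hIJ hθI) (hIJ hpI) ha hx) hJ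
  obtain ⟨s, hs, hsI⟩ := hn I hItop
  obtain ⟨J, hJs, hJ⟩ : ∃ J ∈ s, J ≠ ⊤ := by
    by_contra! hall
    apply hItop
    rw [← hsI]
    have : s = Multiset.replicate (Multiset.card s) ⊤ := Multiset.eq_replicate_card.2 hall
    rw [this, Multiset.prod_replicate, ← Ideal.one_eq_top, one_pow]
  obtain ⟨s', rfl⟩ := Multiset.exists_cons_of_mem hJs
  rw [Multiset.prod_cons] at hsI
  by_cases hs' : s'.prod = ⊤
  · rw [hs', Ideal.mul_top] at hsI
    have h1 := (hs J hJs).pow_mem (hsI ▸ hpI)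
    rw [hsI] at h1
    have h2 := h.intCast_mem_span_pair (a := p ^ n) hpN (by exact_mod_cast h1)
    exact (pow_dvd_pow_iff hp.ne_zero hp.not_isUnit).1 h2
  -- Two proper factors would put θ into M² ⊆ pR, but its θ-coordinate is 1.
  · exfalso
    have h1 := Ideal.mul_mono (hle J (hsI.symm.le.trans Ideal.mul_le_left) hJ)
      (hle s'.prod (hsI.symm.le.trans Ideal.mul_le_right) hs')
    rw [hsI] at h1
    obtain ⟨a, b, hab⟩ := h.mem_span_pair_mul_self hpT hp2 (h1 hθI)
    have := h.ext_iff (a := 0) (b := 1) (c := p * (p * a)) (d := p * b) (by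
      push_cast at hab ⊢; linear_combination hab)
    exact hp.not_dvd_one ⟨b, this.2⟩

end IsQuadOrderGen

/-- Hensel lifting of a simple root of `t² + T t + N` modulo `p`. -/
theorem exists_pow_dvd_of_simple_root {p T N t : ℤ} (hp : Prime p) (ht : p ∣ t * t + T * t + N)
    (ht' : ¬p ∣ 2 * t + T) (j : ℕ) :
    ∃ s, p ^ j ∣ s * s + T * s + N ∧ p ∣ s - t := by
  induction j with
  | zero => exact ⟨t, by simp⟩
  | succ j ih =>
    rcases Nat.eq_zero_or_pos j with rfl | hj
    · exact ⟨t, by simpa using ht, by simp⟩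
    obtain ⟨s, ⟨c, hc⟩, hs⟩ := ih
    have hs' : ¬p ∣ 2 * s + T := fun hd => ht' (by
      have := dvd_sub hd (hs.mul_left 2)
      rwa [show 2 * s + T - 2 * (s - t) = 2 * t + T by ring] at this)
    -- Newton's correction: u solves c + (2s + T)u ≡ 0 modulo p. The quadratic term p^(2j) u² is
    -- harmless because j ≥ 1.
    obtain ⟨u, d, hd⟩ := Int.exists_dvd_add_mul hp hs' 1 c
    obtain ⟨i, rfl⟩ : ∃ i, j = i + 1 := ⟨j - 1, by omega⟩
    refine ⟨s + p ^ (i + 1) * u, ⟨d + p ^ i * u * u, ?_⟩, ?_⟩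
    · rw [pow_one] at hd
      linear_combination hc + p ^ (i + 1) * hd
    · have : p ∣ p ^ (i + 1) * u := (dvd_pow_self p (by omega)).mul_right u
      have := dvd_add hs this
      rwa [show s - t + p ^ (i + 1) * u = s + p ^ (i + 1) * u - t by ring] at this

/-! ### What absorbing factorizations impose on the primes dividing r -/

section Necessary

variable {R : Type*} [CommRing R] {α : R} {r T N : ℤ}

/-- `p` splits: `X² + T X + N` has a simple root modulo `p`. -/
def HasSimpleRoot (T N p : ℤ) : Prop := ∃ t : ℤ, p ∣ t * t + T * t + N ∧ ¬p ∣ 2 * t + T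

/-- `p` is inert: `X² + T X + N` has no root modulo `p`. -/
def HasNoRoot (T N p : ℤ) : Prop := ∀ t : ℤ, ¬p ∣ t * t + T * t + N

/-- The generator α + rt has trace divisible by r and norm r² (t² + Tt + N). -/
theorem IsQuadOrderGen.le_of_hasAbsorbingFactorization_of_dvd
    (h : IsQuadOrderGen α (r * T) (r * r * N)) {p : ℤ} (hp : Prime p) (hpr : p ∣ r) {t : ℤ} {e : ℕ}
    (he : 2 ≤ e) (hpN : p ^ e ∣ r * r * (t * t + T * t + N)) {n : ℕ}
    (hn : HasAbsorbingFactorization R n) : e ≤ n := by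
  refine (h.shift (r * t)).le_of_hasAbsorbingFactorization hp ?_ he ?_ hn
  · obtain ⟨c, rfl⟩ := hpr
    exact ⟨c * T + 2 * (c * t), by ring⟩
  · refine hpN.trans (dvd_of_eq ?_)
    ring

theorem IsQuadOrderGen.squarefree_of_hasAbsorbingFactorization
    (h : IsQuadOrderGen α (r * T) (r * r * N)) (hn : HasAbsorbingFactorization R 3) {p : ℤ}
    (hp : Prime p) : ¬p * p ∣ r := by
  rintro ⟨c, rfl⟩
  have := h.le_of_hasAbsorbingFactorization_of_dvd hp (e := 4) (t := 0) ⟨p * c, by ring⟩ (by omega)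
    ⟨c * c * N, by ring⟩ hn
  omega

theorem IsQuadOrderGen.hasNoRoot_of_hasAbsorbingFactorization
    (h : IsQuadOrderGen α (r * T) (r * r * N)) (hn : HasAbsorbingFactorization R 2) {p : ℤ}
    (hp : Prime p) (hpr : p ∣ r) : HasNoRoot T N p := by
  intro t ht
  have hd : p ^ 3 ∣ r * r * (t * t + T * t + N) := by
    rw [show p ^ 3 = p * p * p by ring]
    exact mul_dvd_mul (mul_dvd_mul hpr hpr) ht
  have := h.le_of_hasAbsorbingFactorization_of_dvd hp hpr (by omega) hd hn
  omega

theorem IsQuadOrderGen.not_hasSimpleRoot_of_hasAbsorbingFactorization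
    (h : IsQuadOrderGen α (r * T) (r * r * N)) {n : ℕ} (hn : HasAbsorbingFactorization R n) {p : ℤ}
    (hp : Prime p) (hpr : p ∣ r) : ¬HasSimpleRoot T N p := by
  rintro ⟨t, ht, ht'⟩
  -- The exponent n + 2 is chosen to contradict the bound e ≤ n.
  obtain ⟨s, hs, -⟩ := exists_pow_dvd_of_simple_root hp ht ht' (n + 2)
  have := h.le_of_hasAbsorbingFactorization_of_dvd hp hpr (by omega) (hs.mul_left (r * r)) hn
  omega

end Necessary

end QuadraticGenerators

end

noncomputable section

/-! ### Construction of absorbing factorizations, one prime at a time -/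

section Sufficient

theorem Ideal.mem_of_isCoprime_mul_mem {R : Type*} [CommRing R] {I : Ideal R} {a b : ℤ} {x : R}
    (hab : IsCoprime a b) (ha : (a : R) * x ∈ I) (hb : (b : R) * x ∈ I) : x ∈ I := by
  obtain ⟨u, v, huv⟩ := hab
  have h1 : (u : R) * a + v * b = 1 := by exact_mod_cast congrArg (Int.cast : ℤ → R) huv
  have : x = u * (a * x) + v * (b * x) := by linear_combination (-x) * h1
  rw [this]
  exact I.add_mem (I.mul_mem_left _ ha) (I.mul_mem_left _ hb)

theorem Ideal.exists_eq_span_singleton_mul {R : Type*} [CommRing R] {I : Ideal R} {x : R}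
    (hI : I ≤ Ideal.span {x}) :
    ∃ J : Ideal R, I = Ideal.span {x} * J ∧ ∀ y, x * y ∈ I → y ∈ J := by
  refine ⟨Submodule.comap (LinearMap.mulLeft R x) I, ?_, fun y hy => hy⟩
  ext z
  rw [Ideal.mem_span_singleton_mul]
  constructor
  · intro hz
    obtain ⟨y, rfl⟩ := Ideal.mem_span_singleton.1 (hI hz)
    exact ⟨y, hz, rfl⟩
  · rintro ⟨y, hy, rfl⟩
    exact hy

theorem Ideal.eq_sup_span_mul_sup_span {R : Type*} [CommRing R] {I : Ideal R} {a b : ℤ}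
    (hab : IsCoprime a b) (h : ((a * b : ℤ) : R) ∈ I) :
    I = (I ⊔ Ideal.span {(a : R)}) * (I ⊔ Ideal.span {(b : R)}) := by
  apply le_antisymm
  · intro x hx
    refine Ideal.mem_of_isCoprime_mul_mem hab ?_ ?_
    · exact Ideal.mul_mem_mul (Ideal.mem_sup_right (Ideal.mem_span_singleton_self _))
        (Ideal.mem_sup_left hx)
    · rw [mul_comm (b : R) x]
      exact Ideal.mul_mem_mul (Ideal.mem_sup_left hx)
        (Ideal.mem_sup_right (Ideal.mem_span_singleton_self _))
  · rw [Ideal.sup_mul, Ideal.mul_sup, Ideal.mul_sup, Ideal.span_singleton_mul_span_singleton]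
    refine sup_le (sup_le Ideal.mul_le_left Ideal.mul_le_left) (sup_le Ideal.mul_le_right ?_)
    rw [Ideal.span_singleton_le_iff_mem]
    exact_mod_cast h

theorem quadNorm_mul_left (T N m a b : ℤ) :
    quadNorm (m * T) (m * m * N) a b = quadNorm T N a (m * b) := by
  simp only [quadNorm]; ring

/-- If p ∤ b, then with t ≡ a/b the norm is congruent to b² (t² + Tt + N), so t would be a root. -/
theorem HasNoRoot.dvd_of_dvd_quadNorm {T N p : ℤ} (hp : Prime p) (h : HasNoRoot T N p) {a b : ℤ}
    (hab : p ∣ quadNorm T N a b) : p ∣ a ∧ p ∣ b := by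
  by_cases hb : p ∣ b
  · refine ⟨?_, hb⟩
    obtain ⟨c, rfl⟩ := hb
    obtain ⟨d, hd⟩ := hab
    have : p ∣ a * a := ⟨d - a * c * T - c * (p * c) * N, by
      simp only [quadNorm] at hd; linear_combination hd⟩
    exact (hp.dvd_or_dvd this).elim id id
  · exfalso
    obtain ⟨t, c, hc⟩ := Int.exists_dvd_add_mul hp hb 1 (-a)
    rw [pow_one] at hc
    apply h t
    have : p ∣ b * b * (t * t + T * t + N) := by
      obtain ⟨d, hd⟩ := hab
      refine ⟨d + c * (a + b * t) + b * c * T, ?_⟩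
      simp only [quadNorm] at hd
      linear_combination hd + (a + b * t + b * T) * hc
    rcases hp.dvd_or_dvd this with h' | h'
    · exact absurd ((hp.dvd_or_dvd h').elim id id) hb
    · exact h'

/-- If p ∤ b, then a/b is a root modulo p; it is not simple, so the derivative vanishes there, and b
times the derivative is the trace modulo p. -/
theorem dvd_trace_of_dvd_quadNorm {T N p : ℤ} (hp : Prime p) (h : ¬HasSimpleRoot T N p) {a b : ℤ}
    (hab : p ∣ quadNorm T N a b) : p ∣ 2 * a + b * T := by
  by_cases hb : p ∣ b
  · obtain ⟨c, rfl⟩ := hb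
    obtain ⟨d, hd⟩ := hab
    have : p ∣ a * a := ⟨d - a * c * T - c * (p * c) * N, by
      simp only [quadNorm] at hd; linear_combination hd⟩
    obtain ⟨e, rfl⟩ := (hp.dvd_or_dvd this).elim id id
    exact ⟨2 * e + c * T, by ring⟩
  · obtain ⟨t, c, hc⟩ := Int.exists_dvd_add_mul hp hb 1 (-a)
    rw [pow_one] at hc
    have h1 : p ∣ b * b * (t * t + T * t + N) := by
      obtain ⟨d, hd⟩ := hab
      refine ⟨d + c * (a + b * t) + b * c * T, ?_⟩
      simp only [quadNorm] at hd
      linear_combination hd + (a + b * t + b * T) * hc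
    have h2 : p ∣ t * t + T * t + N := by
      rcases hp.dvd_or_dvd h1 with h' | h'
      · exact absurd ((hp.dvd_or_dvd h').elim id id) hb
      · exact h'
    by_contra h3
    refine h ⟨t, h2, fun h4 => h3 ?_⟩
    obtain ⟨d, hd⟩ := h4
    exact ⟨b * d - 2 * c, by linear_combination b * hd - 2 * hc⟩

/-- If p ∤ b, a quotient t ≡ a/b modulo p² would satisfy p² ∣ t² + Tt + N and p ∣ 2t + T, which
`hmax`, maximality at p, excludes. -/
theorem dvd_of_sq_dvd_quadNorm {T N p : ℤ} (hp : Prime p) (h : ¬HasSimpleRoot T N p)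
    (hmax : ∀ t, p ^ 2 ∣ t * t + T * t + N → ¬p ∣ 2 * t + T) {a b : ℤ}
    (hab : p ^ 2 ∣ quadNorm T N a b) : p ∣ a ∧ p ∣ b := by
  have hp1 : p ∣ quadNorm T N a b := (dvd_pow_self p two_ne_zero).trans hab
  by_cases hb : p ∣ b
  · refine ⟨?_, hb⟩
    obtain ⟨c, rfl⟩ := hb
    obtain ⟨d, hd⟩ := hp1
    have : p ∣ a * a := ⟨d - a * c * T - c * (p * c) * N, by
      simp only [quadNorm] at hd; linear_combination hd⟩
    exact (hp.dvd_or_dvd this).elim id id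
  · exfalso
    have htr := dvd_trace_of_dvd_quadNorm hp h hp1
    obtain ⟨t, c, hc⟩ := Int.exists_dvd_add_mul hp hb 2 (-a)
    refine hmax t ?_ ?_
    · have h1 : p ^ 2 ∣ (t * t + T * t + N) * (b * b) := by
        obtain ⟨d, hd⟩ := hab
        refine ⟨d + c * (a + b * t) + b * c * T, ?_⟩
        simp only [quadNorm] at hd
        linear_combination hd + (a + b * t + b * T) * hc
      have hco := (Int.isCoprime_pow_of_prime hp hb 2).symm
      exact (hco.mul_right hco).dvd_of_dvd_mul_right h1
    · obtain ⟨d, hd⟩ := htr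
      have : p ∣ b * (2 * t + T) := ⟨d + 2 * p * c, by linear_combination hd + 2 * hc⟩
      exact (hp.dvd_or_dvd this).resolve_left hb

namespace IsQuadOrderGen

variable {R : Type*} [CommRing R] {θ : R} {T N : ℤ} (h : IsQuadOrderGen θ T N)
include h

theorem mem_span_intCast {c a b : ℤ} :
    (a : R) + b * θ ∈ Ideal.span {(c : R)} ↔ c ∣ a ∧ c ∣ b := by
  rw [Ideal.mem_span_singleton']
  constructor
  · rintro ⟨x, hx⟩
    obtain ⟨u, v, rfl⟩ := h.span x
    have := h.ext_iff (a := u * c) (b := v * c) (c := a) (d := b) (by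
      push_cast; linear_combination hx)
    exact ⟨⟨u, by linarith⟩, ⟨v, by linarith⟩⟩
  · rintro ⟨⟨u, rfl⟩, ⟨v, rfl⟩⟩
    exact ⟨u + v * θ, by push_cast; ring⟩

theorem quadNorm_mem {I : Ideal R} {a b : ℤ} (hx : (a : R) + b * θ ∈ I) :
    (quadNorm T N a b : R) ∈ I := by
  rw [← h.mul_conj a b]
  exact I.mul_mem_right _ hx

theorem span_pair_pow_le {p : ℤ} (hpT : p ∣ T) (hpN : p * p ∣ N) (l : ℕ) :
    Ideal.span {(p : R), θ} ^ (l + 1) ≤ Ideal.span {(p : R)} ^ l * Ideal.span {(p : R), θ} := by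
  have hpN1 : p ∣ N := (Dvd.intro _ rfl).trans hpN
  have h2 : Ideal.span {(p : R), θ} * Ideal.span {(p : R), θ} ≤
      Ideal.span {(p : R)} * Ideal.span {(p : R), θ} := by
    intro x hx
    obtain ⟨a, b, rfl⟩ := h.mem_span_pair_mul_self hpT hpN hx
    exact Ideal.mul_mem_mul (Ideal.mem_span_singleton_self _) ((h.mem_span_pair hpN1).2 ⟨a, b, rfl⟩)
  induction l with
  | zero => simp
  | succ l ih =>
    rw [pow_succ]
    refine (Ideal.mul_mono_left ih).trans ?_
    rw [mul_assoc, pow_succ, mul_assoc]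
    exact Ideal.mul_mono_right h2

end IsQuadOrderGen

/-- In an order with conductor exactly divisible by `p ^ k`, a `p`-primary ideal that is not
divisible by `p` contains a controlled power of the maximal ideal over `p`. -/
theorem IsQuadOrderGen.span_pair_pow_le_of_notMem {R : Type*} [CommRing R] {α : R} {p T N : ℤ}
    {k ε : ℕ} (h : IsQuadOrderGen α (p ^ k * T) (p ^ k * p ^ k * N)) (hp : Prime p) (hk : 0 < k)
    (hε : ∀ a b, p ^ (ε + 1) ∣ quadNorm T N a b → p ∣ a ∧ p ∣ b) {I : Ideal R} {j : ℕ}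
    (hj : (p : R) ^ j ∈ I) {x : R} (hx : x ∈ I) (hxp : x ∉ Ideal.span {(p : R)}) :
    Ideal.span {(p : R), α} ^ (2 * k + ε) ≤ I := by
  obtain ⟨a, b, rfl⟩ := h.span x
  have hpk : p ∣ p ^ k := dvd_pow_self p hk.ne'
  by_cases ha : p ∣ a
  swap
  · have hI : I = ⊤ := by
      rw [Ideal.eq_top_iff_one]
      refine Ideal.one_mem_of_isCoprime (Int.isCoprime_pow_of_prime hp ?_ j) (h.quadNorm_mem hx)
        (by exact_mod_cast hj)
      intro hd
      apply ha
      have : p ∣ a * a := by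
        have h1 : p ∣ a * b * (p ^ k * T) + b * b * (p ^ k * p ^ k * N) :=
          dvd_add ((hpk.mul_right _).mul_left _) (((hpk.mul_right _).mul_right _).mul_left _)
        have := dvd_sub hd h1
        rwa [show quadNorm (p ^ k * T) (p ^ k * p ^ k * N) a b -
          (a * b * (p ^ k * T) + b * b * (p ^ k * p ^ k * N)) = a * a by
            simp only [quadNorm]; ring] at this
      exact (hp.dvd_or_dvd this).elim id id
    rw [hI]; exact le_top
  have hb : ¬p ∣ b := fun hb => hxp (h.mem_span_intCast.2 ⟨ha, hb⟩)
  -- Here i is the p-adic valuation of a, capped at k. With α = p^k θ this factors x as p^i (a' + b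
  -- p^l θ), and the second factor is not divisible by p, so its norm has valuation δ ≤ ε.
  obtain ⟨i, l, a', hil, rfl, ha'⟩ : ∃ (i l : ℕ) (a' : ℤ), k = i + l ∧ a = p ^ i * a' ∧
      (0 < l → ¬p ∣ a') := by
    clear hε h hj hx hxp hpk ha
    induction k with
    | zero => exact absurd hk (lt_irrefl 0)
    | succ k ih =>
      rcases Nat.eq_zero_or_pos k with rfl | hk'
      · by_cases ha : p ∣ a
        · obtain ⟨c, rfl⟩ := ha
          exact ⟨1, 0, c, rfl, by ring, by simp⟩
        · exact ⟨0, 1, a, rfl, by ring, fun _ => ha⟩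
      · obtain ⟨i, l, a', rfl, rfl, ha'⟩ := ih hk'
        by_cases hd : p ∣ a'
        · rcases Nat.eq_zero_or_pos l with rfl | hl
          · obtain ⟨c, rfl⟩ := hd
            exact ⟨i + 1, 0, c, rfl, by ring, by simp⟩
          · exact absurd hd (ha' hl)
        · exact ⟨i, l + 1, a', rfl, rfl, fun _ => hd⟩
  subst hil
  set n := quadNorm T N a' (b * p ^ l) with hn
  have hnε : ¬p ^ (ε + 1) ∣ n := by
    intro hd
    obtain ⟨h1, h2⟩ := hε _ _ hd
    rcases Nat.eq_zero_or_pos l with rfl | hl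
    · exact hb (by simpa using h2)
    · exact ha' hl h1
  have hn0 : n ≠ 0 := fun h0 => hnε (h0 ▸ dvd_zero _)
  obtain ⟨δ, u, hu, hnu⟩ : ∃ (δ : ℕ) (u : ℤ), ¬p ∣ u ∧ n = p ^ δ * u := by
    obtain ⟨δ, u, hu, hnu⟩ := WfDvdMonoid.max_power_factor hn0 hp.irreducible
    exact ⟨δ, u, hu, hnu⟩
  have hδ : δ ≤ ε := by
    by_contra! hlt
    apply hnε
    rw [hnu]
    exact (pow_dvd_pow p hlt).mul_right u
  have hcop := Int.isCoprime_pow_of_prime hp hu j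
  have h1 : ((p ^ (2 * i + δ) : ℤ) : R) ∈ I := by
    refine Ideal.mem_of_isCoprime_mul_mem hcop ?_ (I.mul_mem_right _ (by exact_mod_cast hj))
    have := h.quadNorm_mem hx
    have he : quadNorm (p ^ (i + l) * T) (p ^ (i + l) * p ^ (i + l) * N) (p ^ i * a') b =
        u * p ^ (2 * i + δ) := by
      have : u * p ^ (2 * i + δ) = p ^ (2 * i) * n := by rw [hnu]; ring
      rw [this, hn]
      simp only [quadNorm]; ring
    rw [he] at this
    exact_mod_cast this
  have h2 : ((p ^ (i + δ) : ℤ) : R) * α ∈ I := by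
    refine Ideal.mem_of_isCoprime_mul_mem hcop ?_ (I.mul_mem_right _ (by exact_mod_cast hj))
    -- The multiplier is α times the conjugate of a' + b p^l θ. It lies in R even when that
    -- conjugate does not, and its product with x is p^i n α.
    have he : (u : R) * (((p ^ (i + δ) : ℤ) : R) * α) = (((p ^ i * a' : ℤ) : R) + b * α) *
        (((p ^ (i + l) * (b * p ^ l * N) : ℤ) : R) + (a' : R) * α) := by
      have : (u : R) * (((p ^ (i + δ) : ℤ) : R) * α) = ((p ^ i * n : ℤ) : R) * α := by
        rw [hnu]; push_cast; ring
      rw [this, hn]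
      have hsq := h.sq
      simp only [quadNorm]
      push_cast at hsq ⊢
      linear_combination (-(b : R) * a') * hsq
    rw [he]
    exact I.mul_mem_right _ hx
  -- Iterating M² ⊆ pM gives M^(L+1) ⊆ p^L M, which is generated by p^(L+1) and p^L α. Both lie in I
  -- because 2i + δ ≤ L + 1 and i + δ ≤ L.
  obtain ⟨L, hL⟩ : ∃ L, 2 * (i + l) + ε = L + 1 := ⟨2 * (i + l) + ε - 1, by omega⟩
  rw [hL]
  refine (h.span_pair_pow_le (hpk.mul_right _) (mul_dvd_mul hpk hpk |>.mul_right _) L).trans ?_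
  rw [Ideal.span_singleton_pow, Ideal.span_singleton_mul_le_iff]
  intro z hz
  obtain ⟨c, d, rfl⟩ := (h.mem_span_pair ((hpk.mul_right _).mul_right _)).1 hz
  have e1 : L + 1 = (2 * i + δ) + (L + 1 - (2 * i + δ)) := by omega
  have e2 : L = (i + δ) + (L - (i + δ)) := by omega
  have : (p : R) ^ L * (((p * c : ℤ) : R) + d * α) =
      (p : R) ^ (L + 1) * c + (p : R) ^ L * (d * α) := by push_cast; ring
  rw [this]
  push_cast at h1 h2
  refine I.add_mem (I.mul_mem_right _ ?_) ?_
  · rw [e1, pow_add]; exact I.mul_mem_right _ h1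
  · rw [e2, pow_add, show (p : R) ^ (i + δ) * (p : R) ^ (L - (i + δ)) * (d * α) =
      (p : R) ^ (L - (i + δ)) * d * ((p : R) ^ (i + δ) * α) by ring]
    exact I.mul_mem_left _ h2

/-- Factors pR are split off while possible; pR is an admissible factor since M² ⊆ pR. What remains
is not contained in pR and so contains M^(2k+ε). -/
theorem IsQuadOrderGen.isAbsorbingProduct_of_dvd {R : Type*} [CommRing R] {α : R} {p T N : ℤ}
    {k ε : ℕ} (h : IsQuadOrderGen α (p ^ k * T) (p ^ k * p ^ k * N)) (hp : Prime p) (hk : 0 < k)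
    (hε : ∀ a b, p ^ (ε + 1) ∣ quadNorm T N a b → p ∣ a ∧ p ∣ b) {n : ℕ} (hn : 2 * k + ε ≤ n)
    (j : ℕ) (I : Ideal R) (hj : (p : R) ^ j ∈ I) : IsAbsorbingProduct n I := by
  have hpk : p ∣ p ^ k := dvd_pow_self p hk.ne'
  have hM := h.isMaximal_span_pair hp ((hpk.mul_right _).mul_right _)
  have habs : ∀ J : Ideal R, Ideal.span {(p : R), α} ^ (2 * k + ε) ≤ J → IsAbsorbingProduct n J :=
    fun J hJ => ((isNAbsorbing_of_pow_le hM hJ).mono hn).isAbsorbingProduct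
  induction j generalizing I with
  | zero =>
    rw [pow_zero, ← Ideal.eq_top_iff_one] at hj
    rw [hj]; exact isAbsorbingProduct_top n
  | succ j ih =>
    by_cases hI : I ≤ Ideal.span {(p : R)}
    · obtain ⟨J, rfl, hJ⟩ := Ideal.exists_eq_span_singleton_mul hI
      refine IsAbsorbingProduct.mul (habs _ ?_) (ih J (hJ _ (by rwa [← pow_succ'])))
      refine (Ideal.pow_le_pow_right (by omega : 1 + 1 ≤ 2 * k + ε)).trans ?_
      refine (h.span_pair_pow_le (hpk.mul_right _) (mul_dvd_mul hpk hpk |>.mul_right _) 1).trans ?_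
      rw [pow_one]
      exact Ideal.mul_le_left
    · obtain ⟨x, hx, hxp⟩ := Set.not_subset.1 hI
      exact habs I (h.span_pair_pow_le_of_notMem hp hk hε hj hx hxp)

theorem IsQuadOrderGen.isCoprime_quadNorm {R : Type*} [CommRing R] {α : R} {p T N : ℤ}
    (h : IsQuadOrderGen α T N) (hp : Prime p) (hroot : HasNoRoot T N p) {a b : ℤ}
    (hab : (a : R) + b * α ∉ Ideal.span {(p : R)}) (i : ℕ) :
    IsCoprime (quadNorm T N a b) (p ^ i) :=
  Int.isCoprime_pow_of_prime hp
    (fun hd => hab (h.mem_span_intCast.2 (hroot.dvd_of_dvd_quadNorm hp hd))) i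

theorem IsQuadOrderGen.isPrime_span {R : Type*} [CommRing R] {α : R} {p T N : ℤ}
    (h : IsQuadOrderGen α T N) (hp : Prime p) (hroot : HasNoRoot T N p) :
    (Ideal.span {(p : R)}).IsPrime := by
  refine ⟨fun htop => ?_, fun {x y} hxy => ?_⟩
  · have h1 : ((1 : ℤ) : R) + (0 : ℤ) * α ∈ Ideal.span {(p : R)} := by rw [htop]; trivial
    exact hp.not_dvd_one (h.mem_span_intCast.1 h1).1
  · by_cases hx : x ∈ Ideal.span {(p : R)}
    · exact Or.inl hx
    · right
      obtain ⟨a, b, rfl⟩ := h.span x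
      refine Ideal.mem_of_isCoprime_mul_mem (h.isCoprime_quadNorm hp hroot hx 1) ?_ ?_
      · rw [← h.mul_conj a b, mul_right_comm]
        exact Ideal.mul_mem_right _ _ hxy
      · rw [pow_one]
        exact Ideal.mul_mem_right _ _ (Ideal.mem_span_singleton_self _)

theorem IsQuadOrderGen.isAbsorbingProduct_of_hasNoRoot {R : Type*} [CommRing R] {α : R} {p T N : ℤ}
    (h : IsQuadOrderGen α T N) (hp : Prime p) (hroot : HasNoRoot T N p) {n : ℕ} (hn : 0 < n)
    (j : ℕ) (I : Ideal R) (hj : (p : R) ^ j ∈ I) : IsAbsorbingProduct n I := by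
  have hprime := h.isPrime_span hp hroot
  induction j generalizing I with
  | zero =>
    rw [pow_zero, ← Ideal.eq_top_iff_one] at hj
    rw [hj]; exact isAbsorbingProduct_top n
  | succ j ih =>
    by_cases hI : I ≤ Ideal.span {(p : R)}
    · obtain ⟨J, rfl, hJ⟩ := Ideal.exists_eq_span_singleton_mul hI
      exact (isNAbsorbing_of_isPrime hn hprime).isAbsorbingProduct.mul
        (ih J (hJ _ (by rwa [← pow_succ'])))
    · obtain ⟨x, hx, hxp⟩ := Set.not_subset.1 hI
      obtain ⟨a, b, rfl⟩ := h.span x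
      have : I = ⊤ := by
        rw [Ideal.eq_top_iff_one]
        exact Ideal.one_mem_of_isCoprime (h.isCoprime_quadNorm hp hroot hxp (j + 1)) (h.quadNorm_mem hx)
          (by exact_mod_cast hj)
      rw [this]; exact isAbsorbingProduct_top n

theorem IsQuadOrderGen.conj {R : Type*} [CommRing R] {θ : R} {T N : ℤ}
    (h : IsQuadOrderGen θ T N) : IsQuadOrderGen (T - θ) T N where
  sq := by linear_combination h.sq
  indep a b hab := by
    have := h.indep (a + b * T) (-b) (by push_cast; linear_combination hab)
    have hb : b = 0 := by omega
    exact ⟨by simpa [hb] using this.1, hb⟩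
  span x := by
    obtain ⟨a, b, rfl⟩ := h.span x
    exact ⟨a + b * T, -b, by push_cast; ring⟩

/-- The norm of θ is pu with p ∤ u, so the product contains p² and pu, hence p. -/
theorem IsQuadOrderGen.span_pair_mul_conj {R : Type*} [CommRing R] {θ : R} {p T N : ℤ}
    (h : IsQuadOrderGen θ T N) (hp : Prime p) (hpN : p ∣ N) (hpN2 : ¬p ^ 2 ∣ N) :
    Ideal.span {(p : R), θ} * Ideal.span {(p : R), (T : R) - θ} = Ideal.span {(p : R)} := by
  obtain ⟨u, rfl⟩ := hpN
  have hu : ¬p ∣ u := fun ⟨v, hv⟩ => hpN2 ⟨v, by rw [hv]; ring⟩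
  have hN : θ * ((T : R) - θ) = p * u := by
    have := h.sq
    push_cast at this
    linear_combination -this
  apply le_antisymm
  · rw [Ideal.span_pair_mul_span_pair, Ideal.span_le]
    rintro x (rfl | rfl | rfl | rfl)
    · exact Ideal.mul_mem_right _ _ (Ideal.mem_span_singleton_self _)
    · exact Ideal.mul_mem_right _ _ (Ideal.mem_span_singleton_self _)
    · exact Ideal.mul_mem_left _ _ (Ideal.mem_span_singleton_self _)
    · rw [hN]
      exact Ideal.mul_mem_right _ _ (Ideal.mem_span_singleton_self _)
  · rw [Ideal.span_singleton_le_iff_mem]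
    refine Ideal.mem_of_isCoprime_mul_mem (Int.isCoprime_pow_of_prime hp hu 1) ?_ ?_
    · rw [mul_comm (u : R), ← hN]
      exact Ideal.mul_mem_mul (Ideal.subset_span (by simp)) (Ideal.subset_span (by simp))
    · rw [pow_one]
      exact Ideal.mul_mem_mul (Ideal.subset_span (by simp)) (Ideal.subset_span (by simp))

theorem Ideal.exists_eq_mul_of_mul_eq_span_singleton {R : Type*} [CommRing R] [IsDomain R]
    [IsNoetherianRing R] {M M' I : Ideal R} {x : R} (hx : x ≠ 0) (hM : M ≠ ⊤)
    (hMM : M * M' = Ideal.span {x}) (hI0 : I ≠ ⊥) (hI : I ≤ M) : ∃ J, I = M * J ∧ I < J := by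
  have h1 : I * M' ≤ Ideal.span {x} := hMM ▸ Ideal.mul_mono_left hI
  obtain ⟨J, hJ, -⟩ := Ideal.exists_eq_span_singleton_mul h1
  have hIJ : I = M * J := by
    refine Ideal.span_singleton_mul_right_injective hx ?_
    show Ideal.span {x} * I = Ideal.span {x} * (M * J)
    rw [mul_left_comm, ← hJ, ← hMM]
    ring
  refine ⟨J, hIJ, lt_of_le_of_ne (hIJ ▸ Ideal.mul_le_right) fun he => ?_⟩
  -- If J = I, then I = MI, and Nakayama gives an element a ≡ 1 modulo M killing I ≠ 0; in a domain
  -- a = 0, so M is the unit ideal.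
  obtain ⟨a, ha, haI⟩ := Submodule.exists_sub_one_mem_and_smul_eq_zero_of_fg_of_le_smul M I
    (IsNoetherian.noetherian I) (by rw [smul_eq_mul]; nth_rw 2 [he]; exact hIJ.le)
  obtain ⟨y, hy, hy0⟩ := Submodule.exists_mem_ne_zero_of_ne_bot hI0
  have : a = 0 := (mul_eq_zero.1 (haI y hy)).resolve_right hy0
  rw [this, zero_sub] at ha
  exact hM ((Ideal.eq_top_iff_one _).2 (by simpa using M.neg_mem ha))

/-- A proper ideal containing a power of p lies in (p, θ) or in its conjugate. Both are invertible,
so one of them splits off and leaves a strictly larger ideal; Noetherian induction finishes. -/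
theorem IsQuadOrderGen.isAbsorbingProduct_of_dvd_norm {R : Type*} [CommRing R] [IsDomain R]
    {θ : R} {p T N : ℤ} (h : IsQuadOrderGen θ T N) (hp : Prime p) (hpN : p ∣ N)
    (hpN2 : ¬p ^ 2 ∣ N) {n : ℕ} (hn : 0 < n) (j : ℕ) (I : Ideal R) (hj : (p : R) ^ j ∈ I) :
    IsAbsorbingProduct n I := by
  have hnoeth := h.isNoetherianRing
  have hp0 : (p : R) ≠ 0 := fun h0 => hp.ne_zero (h.intCast_eq_zero h0)
  have hM := h.isMaximal_span_pair hp hpN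
  have hM' := h.conj.isMaximal_span_pair hp hpN
  have hMM := h.span_pair_mul_conj hp hpN hpN2
  induction I using IsNoetherian.induction with
  | hgt I ih =>
    have hI0 : I ≠ ⊥ := by
      rintro rfl
      exact pow_ne_zero j hp0 hj
    have step : ∀ M M' : Ideal R, M.IsMaximal → M * M' = Ideal.span {(p : R)} → I ≤ M →
        IsAbsorbingProduct n I := by
      intro M M' hM hMM hI
      obtain ⟨J, hJ, hlt⟩ :=
        Ideal.exists_eq_mul_of_mul_eq_span_singleton hp0 hM.ne_top hMM hI0 hI
      rw [hJ]
      exact (isNAbsorbing_of_isPrime hn hM.isPrime).isAbsorbingProduct.mul (ih J hlt (hlt.le hj))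
    by_cases htop : I = ⊤
    · rw [htop]; exact isAbsorbingProduct_top n
    obtain ⟨P, hP, hIP⟩ := Ideal.exists_le_maximal I htop
    have hpP : (p : R) ∈ P := hP.isPrime.mem_of_pow_mem j (hIP hj)
    have hNP : θ * ((T : R) - θ) ∈ P := by
      obtain ⟨u, rfl⟩ := hpN
      have := h.sq
      push_cast at this
      rw [show θ * ((T : R) - θ) = p * u by linear_combination -this]
      exact P.mul_mem_right _ hpP
    rcases hP.isPrime.mem_or_mem hNP with h1 | h1
    · have : Ideal.span {(p : R), θ} = P := hM.eq_of_le hP.ne_top (by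
        rw [Ideal.span_le]; rintro x (rfl | rfl) <;> assumption)
      exact step _ _ hM hMM (this ▸ hIP)
    · have : Ideal.span {(p : R), (T : R) - θ} = P := hM'.eq_of_le hP.ne_top (by
        rw [Ideal.span_le]; rintro x (rfl | rfl) <;> assumption)
      exact step _ _ hM' (by rw [mul_comm, hMM]) (this ▸ hIP)

/-- If `p` does not divide the conductor, then either `p` is inert or there is an element whose
norm is divisible by `p` exactly once. -/
theorem hasNoRoot_or_exists_exact_root {p r T N : ℤ} (hp : Prime p) (hpr : ¬p ∣ r)
    (hmax : ∀ t, p ^ 2 ∣ t * t + T * t + N → ¬p ∣ 2 * t + T) :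
    HasNoRoot (r * T) (r * r * N) p ∨
      ∃ t, p ∣ t * t + r * T * t + r * r * N ∧ ¬p ^ 2 ∣ t * t + r * T * t + r * r * N := by
  by_cases hroot : HasNoRoot (r * T) (r * r * N) p
  · exact Or.inl hroot
  right
  simp only [HasNoRoot, not_forall, not_not] at hroot
  obtain ⟨t, ht⟩ := hroot
  by_cases ht2 : p ^ 2 ∣ t * t + r * T * t + r * r * N
  swap
  · exact ⟨t, ht, ht2⟩
  by_cases htr : p ∣ 2 * t + r * T
  · exfalso
    -- Since p ∤ r, dividing t by r modulo p² yields a double root s excluded by maximality.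
    obtain ⟨s, c, hc⟩ := Int.exists_dvd_add_mul hp hpr 2 (-t)
    refine hmax s ?_ ?_
    · have hco := (Int.isCoprime_pow_of_prime hp hpr 2).symm
      refine (hco.mul_right hco).dvd_of_dvd_mul_right ?_
      obtain ⟨d, hd⟩ := ht2
      exact ⟨d + c * (t + r * s) + c * (r * T), by
        linear_combination hd + (t + r * s + r * T) * hc⟩
    · obtain ⟨d, hd⟩ := htr
      have : p ∣ r * (2 * s + T) := ⟨d + 2 * p * c, by linear_combination hd + 2 * hc⟩
      exact (hp.dvd_or_dvd this).resolve_left hpr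
  -- Passing to t + p changes the value by p(2t + rT + p), which is divisible by p exactly once.
  · refine ⟨t + p, ?_, fun hd => htr ?_⟩
    · have : p ∣ p * (2 * t + r * T + p) := Dvd.intro _ rfl
      have := dvd_add ht this
      rwa [show t * t + r * T * t + r * r * N + p * (2 * t + r * T + p) =
        (t + p) * (t + p) + r * T * (t + p) + r * r * N by ring] at this
    · obtain ⟨c, hc⟩ := hd
      obtain ⟨d, hd⟩ := ht2
      refine ⟨c - d - 1, mul_left_cancel₀ hp.ne_zero ?_⟩
      linear_combination hc - hd

/-- A nonzero ideal contains a nonzero integer; splitting it into coprime parts reduces to ideals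
containing a power of a prime p, treated according to whether p divides r and, if not, whether p is
inert. -/
theorem IsQuadOrderGen.hasAbsorbingFactorization {R : Type*} [CommRing R] [IsDomain R] {α : R}
    {r T N : ℤ} (h : IsQuadOrderGen α (r * T) (r * r * N)) (hr : r ≠ 0)
    (hmax : ∀ p : ℤ, Prime p → ∀ t, p ^ 2 ∣ t * t + T * t + N → ¬p ∣ 2 * t + T) {n : ℕ} (hn : 0 < n)
    (hloc : ∀ p : ℤ, Prime p → p ∣ r → ∃ ε : ℕ,
      (∀ a b, p ^ (ε + 1) ∣ quadNorm T N a b → p ∣ a ∧ p ∣ b) ∧ ∀ k, p ^ k ∣ r → 2 * k + ε ≤ n) :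
    HasAbsorbingFactorization R n := by
  have hprim : ∀ p : ℤ, Prime p → ∀ (j : ℕ) (I : Ideal R), (p : R) ^ j ∈ I →
      IsAbsorbingProduct n I := by
    intro p hp j I hj
    by_cases hpr : p ∣ r
    · obtain ⟨ε, hε, hεn⟩ := hloc p hp hpr
      obtain ⟨k, m, hm, hrm⟩ := WfDvdMonoid.max_power_factor hr hp.irreducible
      have hk : 0 < k := by
        rcases Nat.eq_zero_or_pos k with rfl | hk
        · exact absurd (by simpa [hrm] using hpr) hm
        · exact hk
      have h' : IsQuadOrderGen α (p ^ k * (m * T)) (p ^ k * p ^ k * (m * m * N)) := by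
        convert h using 1 <;> rw [hrm] <;> ring
      refine h'.isAbsorbingProduct_of_dvd hp hk (ε := ε) ?_ (hεn k ⟨m, hrm⟩) j I hj
      intro a b hab
      rw [quadNorm_mul_left] at hab
      exact (hε _ _ hab).imp id fun hd => (hp.dvd_or_dvd hd).resolve_left hm
    · rcases hasNoRoot_or_exists_exact_root hp hpr (hmax p hp) with hroot | ⟨t, ht, ht2⟩
      · exact h.isAbsorbingProduct_of_hasNoRoot hp hroot hn j I hj
      · refine (h.shift t).isAbsorbingProduct_of_dvd_norm hp ?_ ?_ hn j I hj
        · rwa [show r * r * N + r * T * t + t * t = t * t + r * T * t + r * r * N by ring]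
        · rwa [show r * r * N + r * T * t + t * t = t * t + r * T * t + r * r * N by ring]
  have hnat : ∀ c : ℕ, c ≠ 0 → ∀ I : Ideal R, (c : R) ∈ I → IsAbsorbingProduct n I := by
    intro c
    induction c using Nat.recOnPosPrimePosCoprime with
    | prime_pow p j hp hj =>
      intro _ I hI
      exact hprim p (Nat.prime_iff_prime_int.1 hp) j I (by exact_mod_cast hI)
    | zero => exact fun h0 => absurd rfl h0
    | one =>
      intro _ I hI
      rw [Nat.cast_one, ← Ideal.eq_top_iff_one] at hI
      rw [hI]; exact isAbsorbingProduct_top n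
    | coprime a b ha hb hab iha ihb =>
      intro _ I hI
      rw [Ideal.eq_sup_span_mul_sup_span (I := I) (Nat.isCoprime_iff_coprime.2 hab)
        (by exact_mod_cast hI)]
      exact (iha (by omega) _ (Ideal.mem_sup_right (by simp))).mul
        (ihb (by omega) _ (Ideal.mem_sup_right (by simp)))
  intro I _
  by_cases hI0 : I = ⊥
  · exact (isNAbsorbing_of_isPrime hn (hI0 ▸ Ideal.isPrime_bot)).isAbsorbingProduct
  · obtain ⟨c, hc, hcI⟩ := h.exists_intCast_mem hI0
    refine hnat c.natAbs (Int.natAbs_ne_zero.2 hc) I ?_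
    rw [← Int.cast_natCast]
    rcases Int.natAbs_eq c with h' | h'
    · rwa [← h']
    · rw [h', Int.cast_neg] at hcI
      simpa only [neg_neg] using I.neg_mem hcI

end Sufficient

end

noncomputable section

/-! ### Localizations at maximal ideals, on and off the conductor -/

section Localizations

namespace IsQuadOrderGen

variable {R : Type*} [CommRing R] {θ : R} {T N : ℤ} (h : IsQuadOrderGen θ T N)
include h

theorem dimensionLEOne [IsDomain R] : Ring.DimensionLEOne R := by
  refine ⟨fun {P} hP0 hP => ?_⟩
  have := h.finite_int
  obtain ⟨p, hp, hpP⟩ := h.exists_prime_mem hP hP0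
  refine Ideal.isMaximal_of_isIntegral_of_isMaximal_comap (R := ℤ) P ?_
  have hpr : (P.comap (algebraMap ℤ R)).IsPrime := P.comap_isPrime _
  refine hpr.isMaximal ?_
  intro h0
  have : p ∈ P.comap (algebraMap ℤ R) := by simpa using hpP
  rw [h0] at this
  exact hp.ne_zero this

/-- A Noetherian local domain with principal maximal ideal is a valuation ring; x = 0 is allowed and
covers fields. -/
theorem valuationRing_of_map_eq [IsDomain R] (M : Ideal R) [M.IsPrime] (x : R)
    (hx : M.map (algebraMap R (Localization.AtPrime M)) =
      (Ideal.span {x}).map (algebraMap R (Localization.AtPrime M))) :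
    ValuationRing (Localization.AtPrime M) := by
  have := h.isNoetherianRing
  have : IsNoetherianRing (Localization.AtPrime M) :=
    IsLocalization.isNoetherianRing M.primeCompl _ inferInstance
  refine ((tfae_of_isNoetherianRing_of_isLocalRing_of_isDomain
    (Localization.AtPrime M)).out 4 1).1 ?_
  rw [← Localization.AtPrime.map_eq_maximalIdeal, hx, Ideal.map_span, Set.image_singleton]
  exact ⟨⟨_, rfl⟩⟩

theorem valuationRing_of_dvd_norm [IsDomain R] (M : Ideal R) [M.IsPrime] {p : ℤ} (hp : Prime p)
    (hpM : (p : R) ∈ M) (hpN : p ∣ N) (hpN2 : ¬p ^ 2 ∣ N) (hθ : θ ∈ M) :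
    ValuationRing (Localization.AtPrime M) := by
  obtain ⟨u, rfl⟩ := hpN
  have hu : ¬p ∣ u := fun ⟨v, hv⟩ => hpN2 ⟨v, by rw [hv]; ring⟩
  have huM : (u : R) ∉ M := fun huM => (inferInstance : M.IsPrime).ne_top
    ((Ideal.eq_top_iff_one _).2 (Ideal.one_mem_of_isCoprime
      (Int.isCoprime_pow_of_prime hp hu 1) huM (by simpa using hpM)))
  have hM : M = Ideal.span {(p : R), θ} := ((h.isMaximal_span_pair hp (Dvd.intro _ rfl)).eq_of_le
    (inferInstance : M.IsPrime).ne_top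
    (by rw [Ideal.span_le]; rintro x (rfl | rfl) <;> assumption)).symm
  refine h.valuationRing_of_map_eq M θ (le_antisymm ?_ (Ideal.map_mono (by
    rw [Ideal.span_singleton_le_iff_mem]; exact hθ)))
  rw [Ideal.map_le_iff_le_comap]
  nth_rw 1 [hM]
  rw [Ideal.span_le]
  have hθ' : θ ∈ ((Ideal.span {θ}).map (algebraMap R (Localization.AtPrime M))).comap
      (algebraMap R (Localization.AtPrime M)) :=
    Ideal.mem_map_of_mem _ (Ideal.mem_span_singleton_self θ)
  rintro x (rfl | rfl)
  · have hunit : IsUnit (algebraMap R (Localization.AtPrime M) u) :=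
      IsLocalization.map_units _ (⟨u, huM⟩ : M.primeCompl)
    rw [SetLike.mem_coe, Ideal.mem_comap, ← Ideal.unit_mul_mem_iff_mem _ hunit, ← map_mul]
    -- Since u is a unit at M, this relation makes p a multiple of θ, so θ alone generates the
    -- maximal ideal of the localization.
    have he : (u : R) * p = θ * (T - θ) := by
      have := h.sq
      push_cast at this
      linear_combination this
    rw [he]
    exact Ideal.mul_mem_right (T - θ) _ hθ'
  · exact hθ'

theorem valuationRing_of_hasNoRoot [IsDomain R] (M : Ideal R) [M.IsPrime] {p : ℤ} (hp : Prime p)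
    (hpM : (p : R) ∈ M) (hroot : HasNoRoot T N p) : ValuationRing (Localization.AtPrime M) := by
  have hM : M = Ideal.span {(p : R)} := by
    refine le_antisymm (fun x hx => ?_) (by rwa [Ideal.span_singleton_le_iff_mem])
    obtain ⟨a, b, rfl⟩ := h.span x
    by_contra hxp
    refine (inferInstance : M.IsPrime).ne_top ((Ideal.eq_top_iff_one _).2
      (Ideal.one_mem_of_isCoprime (Int.isCoprime_pow_of_prime hp (fun hd => hxp ?_) 1)
        (h.quadNorm_mem hx) (by simpa using hpM)))
    exact h.mem_span_intCast.2 (hroot.dvd_of_dvd_quadNorm hp hd)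
  exact h.valuationRing_of_map_eq M p (by rw [← hM])

end IsQuadOrderGen

theorem IsQuadOrderGen.valuationRing_of_notMem {R : Type*} [CommRing R] [IsDomain R] {α : R}
    {r T N : ℤ} (h : IsQuadOrderGen α (r * T) (r * r * N))
    (hmax : ∀ p : ℤ, Prime p → ∀ t, p ^ 2 ∣ t * t + T * t + N → ¬p ∣ 2 * t + T)
    (M : Ideal R) [M.IsMaximal] (hrM : (r : R) ∉ M) : ValuationRing (Localization.AtPrime M) := by
  have hM : M.IsPrime := inferInstance
  by_cases hM0 : M = ⊥
  · refine h.valuationRing_of_map_eq M 0 ?_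
    have : (Ideal.span {(0 : R)}) = M := by rw [hM0]; simp
    rw [this]
  obtain ⟨p, hp, hpM⟩ := h.exists_prime_mem hM hM0
  have hpr : ¬p ∣ r := by
    rintro ⟨c, rfl⟩
    exact hrM (by push_cast; exact M.mul_mem_right _ hpM)
  rcases hasNoRoot_or_exists_exact_root hp hpr (hmax p hp) with hroot | ⟨t, ht, ht2⟩
  · exact h.valuationRing_of_hasNoRoot M hp hpM hroot
  · rw [show t * t + r * T * t + r * r * N = r * r * N + r * T * t + t * t by ring] at ht ht2
    have hs := h.shift t
    -- The norm of α + t is divisible by p, so α + t or its conjugate lies in M and serves as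
    -- uniformizer.
    have hNM : (α + t) * (((r * T + 2 * t : ℤ) : R) - (α + t)) ∈ M := by
      obtain ⟨u, hu⟩ := ht
      have := hs.sq
      rw [hu] at this
      push_cast at this ⊢
      rw [show (α + t) * (r * T + 2 * t - (α + t)) = (p : R) * u by linear_combination -this]
      exact M.mul_mem_right _ hpM
    rcases hM.mem_or_mem hNM with h1 | h1
    · exact hs.valuationRing_of_dvd_norm M hp hpM ht ht2 h1
    · exact hs.conj.valuationRing_of_dvd_norm M hp hpM ht ht2 h1

/-- `θ` is a root of `X² - T X + N` and `1, θ` is a basis of `K` over the field of fractions of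
`ℤ`. -/
structure IsQuadFieldGen {K : Type*} [Field K] (θ : K) (T N : ℤ) : Prop
    extends IsQuadElement θ T N where
  span : ∀ z : K, ∃ a b d : ℤ, d ≠ 0 ∧ (d : K) * z = a + b * θ

theorem IsQuadOrderGen.isQuadFieldGen {R K : Type*} [CommRing R] [IsDomain R] [Field K] {α : R}
    {c T N : ℤ} (h : IsQuadOrderGen α (c * T) (c * c * N)) (hc : c ≠ 0) (φ : R →+* K)
    (hφ : Function.Injective φ) (hfrac : ∀ z : K, ∃ x y : R, y ≠ 0 ∧ φ y * z = φ x) {θ : K}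
    (hθ : φ α = c * θ) : IsQuadFieldGen θ T N := by
  have hcK : ∀ c : ℤ, c ≠ 0 → (c : K) ≠ 0 := by
    intro c hc h0
    exact hc (h.intCast_eq_zero (hφ (by simpa using h0)))
  refine ⟨⟨?_, ?_⟩, ?_⟩
  · have h1 := congrArg φ h.sq
    simp only [map_mul, map_sub, map_intCast, hθ] at h1
    push_cast at h1
    have h2 : (c : K) * c ≠ 0 := mul_ne_zero (hcK c hc) (hcK c hc)
    refine mul_left_cancel₀ h2 ?_
    linear_combination h1
  · intro a b hab
    have := h.indep (c * a) b (hφ (by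
      simp only [map_add, map_mul, map_intCast, map_zero, hθ]
      push_cast
      linear_combination (c : K) * hab))
    exact ⟨(mul_eq_zero.1 this.1).resolve_left hc, this.2⟩
  · intro z
    obtain ⟨x, y, hy, hyz⟩ := hfrac z
    obtain ⟨u, v, rfl⟩ := h.span y
    obtain ⟨a, b, hab⟩ := h.span (x * (((u + v * (c * T) : ℤ) : R) + ((-v : ℤ) : R) * α))
    refine ⟨a, b * c, _, h.quadNorm_ne_zero hy, ?_⟩
    have h1 := congrArg φ (h.mul_conj u v)
    have h2 := congrArg φ hab
    simp only [map_add, map_mul, map_intCast, hθ] at h1 h2 hyz ⊢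
    rw [← h1]
    push_cast at h2 ⊢
    linear_combination (((u : K) + v * (c * T)) + (-v) * (c * θ)) * hyz + h2

/-- The elements `z` with `s z ∈ c ℤ + d ℤ θ` for some `s` prime to `p`. -/
def localLattice {K : Type*} [Field K] (p : ℤ) (θ : K) (c d : ℤ) : Set K :=
  {z | ∃ a b s : ℤ, ¬p ∣ s ∧ (s : K) * z = ((c * a : ℤ) : K) + ((d * b : ℤ) : K) * θ}

section

variable {R : Type*} [CommRing R]

theorem algebraMap_comp_injective [IsDomain R] (M : Ideal R) [M.IsPrime] (A K : Type*)
    [CommRing A] [Algebra R A] [IsLocalization.AtPrime A M] [Field K] [Algebra A K]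
    [IsFractionRing A K] : Function.Injective ((algebraMap A K).comp (algebraMap R A)) :=
  (IsFractionRing.injective A K).comp
    (IsLocalization.injective A M.primeCompl_le_nonZeroDivisors)

theorem exists_mul_algebraMap_comp [IsDomain R] (M : Ideal R) [M.IsPrime] (A : Type*) {K : Type*}
    [CommRing A] [Algebra R A] [IsLocalization.AtPrime A M] [Field K] [Algebra A K]
    [IsFractionRing A K] (z : K) : ∃ x y : R, y ≠ 0 ∧
      (algebraMap A K).comp (algebraMap R A) y * z = (algebraMap A K).comp (algebraMap R A) x := by
  obtain ⟨u, v, hv, rfl⟩ := IsFractionRing.div_surjective (A := A) z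
  obtain ⟨a, s, rfl⟩ := IsLocalization.exists_mk'_eq M.primeCompl u
  obtain ⟨b, t, rfl⟩ := IsLocalization.exists_mk'_eq M.primeCompl v
  have : Nontrivial A := (algebraMap A K).domain_nontrivial
  have hv0 : algebraMap A K (IsLocalization.mk' A b t) ≠ 0 :=
    IsFractionRing.to_map_ne_zero_of_mem_nonZeroDivisors hv
  have e1 : (algebraMap A K).comp (algebraMap R A) s * algebraMap A K (IsLocalization.mk' A a s) =
      (algebraMap A K).comp (algebraMap R A) a := by
    simp only [RingHom.comp_apply]
    rw [← map_mul, IsLocalization.mk'_spec']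
  have e2 : (algebraMap A K).comp (algebraMap R A) t * algebraMap A K (IsLocalization.mk' A b t) =
      (algebraMap A K).comp (algebraMap R A) b := by
    simp only [RingHom.comp_apply]
    rw [← map_mul, IsLocalization.mk'_spec']
  refine ⟨a * t, s * b, ?_, ?_⟩
  · refine mul_ne_zero (fun h0 => s.2 (h0 ▸ M.zero_mem)) fun h0 => ?_
    rw [h0, IsLocalization.mk'_zero, map_zero] at hv0
    exact hv0 rfl
  · rw [map_mul, map_mul, ← e1, ← e2]
    field_simp

variable {α : R} {p T N : ℤ} (M : Ideal R)

theorem IsQuadOrderGen.notMem_iff (h : IsQuadOrderGen α T N) (hpN : p ∣ N)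
    (hM : M = Ideal.span {(p : R), α}) {a b : ℤ} : (a : R) + b * α ∉ M ↔ ¬p ∣ a := by
  rw [hM, not_iff_not, h.mem_span_pair hpN]
  constructor
  · rintro ⟨u, v, huv⟩
    exact ⟨u, (h.ext_iff huv).1⟩
  · rintro ⟨u, rfl⟩
    exact ⟨u, b, rfl⟩

/-- The norm of a + bα is congruent to a² modulo p. Hence denominators outside M may be replaced by
integers prime to p, which is what puts the localization in the form of a `localLattice`. -/
theorem IsQuadOrderGen.exists_mul_eq_intCast (h : IsQuadOrderGen α T N) (hp : Prime p)
    (hpT : p ∣ T) (hpN : p ∣ N) (hM : M = Ideal.span {(p : R), α}) {x : R} (hx : x ∉ M) :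
    ∃ (y : R) (s : ℤ), ¬p ∣ s ∧ x * y = s := by
  obtain ⟨a, b, rfl⟩ := h.span x
  refine ⟨_, _, ?_, h.mul_conj a b⟩
  rw [h.notMem_iff M hpN hM] at hx
  intro hd
  apply hx
  have h1 : p ∣ a * b * T + b * b * N := dvd_add (hpT.mul_left _) (hpN.mul_left _)
  have := dvd_sub hd h1
  rw [show quadNorm T N a b - (a * b * T + b * b * N) = a * a by
    simp only [quadNorm]; ring] at this
  exact (hp.dvd_or_dvd this).elim id id

variable [IsDomain R] [M.IsPrime] (A : Type*) {K : Type*} [CommRing A] [Algebra R A]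
  [IsLocalization.AtPrime A M] [Field K] [Algebra A K] [IsFractionRing A K]
variable (h : IsQuadOrderGen α T N) (hp : Prime p) (hpT : p ∣ T) (hpN : p ∣ N)
  (hM : M = Ideal.span {(p : R), α})
include h hp hpT hpN hM

theorem IsQuadOrderGen.mem_idealImage_map_iff (I : Ideal R) (z : K) :
    z ∈ idealImage K (I.map (algebraMap R A)) ↔
    ∃ x ∈ I, ∃ s : ℤ, ¬p ∣ s ∧ (s : K) * z = (algebraMap A K).comp (algebraMap R A) x := by
  constructor
  · rintro ⟨w, hw, rfl⟩
    obtain ⟨⟨x, s⟩, hxs⟩ := (IsLocalization.mem_map_algebraMap_iff M.primeCompl A).1 hw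
    obtain ⟨y, n, hn, hy⟩ := h.exists_mul_eq_intCast M hp hpT hpN hM s.2
    refine ⟨y * x, I.mul_mem_left _ x.2, n, hn, ?_⟩
    have h1 := congrArg ((algebraMap A K).comp (algebraMap R A)) hy
    have h2 := congrArg (algebraMap A K) hxs
    rw [map_mul] at h2
    rw [map_mul, map_intCast] at h1
    rw [← h1, map_mul]
    simp only [RingHom.comp_apply] at h2 ⊢
    linear_combination (algebraMap A K (algebraMap R A y)) * h2
  · rintro ⟨x, hx, s, hs, hsz⟩
    have hsM : (s : R) ∉ M := by
      have := (h.notMem_iff M hpN hM (a := s) (b := 0)).2 hs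
      simpa using this
    refine ⟨IsLocalization.mk' A x (⟨s, hsM⟩ : M.primeCompl), ?_, ?_⟩
    · rw [SetLike.mem_coe, IsLocalization.mk'_mem_iff]
      exact Ideal.mem_map_of_mem _ hx
    · have hs0 : (s : K) ≠ 0 := by
        intro h0
        have : (algebraMap A K).comp (algebraMap R A) (s : R) =
            (algebraMap A K).comp (algebraMap R A) 0 := by
          rw [map_intCast, map_zero, h0]
        rw [algebraMap_comp_injective M A K this] at hsM
        exact hsM M.zero_mem
      refine mul_left_cancel₀ hs0 ?_
      rw [hsz]
      have : (s : K) = algebraMap A K (algebraMap R A s) := by simp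
      rw [this, ← map_mul]
      simp only [RingHom.comp_apply]
      congr 1
      exact IsLocalization.mk'_spec' A x (⟨s, hsM⟩ : M.primeCompl)

theorem IsQuadOrderGen.idealImage_maximalIdeal [IsLocalRing A] {c : ℤ} {θ : K}
    (hθ : (algebraMap A K).comp (algebraMap R A) α = c * θ) :
    idealImage K (IsLocalRing.maximalIdeal A) = localLattice p θ p c := by
  ext z
  rw [← IsLocalization.AtPrime.map_eq_maximalIdeal M A,
    h.mem_idealImage_map_iff M A hp hpT hpN hM]
  constructor
  · rintro ⟨x, hx, s, hs, hsz⟩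
    rw [hM] at hx
    obtain ⟨a, b, rfl⟩ := (h.mem_span_pair hpN).1 hx
    refine ⟨a, b, s, hs, ?_⟩
    rw [hsz, map_add, map_mul, map_intCast, map_intCast, hθ]
    push_cast; ring
  · rintro ⟨a, b, s, hs, hsz⟩
    refine ⟨((p * a : ℤ) : R) + b * α, ?_, s, hs, ?_⟩
    · have := (h.mem_span_pair hpN).2 ⟨a, b, rfl⟩
      rwa [← hM] at this
    · rw [hsz, map_add, map_mul, map_intCast, map_intCast, hθ]
      push_cast; ring

theorem IsQuadOrderGen.range_algebraMap {c : ℤ} {θ : K}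
    (hθ : (algebraMap A K).comp (algebraMap R A) α = c * θ) :
    Set.range (algebraMap A K) = localLattice p θ 1 c := by
  have h0 : Set.range (algebraMap A K) = idealImage K ((⊤ : Ideal R).map (algebraMap R A)) := by
    rw [Ideal.map_top, idealImage, Submodule.top_coe, Set.image_univ]
  rw [h0]
  ext z
  rw [h.mem_idealImage_map_iff M A hp hpT hpN hM]
  constructor
  · rintro ⟨x, hx, s, hs, hsz⟩
    obtain ⟨a, b, rfl⟩ := h.span x
    refine ⟨a, b, s, hs, ?_⟩
    rw [hsz, map_add, map_mul, map_intCast, map_intCast, hθ]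
    push_cast; ring
  · rintro ⟨a, b, s, hs, hsz⟩
    refine ⟨(a : R) + b * α, trivial, s, hs, ?_⟩
    rw [hsz, map_add, map_mul, map_intCast, map_intCast, hθ]
    push_cast; ring

end

end Localizations

end

noncomputable section

/-! ### The local lattice V = ℤ_(p) + θ ℤ_(p) as a valuation ring -/

section LocalLattices

variable {K : Type*} [Field K] {θ : K} {p T N : ℤ}

theorem IsQuadElement.intCast_ne_zero (h : IsQuadElement θ T N) {a : ℤ} (ha : a ≠ 0) :
    (a : K) ≠ 0 :=
  fun h0 => ha (h.intCast_eq_zero h0)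

theorem mem_localLattice_self_iff {p c : ℤ} {z : K} (hc : (c : K) ≠ 0) :
    z ∈ localLattice p θ c c ↔ z / c ∈ localLattice p θ 1 1 := by
  constructor
  · rintro ⟨a, b, s, hs, hz⟩
    refine ⟨a, b, s, hs, ?_⟩
    push_cast at hz ⊢
    field_simp
    linear_combination hz
  · rintro ⟨a, b, s, hs, hz⟩
    refine ⟨a, b, s, hs, ?_⟩
    push_cast at hz ⊢
    field_simp at hz
    linear_combination hz

theorem intCast_add_mul_mem_localLattice (hp : Prime p) (a b : ℤ) :
    (a : K) + b * θ ∈ localLattice p θ 1 1 :=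
  ⟨a, b, 1, hp.not_dvd_one, by push_cast; ring⟩

theorem localLattice_subset_of_dvd {c d : ℤ} (hcd : c ∣ d) :
    localLattice p θ c d ⊆ localLattice p θ c c := by
  obtain ⟨e, rfl⟩ := hcd
  rintro z ⟨a, b, s, hs, hz⟩
  exact ⟨a, e * b, s, hs, by rw [hz]; push_cast; ring⟩

theorem IsQuadElement.mul_mem_localLattice (h : IsQuadElement θ T N) (hp : Prime p) {c : ℤ}
    {x y : K} (hx : x ∈ localLattice p θ 1 1) (hy : y ∈ localLattice p θ c c) :
    x * y ∈ localLattice p θ c c := by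
  obtain ⟨a, b, s, hs, hx⟩ := hx
  obtain ⟨a', b', s', hs', hy⟩ := hy
  refine ⟨a * a' - b * b' * N, a * b' + b * a' + b * b' * T, s * s',
    fun hd => (hp.dvd_or_dvd hd).elim hs hs', ?_⟩
  have h1 : ((s * s' : ℤ) : K) * (x * y) = (s * x) * (s' * y) := by push_cast; ring
  rw [h1, hx, hy]
  have h2 := h.sq
  push_cast
  linear_combination ((b : K) * b' * c) * h2

theorem add_mem_localLattice (hp : Prime p) {c d : ℤ} {x y : K} (hx : x ∈ localLattice p θ c d)
    (hy : y ∈ localLattice p θ c d) : x + y ∈ localLattice p θ c d := by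
  obtain ⟨a, b, s, hs, hx⟩ := hx
  obtain ⟨a', b', s', hs', hy⟩ := hy
  refine ⟨a * s' + a' * s, b * s' + b' * s, s * s',
    fun hd => (hp.dvd_or_dvd hd).elim hs hs', ?_⟩
  push_cast at hx hy ⊢
  linear_combination (s' : K) * hx + (s : K) * hy

theorem IsQuadElement.pow_mem_localLattice (h : IsQuadElement θ T N) (hp : Prime p) {x : K}
    (hx : x ∈ localLattice p θ 1 1) (m : ℕ) : x ^ m ∈ localLattice p θ 1 1 := by
  induction m with
  | zero => exact ⟨1, 0, 1, hp.not_dvd_one, by simp⟩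
  | succ m ih => rw [pow_succ]; exact h.mul_mem_localLattice hp ih hx

/-- Descent on the size of the denominator: common factors p are cancelled. -/
theorem IsQuadFieldGen.exists_primitive (h : IsQuadFieldGen θ T N) (hp : Prime p) (z : K) :
    ∃ a b d : ℤ, d ≠ 0 ∧ (d : K) * z = a + b * θ ∧ ¬(p ∣ a ∧ p ∣ b ∧ p ∣ d) := by
  obtain ⟨a, b, d, hd, hz⟩ := h.span z
  induction hn : d.natAbs using Nat.strong_induction_on generalizing a b d with
  | _ n ih =>
    by_cases hall : p ∣ a ∧ p ∣ b ∧ p ∣ d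
    · obtain ⟨⟨a, rfl⟩, ⟨b, rfl⟩, ⟨d, rfl⟩⟩ := hall
      have hd0 : d ≠ 0 := right_ne_zero_of_mul hd
      refine ih d.natAbs ?_ a b d hd0 ?_ rfl
      · rw [← hn, Int.natAbs_mul]
        have h1 : 2 ≤ p.natAbs := (Int.prime_iff_natAbs_prime.1 hp).two_le
        have h2 : 0 < d.natAbs := Int.natAbs_pos.2 hd0
        nlinarith
      · refine mul_left_cancel₀ (h.intCast_ne_zero hp.ne_zero) ?_
        push_cast at hz
        linear_combination hz
    · exact ⟨a, b, d, hd, hz, hall⟩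

/-- Take a primitive representation of z with p ∣ d. Its numerator has norm not divisible by p², and
z⁻¹ is d times the conjugate over that norm, so the factor p of d cancels the only possible p in the
denominator. -/
theorem IsQuadFieldGen.mem_or_inv_mem_localLattice (h : IsQuadFieldGen θ T N) (hp : Prime p)
    (hsq : ∀ a b, p ^ 2 ∣ quadNorm T N a b → p ∣ a ∧ p ∣ b) (z : K) :
    z ∈ localLattice p θ 1 1 ∨ z⁻¹ ∈ localLattice p θ 1 1 := by
  obtain ⟨a, b, d, hd, hz, hprim⟩ := h.exists_primitive hp z
  by_cases hpd : p ∣ d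
  swap
  · exact Or.inl ⟨a, b, d, hpd, by rw [hz]; push_cast; ring⟩
  by_cases hz0 : z = 0
  · rw [hz0]
    exact Or.inl ⟨0, 0, 1, hp.not_dvd_one, by simp⟩
  right
  have hn : ¬p ^ 2 ∣ quadNorm T N a b := fun hdv =>
    hprim ⟨(hsq a b hdv).1, (hsq a b hdv).2, hpd⟩
  have key := h.mul_conj a b
  rw [← hz] at key
  have hinv : (quadNorm T N a b : K) * z⁻¹ = d * (((a + b * T : ℤ) : K) + ((-b : ℤ) : K) * θ) := by
    rw [← key]; field_simp
  by_cases hpn : p ∣ quadNorm T N a b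
  · obtain ⟨n, hn'⟩ := hpn
    obtain ⟨d, rfl⟩ := hpd
    refine ⟨d * (a + b * T), d * -b, n, ?_, ?_⟩
    · rintro ⟨n', rfl⟩
      exact hn ⟨n', by rw [hn']; ring⟩
    · rw [hn'] at hinv
      refine mul_left_cancel₀ (h.intCast_ne_zero hp.ne_zero) ?_
      push_cast at hinv ⊢
      linear_combination hinv
  · refine ⟨d * (a + b * T), d * -b, _, hpn, ?_⟩
    rw [hinv]; push_cast; ring

theorem IsQuadElement.dvd_quadNorm_of_inv_notMem (h : IsQuadElement θ T N) {w : K}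
    {a b s : ℤ} (hw : (s : K) * w = a + b * θ) (hw' : w⁻¹ ∉ localLattice p θ 1 1) :
    p ∣ quadNorm T N a b := by
  by_contra hpn
  apply hw'
  by_cases hw0 : w = 0
  · refine ⟨0, 0, _, hpn, ?_⟩
    simp [hw0]
  have key := h.mul_conj a b
  rw [← hw] at key
  refine ⟨s * (a + b * T), s * -b, _, hpn, ?_⟩
  rw [← key]
  push_cast
  field_simp

/-- If the local lattice `V` spanned by `1, θ` is a valuation ring, and the `e`-th powers of its
nonunits lie in `p V`, then `p V` is strongly primary with exponent `e`. -/
theorem IsQuadFieldGen.mem_or_pow_mem_localLattice (h : IsQuadFieldGen θ T N) (hp : Prime p)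
    (hsq : ∀ a b, p ^ 2 ∣ quadNorm T N a b → p ∣ a ∧ p ∣ b) {e : ℕ}
    (he : ∀ w ∈ localLattice p θ 1 1, w⁻¹ ∉ localLattice p θ 1 1 → w ^ e ∈ localLattice p θ p p)
    {x y : K} (hxy : x * y ∈ localLattice p θ p p) :
    x ∈ localLattice p θ p p ∨ y ^ e ∈ localLattice p θ p p := by
  have hpK := h.intCast_ne_zero hp.ne_zero
  by_cases hx : x ∈ localLattice p θ p p
  · exact Or.inl hx
  right
  rw [mem_localLattice_self_iff hpK] at hx
  have hx0 : x ≠ 0 := by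
    rintro rfl
    exact hx ⟨0, 0, 1, hp.not_dvd_one, by simp⟩
  -- The inverse w of x/p is a nonunit of V, and y = (xy/p) w with xy/p ∈ V.
  have hw := (h.mem_or_inv_mem_localLattice hp hsq (x / p)).resolve_left hx
  have hwe := he _ hw (by rwa [inv_inv])
  rw [mem_localLattice_self_iff hpK] at hxy
  have : y ^ e = (x * y / p) ^ e * ((x / p)⁻¹) ^ e := by
    rw [← mul_pow]; congr 1; field_simp
  rw [this]
  exact h.mul_mem_localLattice hp (h.pow_mem_localLattice hp hxy e) hwe

theorem IsQuadElement.mem_localLattice_of_inv_notMem (h : IsQuadElement θ T N)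
    (hno : ∀ a b, p ∣ quadNorm T N a b → p ∣ a ∧ p ∣ b) {w : K} (hw : w ∈ localLattice p θ 1 1)
    (hw' : w⁻¹ ∉ localLattice p θ 1 1) : w ∈ localLattice p θ p p := by
  obtain ⟨a, b, s, hs, hw⟩ := hw
  rw [one_mul, one_mul] at hw
  obtain ⟨⟨a, rfl⟩, ⟨b, rfl⟩⟩ := hno a b (h.dvd_quadNorm_of_inv_notMem hw hw')
  exact ⟨a, b, s, hs, hw⟩

/-- The numerator of a nonunit has norm and trace divisible by p, and its square is trace times
itself minus norm. -/
theorem IsQuadElement.sq_mem_localLattice_of_inv_notMem (h : IsQuadElement θ T N) (hp : Prime p)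
    (htr : ∀ a b, p ∣ quadNorm T N a b → p ∣ 2 * a + b * T) {w : K}
    (hw : w ∈ localLattice p θ 1 1) (hw' : w⁻¹ ∉ localLattice p θ 1 1) :
    w ^ 2 ∈ localLattice p θ p p := by
  obtain ⟨a, b, s, hs, hw⟩ := hw
  rw [one_mul, one_mul] at hw
  have hn := h.dvd_quadNorm_of_inv_notMem hw hw'
  obtain ⟨t, ht⟩ := htr a b hn
  obtain ⟨n, hn⟩ := hn
  refine ⟨t * a - n, t * b, s * s, fun hd => (hp.dvd_or_dvd hd).elim hs hs, ?_⟩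
  have h1 : ((s * s : ℤ) : K) * w ^ 2 = (s * w) * (s * w) := by push_cast; ring
  have h2 : ((p * (t * a - n) : ℤ) : K) + ((p * (t * b) : ℤ) : K) * θ =
      ((p * t : ℤ) : K) * (a + b * θ) - ((p * n : ℤ) : K) := by push_cast; ring
  rw [h1, hw, h2, ← ht, ← hn]
  have h3 := h.sq
  simp only [quadNorm]
  push_cast
  linear_combination ((b : K) * b) * h3

theorem mul_mem_localLattice_one {c : ℤ} {z : K} (hz : z ∈ localLattice p θ 1 1) :
    (c : K) * z ∈ localLattice p θ 1 c := by
  obtain ⟨a, b, s, hs, hz⟩ := hz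
  refine ⟨c * a, b, s, hs, ?_⟩
  push_cast at hz ⊢
  linear_combination (c : K) * hz

end LocalLattices

/-! ### PVD, APVD and conducivity of the localizations -/

section LocalProperties

/-- The generator is θ = α/p^k, not α/r: the prime-to-p part m of r is absorbed into the trace and
norm of θ. -/
theorem IsQuadOrderGen.exists_local_gen {R : Type*} [CommRing R] [IsDomain R] {α : R} {r T N : ℤ}
    (h : IsQuadOrderGen α (r * T) (r * r * N)) (hr : r ≠ 0) (M : Ideal R) [M.IsPrime]
    (hrM : (r : R) ∈ M) (A K : Type*) [CommRing A] [Algebra R A]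
    [IsLocalization.AtPrime A M] [IsLocalRing A] [Field K] [Algebra A K] [IsFractionRing A K] :
    ∃ (p : ℤ) (k : ℕ) (m : ℤ) (θ : K), Prime p ∧ 0 < k ∧ r = p ^ k * m ∧ ¬p ∣ m ∧
      IsQuadFieldGen θ (m * T) (m * m * N) ∧
      Set.range (algebraMap A K) = localLattice p θ 1 (p ^ k) ∧
      idealImage K (IsLocalRing.maximalIdeal A) = localLattice p θ p (p ^ k) := by
  have hM : M.IsPrime := inferInstance
  have hM0 : M ≠ ⊥ := by
    rintro rfl
    exact hr (h.intCast_eq_zero hrM)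
  obtain ⟨p, hp, hpM⟩ := h.exists_prime_mem hM hM0
  have hpr : p ∣ r := by
    by_contra hpr
    exact hM.ne_top ((Ideal.eq_top_iff_one _).2 (Ideal.one_mem_of_isCoprime
      (Int.isCoprime_pow_of_prime hp hpr 1) hrM (by simpa using hpM)))
  obtain ⟨k, m, hm, hrm⟩ := WfDvdMonoid.max_power_factor hr hp.irreducible
  have hk : 0 < k := by
    rcases Nat.eq_zero_or_pos k with rfl | hk
    · exact absurd (by simpa [hrm] using hpr) hm
    · exact hk
  have hpk : p ∣ p ^ k := dvd_pow_self p hk.ne'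
  have h' : IsQuadOrderGen α (p ^ k * (m * T)) (p ^ k * p ^ k * (m * m * N)) := by
    convert h using 1 <;> rw [hrm] <;> ring
  have hMp := h'.eq_span_pair_of_mem hp (hpk.mul_right _) ((hpk.mul_right _).mul_right _) hM hpM
  have hpk0 : p ^ k ≠ 0 := pow_ne_zero k hp.ne_zero
  have hpkK : ((p ^ k : ℤ) : K) ≠ 0 := by
    intro h0
    apply hpk0
    refine h.intCast_eq_zero (algebraMap_comp_injective M A K ?_)
    rw [map_intCast, map_zero, h0]
  have hθ : (algebraMap A K).comp (algebraMap R A) α =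
      ((p ^ k : ℤ) : K) * ((algebraMap A K).comp (algebraMap R A) α / ((p ^ k : ℤ) : K)) := by
    field_simp
  exact ⟨p, k, m, _, hp, hk, hrm, hm,
    h'.isQuadFieldGen hpk0 _ (algebraMap_comp_injective M A K)
      (exists_mul_algebraMap_comp M A) hθ,
    h'.range_algebraMap M A hp (hpk.mul_right _) ((hpk.mul_right _).mul_right _) hMp hθ,
    h'.idealImage_maximalIdeal M A hp (hpk.mul_right _) ((hpk.mul_right _).mul_right _) hMp hθ⟩

variable {R : Type*} [CommRing R] [IsDomain R] {α : R} {r T N : ℤ}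

theorem IsQuadOrderGen.eq_bot_or_eq_maximalIdeal {T N : ℤ} (h : IsQuadOrderGen α T N) (M : Ideal R)
    [M.IsPrime] (A : Type*) [CommRing A] [IsDomain A] [Algebra R A] [IsLocalization.AtPrime A M]
    [IsLocalRing A] (P : Ideal A) (hP : P.IsPrime) : P = ⊥ ∨ P = IsLocalRing.maximalIdeal A := by
  have := h.dimensionLEOne
  have : Ring.DimensionLEOne A :=
    Ring.DimensionLEOne.localization A M.primeCompl_le_nonZeroDivisors
  by_cases hP0 : P = ⊥
  · exact Or.inl hP0
  · exact Or.inr (IsLocalRing.eq_maximalIdeal (hP.isMaximal hP0))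

theorem sq_dvd_quadNorm_mul {T N p m : ℤ} (hp : Prime p) (hm : ¬p ∣ m)
    (h : ¬HasSimpleRoot T N p) (hmax : ∀ t, p ^ 2 ∣ t * t + T * t + N → ¬p ∣ 2 * t + T) (a b : ℤ)
    (hab : p ^ 2 ∣ quadNorm (m * T) (m * m * N) a b) : p ∣ a ∧ p ∣ b := by
  rw [quadNorm_mul_left] at hab
  exact (dvd_of_sq_dvd_quadNorm hp h hmax hab).imp id fun hd => (hp.dvd_or_dvd hd).resolve_left hm

/-- Square-freeness gives k = 1, so the maximal ideal is pV; as p is inert, pV consists of all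
nonunits of V and is strongly prime. -/
theorem IsQuadOrderGen.isPVD_of_mem (h : IsQuadOrderGen α (r * T) (r * r * N)) (hr : r ≠ 0)
    (M : Ideal R) [M.IsPrime] (hrM : (r : R) ∈ M)
    (hsf : ∀ p : ℤ, Prime p → ¬p * p ∣ r)
    (hno : ∀ p : ℤ, Prime p → p ∣ r → HasNoRoot T N p) (A : Type*) [CommRing A] [IsDomain A]
    [Algebra R A] [IsLocalization.AtPrime A M] [IsLocalRing A] : IsPVD A := by
  obtain ⟨p, k, m, θ, hp, hk, rfl, hm, hθ, -, hmI⟩ :=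
    h.exists_local_gen hr M hrM A (FractionRing A)
  obtain rfl : k = 1 := by
    by_contra hk1
    refine hsf p hp (Dvd.dvd.mul_right ?_ m)
    rw [← pow_two]
    exact pow_dvd_pow p (by omega)
  rw [pow_one] at hno hmI
  have hnp := hno p hp (Dvd.intro _ rfl)
  have hno' : ∀ a b, p ∣ quadNorm (m * T) (m * m * N) a b → p ∣ a ∧ p ∣ b := by
    intro a b hab
    rw [quadNorm_mul_left] at hab
    exact (hnp.dvd_of_dvd_quadNorm hp hab).imp id fun hd => (hp.dvd_or_dvd hd).resolve_left hm
  intro P hP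
  rcases h.eq_bot_or_eq_maximalIdeal M A P hP with rfl | rfl
  · exact isStronglyPrime_bot (FractionRing A)
  · intro x y hxy
    rw [hmI] at hxy ⊢
    have := hθ.mem_or_pow_mem_localLattice hp
      (fun a b hab => hno' a b ((dvd_pow_self p two_ne_zero).trans hab)) (e := 1)
      (fun w hw hw' => by rw [pow_one]; exact hθ.mem_localLattice_of_inv_notMem hno' hw hw') hxy
    rwa [pow_one] at this

variable (h : IsQuadOrderGen α (r * T) (r * r * N)) (hr : r ≠ 0)
  (hmax : ∀ p : ℤ, Prime p → ∀ t, p ^ 2 ∣ t * t + T * t + N → ¬p ∣ 2 * t + T)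
include h hr hmax

/-- As in the inert case the maximal ideal is pV, but now only the squares of the nonunits of V need
lie in it. -/
theorem IsQuadOrderGen.isAPVD_of_mem (M : Ideal R) [M.IsPrime] (hrM : (r : R) ∈ M)
    (hsf : ∀ p : ℤ, Prime p → ¬p * p ∣ r)
    (hns : ∀ p : ℤ, Prime p → p ∣ r → ¬HasSimpleRoot T N p) (A : Type*) [CommRing A] [IsDomain A]
    [Algebra R A] [IsLocalization.AtPrime A M] [IsLocalRing A] : IsAPVD A := by
  obtain ⟨p, k, m, θ, hp, hk, rfl, hm, hθ, -, hmI⟩ :=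
    h.exists_local_gen hr M hrM A (FractionRing A)
  obtain rfl : k = 1 := by
    by_contra hk1
    refine hsf p hp (Dvd.dvd.mul_right ?_ m)
    rw [← pow_two]
    exact pow_dvd_pow p (by omega)
  rw [pow_one] at hns hmI
  have hnp := hns p hp (Dvd.intro _ rfl)
  have hsq := sq_dvd_quadNorm_mul hp hm hnp (hmax p hp)
  intro P hP
  rcases h.eq_bot_or_eq_maximalIdeal M A P hP with rfl | rfl
  · intro x y hxy
    exact (isStronglyPrime_bot (FractionRing A) x y hxy).imp id fun hy => ⟨1, one_pos, by simpa using hy⟩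
  · intro x y hxy
    rw [hmI] at hxy ⊢
    refine (hθ.mem_or_pow_mem_localLattice hp hsq (e := 2) ?_ hxy).imp id
      fun hy => ⟨2, two_pos, hy⟩
    intro w hw hw'
    refine hθ.sq_mem_localLattice_of_inv_notMem hp (fun a b hab => ?_) hw hw'
    rw [quadNorm_mul_left] at hab
    have := dvd_trace_of_dvd_quadNorm hp hnp hab
    rwa [show 2 * a + b * (m * T) = 2 * a + m * b * T by ring]

theorem IsQuadOrderGen.isConducive_of_mem (M : Ideal R) [M.IsPrime] (hrM : (r : R) ∈ M)
    (hns : ∀ p : ℤ, Prime p → p ∣ r → ¬HasSimpleRoot T N p) (A : Type*) [CommRing A] [IsDomain A]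
    [Algebra R A] [IsLocalization.AtPrime A M] [IsLocalRing A] : IsConducive A := by
  obtain ⟨p, k, m, θ, hp, hk, rfl, hm, hθ, hA, -⟩ :=
    h.exists_local_gen hr M hrM A (FractionRing A)
  have hsq := sq_dvd_quadNorm_mul hp hm
    (hns p hp ((dvd_pow_self p hk.ne').mul_right m)) (hmax p hp)
  refine isConducive_of_mul_subset (localLattice p θ 1 1) (hθ.mem_or_inv_mem_localLattice hp hsq)
    ((p ^ k : ℤ) : FractionRing A) (hθ.intCast_ne_zero (pow_ne_zero k hp.ne_zero)) ?_
  intro z hz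
  rw [hA]
  exact mul_mem_localLattice_one hz

theorem IsQuadOrderGen.isLAPVD (hsf : ∀ p : ℤ, Prime p → ¬p * p ∣ r)
    (hns : ∀ p : ℤ, Prime p → p ∣ r → ¬HasSimpleRoot T N p) : IsLAPVD R := by
  intro M hM
  by_cases hrM : (r : R) ∈ M
  · exact h.isAPVD_of_mem hr hmax M hrM hsf hns _
  · have := h.valuationRing_of_notMem hmax M hrM
    exact (isPVD_of_valuationRing _).isAPVD

theorem IsQuadOrderGen.isLocallyConducive
    (hns : ∀ p : ℤ, Prime p → p ∣ r → ¬HasSimpleRoot T N p) : IsLocallyConducive R := by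
  intro M hM
  by_cases hrM : (r : R) ∈ M
  · exact h.isConducive_of_mem hr hmax M hrM hns _
  · have := h.valuationRing_of_notMem hmax M hrM
    exact isConducive_of_valuationRing _

theorem IsQuadOrderGen.isLPVD (hsf : ∀ p : ℤ, Prime p → ¬p * p ∣ r)
    (hno : ∀ p : ℤ, Prime p → p ∣ r → HasNoRoot T N p) : IsLPVD R := by
  intro M hM
  by_cases hrM : (r : R) ∈ M
  · exact h.isPVD_of_mem hr M hrM hsf hno _
  · have := h.valuationRing_of_notMem hmax M hrM
    exact isPVD_of_valuationRing _

end LocalProperties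

/-! ### Test elements that violate the local properties -/

section LocalObstructions

/-- Powers of a root of `X² - T X + N` with `p ∤ T` or `p ∤ N` are not divisible by `p`. -/
theorem IsQuadElement.exists_pow_eq {S : Type*} [CommRing S] {β : S} {p T N : ℤ}
    (h : IsQuadElement β T N) (hp : Prime p) (hTN : ¬p ∣ N ∨ ¬p ∣ T) (m : ℕ) :
    ∃ c d : ℤ, β ^ m = c + d * β ∧ ¬(p ∣ c ∧ p ∣ d) := by
  by_cases hN : p ∣ N
  · have hT := hTN.resolve_left (not_not.2 hN)
    have : ∃ c d : ℤ, β ^ m = c + d * β ∧ ¬p ∣ c + d * T := by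
      induction m with
      | zero => exact ⟨1, 0, by simp, by simpa using hp.not_dvd_one⟩
      | succ m ih =>
        obtain ⟨c, d, hcd, hnd⟩ := ih
        refine ⟨-d * N, c + d * T, ?_, fun hd => ?_⟩
        · rw [pow_succ, hcd]
          have := h.sq
          push_cast
          linear_combination (d : S) * this
        · have h1 := dvd_add hd (hN.mul_left d)
          rw [show -d * N + (c + d * T) * T + d * N = (c + d * T) * T by ring] at h1
          exact (hp.dvd_or_dvd h1).elim hnd hT
    obtain ⟨c, d, hcd, hnd⟩ := this
    exact ⟨c, d, hcd, fun hd => hnd (dvd_add hd.1 (hd.2.mul_right T))⟩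
  · induction m with
    | zero => exact ⟨1, 0, by simp, fun hd => hp.not_dvd_one hd.1⟩
    | succ m ih =>
      obtain ⟨c, d, hcd, hnd⟩ := ih
      refine ⟨-d * N, c + d * T, ?_, fun hd => hnd ?_⟩
      · rw [pow_succ, hcd]
        have := h.sq
        push_cast
        linear_combination (d : S) * this
      · have h1 : p ∣ d * N := by
          have := hd.1
          rwa [neg_mul, dvd_neg] at this
        have h2 : p ∣ d := (hp.dvd_or_dvd h1).resolve_right hN
        have h3 := dvd_sub hd.2 (h2.mul_right T)
        rw [add_sub_cancel_right] at h3
        exact ⟨h3, h2⟩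

variable {K : Type*} [Field K] {ω : K} {p r T N : ℤ}

/-- With e = ±1, the bases 1, ω and 1, t + eω span the same lattice, so indivisibility by p can be
read off in either one. -/
theorem IsQuadElement.pow_notMem_localLattice (h : IsQuadElement ω T N) (hp : Prime p) {t e : ℤ}
    (he : e = 1 ∨ e = -1) {T' N' : ℤ} (hβ : IsQuadElement ((t : K) + e * ω) T' N')
    (hTN : ¬p ∣ N' ∨ ¬p ∣ T') (m : ℕ) : ((t : K) + e * ω) ^ m ∉ localLattice p ω p p := by
  rintro ⟨a, b, s, hs, hz⟩
  obtain ⟨c, d, hcd, hnd⟩ := hβ.exists_pow_eq hp hTN m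
  rw [hcd] at hz
  obtain ⟨h1, h2⟩ := h.ext_iff (a := s * (c + d * t)) (b := s * (d * e)) (c := p * a) (d := p * b) (by
    push_cast at hz ⊢; linear_combination hz)
  have hd : p ∣ d := by
    have : p ∣ d * e := (hp.dvd_or_dvd (Dvd.intro _ h2.symm)).resolve_left hs
    rcases he with rfl | rfl <;> simpa using this
  have hc : p ∣ c + d * t := (hp.dvd_or_dvd (Dvd.intro _ h1.symm)).resolve_left hs
  exact hnd ⟨(dvd_add_left (hd.mul_right t)).1 hc, hd⟩

theorem IsQuadElement.add_intCast (h : IsQuadElement ω T N) (t : ℤ) :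
    IsQuadElement ((t : K) + (1 : ℤ) * ω) (T + 2 * t) (N + T * t + t * t) := by
  have := h.shift t
  rwa [add_comm, ← one_mul ω, ← Int.cast_one] at this

/-- The test pair is p/β and β = t + ω, with product p. By `h1` no power of β is divisible by p, and
by `h2` the element p/β is not in the lattice. -/
theorem IsQuadElement.false_of_strongly_primary (h : IsQuadElement ω T N) (hp : Prime p)
    (hpr : p ∣ r)
    (hprim : ∀ x y : K, x * y ∈ localLattice p ω p r →
      x ∈ localLattice p ω p r ∨ ∃ m : ℕ, 0 < m ∧ y ^ m ∈ localLattice p ω p r) {t : ℤ}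
    (h1 : ¬p ∣ t * t + T * t + N ∨ ¬p ∣ 2 * t + T) (h2 : p * p ∣ r ∨ p ∣ t * t + T * t + N) :
    False := by
  have hβ := h.add_intCast t
  have hβ0 : (t : K) + (1 : ℤ) * ω ≠ 0 := fun h0 => one_ne_zero (h.indep _ _ h0).2
  have hxy : p / ((t : K) + (1 : ℤ) * ω) * ((t : K) + (1 : ℤ) * ω) ∈ localLattice p ω p r :=
    ⟨1, 0, 1, hp.not_dvd_one, by rw [div_mul_cancel₀ _ hβ0]; simp⟩
  rcases hprim _ _ hxy with hx | ⟨m, -, hm⟩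
  · obtain ⟨a, b, s, hs, hz⟩ := hx
    obtain ⟨r', rfl⟩ := hpr
    have hz' : (s : K) = (a + (r' * b) * ω) * (t + (1 : ℤ) * ω) := by
      have hpK := h.intCast_ne_zero hp.ne_zero
      refine mul_left_cancel₀ hpK ?_
      field_simp at hz
      push_cast at hz ⊢
      linear_combination hz
    -- Comparing coordinates gives s = -(r/p) b (t² + Tt + N), which `h2` makes divisible by p.
    obtain ⟨e1, e2⟩ := h.ext_iff (a := s) (b := 0) (c := a * t - r' * b * N)
      (d := a + r' * b * t + r' * b * T) (by
        rw [hz']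
        have := h.sq
        push_cast
        linear_combination ((r' : K) * b) * this)
    apply hs
    have e3 : s = -(r' * b * (t * t + T * t + N)) := by linear_combination e1 - t * e2
    rw [e3, dvd_neg]
    rcases h2 with h2 | h2
    · have : p ∣ r' := (mul_dvd_mul_iff_left hp.ne_zero).1 h2
      exact (this.mul_right b).mul_right _
    · exact h2.mul_left _
  · refine h.pow_notMem_localLattice hp (Or.inl rfl) hβ ?_ m (localLattice_subset_of_dvd hpr hm)
    rw [show N + T * t + t * t = t * t + T * t + N by ring, show T + 2 * t = 2 * t + T by ring]
    exact h1

/-- It suffices to find a t that is not a double root: t = 0 works unless p divides both N and T,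
and then t = 1 does. -/
theorem IsQuadElement.not_sq_dvd_of_strongly_primary (h : IsQuadElement ω T N) (hp : Prime p)
    (hpr : p ∣ r)
    (hprim : ∀ x y : K, x * y ∈ localLattice p ω p r →
      x ∈ localLattice p ω p r ∨ ∃ m : ℕ, 0 < m ∧ y ^ m ∈ localLattice p ω p r) : ¬p * p ∣ r := by
  intro hpp
  by_cases hN : p ∣ N
  · by_cases hT : p ∣ T
    · refine h.false_of_strongly_primary hp hpr hprim (t := 1) (Or.inl fun hd => ?_) (Or.inl hpp)
      have := dvd_sub hd (dvd_add hN hT)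
      rw [show 1 * 1 + T * 1 + N - (N + T) = 1 by ring] at this
      exact hp.not_dvd_one this
    · exact h.false_of_strongly_primary hp hpr hprim (t := 0) (Or.inr (by simpa using hT))
        (Or.inl hpp)
  · exact h.false_of_strongly_primary hp hpr hprim (t := 0) (Or.inl (by simpa using hN))
      (Or.inl hpp)

theorem IsQuadElement.not_hasSimpleRoot_of_strongly_primary (h : IsQuadElement ω T N)
    (hp : Prime p) (hpr : p ∣ r)
    (hprim : ∀ x y : K, x * y ∈ localLattice p ω p r →
      x ∈ localLattice p ω p r ∨ ∃ m : ℕ, 0 < m ∧ y ^ m ∈ localLattice p ω p r) :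
    ¬HasSimpleRoot T N p :=
  fun ⟨_, ht, ht'⟩ => h.false_of_strongly_primary hp hpr hprim (Or.inr ht') (Or.inr ht)

theorem IsQuadElement.hasNoRoot_of_strongly_prime (h : IsQuadElement ω T N) (hp : Prime p)
    (hpr : p ∣ r)
    (hprime : ∀ x y : K, x * y ∈ localLattice p ω p r →
      x ∈ localLattice p ω p r ∨ y ∈ localLattice p ω p r) : HasNoRoot T N p := by
  have hprim : ∀ x y : K, x * y ∈ localLattice p ω p r →
      x ∈ localLattice p ω p r ∨ ∃ m : ℕ, 0 < m ∧ y ^ m ∈ localLattice p ω p r :=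
    fun x y hxy => (hprime x y hxy).imp id fun hy => ⟨1, one_pos, by rwa [pow_one]⟩
  have hpp := h.not_sq_dvd_of_strongly_primary hp hpr hprim
  intro t ht
  have htr : p ∣ 2 * t + T := by
    by_contra htr
    exact h.not_hasSimpleRoot_of_strongly_primary hp hpr hprim ⟨t, ht, htr⟩
  -- At a double root, β² = (2t + T)β - (t² + Tt + N) is p times an element of V. Since r/p is prime
  -- to p, it lies in the lattice; strong primality then puts β there, although its ω-coordinate is
  -- 1.
  have hβ : (t : K) + ω ∈ localLattice p ω p r := by
    refine (hprime _ _ ?_).elim id id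
    obtain ⟨r', rfl⟩ := hpr
    obtain ⟨n, hn⟩ := ht
    obtain ⟨u, hu⟩ := htr
    refine ⟨r' * (u * t - n), u, r', fun hd => hpp (mul_dvd_mul_left p hd), ?_⟩
    have hsq := h.sq
    have hnK : (t : K) * t + T * t + N = p * n := by exact_mod_cast congrArg (Int.cast : ℤ → K) hn
    have huK : (2 : K) * t + T = p * u := by exact_mod_cast congrArg (Int.cast : ℤ → K) hu
    push_cast
    linear_combination (r' : K) * hsq + (r' : K) * (t + ω) * huK - (r' : K) * hnK
  obtain ⟨a, b, s, hs, hz⟩ := hβ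
  obtain ⟨-, e2⟩ := h.ext_iff (a := s * t) (b := s) (c := p * a) (d := r * b) (by push_cast at hz ⊢; linear_combination hz)
  exact hs (e2 ▸ hpr.mul_right b)

/-- For split p the overring B = V[1/β'] is proper, but it contains β/p because ββ' is divisible by
p. The powers of β/p have unbounded denominators, so no nonzero x carries B into A. -/
theorem IsQuadFieldGen.not_hasSimpleRoot_of_isConducive {A : Type*} [CommRing A] [IsDomain A]
    {ω : FractionRing A} (h : IsQuadFieldGen ω T N) (hp : Prime p)
    (hA : Set.range (algebraMap A (FractionRing A)) = localLattice p ω 1 r)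
    (hcond : IsConducive A) : ¬HasSimpleRoot T N p := by
  rintro ⟨t, ht, htr⟩
  have hpK := h.intCast_ne_zero hp.ne_zero
  have hAV : ∀ a : A, algebraMap A (FractionRing A) a ∈ localLattice p ω 1 1 := fun a =>
    localLattice_subset_of_dvd (one_dvd r) (hA ▸ ⟨a, rfl⟩)
  have hβ := h.add_intCast t
  set β : FractionRing A := (t : FractionRing A) + (1 : ℤ) * ω with hβdef
  set β' : FractionRing A := ((t + T : ℤ) : FractionRing A) + (-1 : ℤ) * ω with hβ'def
  have hβ' : IsQuadElement β' (T + 2 * t) (N + T * t + t * t) := by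
    have hsq := h.sq
    refine ⟨?_, fun a b hab => ?_⟩
    · rw [hβ'def]; push_cast
      linear_combination hsq
    · have := h.indep (a + b * (t + T)) (-b) (by
        rw [hβ'def] at hab; push_cast at hab ⊢; linear_combination hab)
      have hb : b = 0 := by omega
      exact ⟨by simpa [hb] using this.1, hb⟩
  have hβ'V : β' ∈ localLattice p ω 1 1 := intCast_add_mul_mem_localLattice hp _ _
  have hTN : ¬p ∣ N + T * t + t * t ∨ ¬p ∣ T + 2 * t :=
    Or.inr (by rwa [add_comm])
  let B : Subalgebra A (FractionRing A) :=
    { carrier := {z | ∃ m : ℕ, β' ^ m * z ∈ localLattice p ω 1 1}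
      mul_mem' := by
        rintro x y ⟨m, hm⟩ ⟨n, hn⟩
        refine ⟨m + n, ?_⟩
        rw [pow_add, mul_mul_mul_comm]
        exact h.mul_mem_localLattice hp hm hn
      add_mem' := by
        rintro x y ⟨m, hm⟩ ⟨n, hn⟩
        refine ⟨m + n, ?_⟩
        rw [show β' ^ (m + n) * (x + y) = β' ^ n * (β' ^ m * x) + β' ^ m * (β' ^ n * y) by ring]
        exact add_mem_localLattice hp
          (h.mul_mem_localLattice hp (h.pow_mem_localLattice hp hβ'V n) hm)
          (h.mul_mem_localLattice hp (h.pow_mem_localLattice hp hβ'V m) hn)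
      algebraMap_mem' := fun a => ⟨0, by rw [pow_zero, one_mul]; exact hAV a⟩ }
  -- The element 1/p is missing from B, since no power of β' is divisible by p.
  have hBtop : B ≠ ⊤ := by
    intro hB
    have : ((p : FractionRing A))⁻¹ ∈ B := by rw [hB]; trivial
    obtain ⟨m, hm⟩ := this
    rw [← div_eq_mul_inv, ← mem_localLattice_self_iff hpK] at hm
    exact h.pow_notMem_localLattice hp (Or.inr rfl) hβ' hTN m hm
  have hβB : β / p ∈ B := by
    obtain ⟨n, hn⟩ := ht
    refine ⟨1, n, 0, 1, hp.not_dvd_one, ?_⟩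
    have hsq := h.sq
    have hnK : (t : FractionRing A) * t + T * t + N = p * n := by
      exact_mod_cast congrArg (Int.cast : ℤ → FractionRing A) hn
    rw [hβdef, hβ'def]
    field_simp
    push_cast
    linear_combination hnK - hsq
  obtain ⟨x, hx, hxB⟩ := hcond B hBtop
  have hx0 : algebraMap A (FractionRing A) x ≠ 0 :=
    IsFractionRing.to_map_ne_zero_of_mem_nonZeroDivisors hx
  obtain ⟨a, b, d, hd, hdx⟩ := h.span (algebraMap A (FractionRing A) x)⁻¹
  obtain ⟨k, u, hu, rfl⟩ := WfDvdMonoid.max_power_factor hd hp.irreducible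
  -- The denominator d of x⁻¹ contains exactly p^k, so the power k + 1 of β/p leaves one uncancelled
  -- p: β^(k+1) times a p-unit would be divisible by p.
  obtain ⟨y, hy⟩ := hxB _ (B.pow_mem hβB (k + 1))
  have hmem : ((p ^ k * u : ℤ) : FractionRing A) * (β / p) ^ (k + 1) ∈ localLattice p ω 1 1 := by
    have : ((p ^ k * u : ℤ) : FractionRing A) * (β / p) ^ (k + 1) =
        (a + b * ω) * algebraMap A (FractionRing A) y := by
      rw [hy, Algebra.smul_def, ← hdx]
      field_simp
    rw [this]
    exact h.mul_mem_localLattice hp (intCast_add_mul_mem_localLattice hp a b) (hAV y)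
  have hmem' : (u : FractionRing A) * β ^ (k + 1) ∈ localLattice p ω p p := by
    rw [mem_localLattice_self_iff hpK]
    convert hmem using 1
    push_cast
    rw [div_pow]
    field_simp
    ring
  obtain ⟨a', b', s, hs, hz⟩ := hmem'
  refine h.pow_notMem_localLattice hp (Or.inl rfl) hβ hTN (k + 1) ⟨a', b', s * u, ?_, ?_⟩
  · exact fun hd => (hp.dvd_or_dvd hd).elim hs hu
  · rw [← hz]; push_cast; ring

end LocalObstructions

end

noncomputable section

/-! ### From local properties of R to conditions on the primes dividing r -/

section NecessaryLocal

variable {R : Type*} [CommRing R] [IsDomain R] {α : R} {r T N p : ℤ}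

/-- Here α is divided by all of r, which keeps the polynomial with coefficients T and N and leaves r
rather than p^k in the lattice. -/
theorem IsQuadOrderGen.exists_gen_of_isLocalization (h : IsQuadOrderGen α (r * T) (r * r * N))
    (hr : r ≠ 0) (hp : Prime p) (hpr : p ∣ r) (M : Ideal R) [M.IsPrime]
    (hM : M = Ideal.span {(p : R), α}) (A K : Type*) [CommRing A] [Algebra R A]
    [IsLocalization.AtPrime A M] [IsLocalRing A] [Field K] [Algebra A K] [IsFractionRing A K] :
    ∃ ω : K, IsQuadFieldGen ω T N ∧ Set.range (algebraMap A K) = localLattice p ω 1 r ∧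
      idealImage K (IsLocalRing.maximalIdeal A) = localLattice p ω p r := by
  have hrK : (r : K) ≠ 0 := by
    intro h0
    apply hr
    refine h.intCast_eq_zero (algebraMap_comp_injective M A K ?_)
    rw [map_intCast, map_zero, h0]
  have hω : (algebraMap A K).comp (algebraMap R A) α =
      (r : K) * ((algebraMap A K).comp (algebraMap R A) α / (r : K)) := by
    field_simp
  exact ⟨_, h.isQuadFieldGen hr _ (algebraMap_comp_injective M A K)
      (exists_mul_algebraMap_comp M A) hω,
    h.range_algebraMap M A hp (hpr.mul_right _) ((hpr.mul_right _).mul_right _) hM hω,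
    h.idealImage_maximalIdeal M A hp (hpr.mul_right _) ((hpr.mul_right _).mul_right _) hM hω⟩

theorem IsQuadOrderGen.of_isAPVD (h : IsQuadOrderGen α (r * T) (r * r * N))
    (hr : r ≠ 0) (hp : Prime p) (hpr : p ∣ r) (M : Ideal R) [M.IsPrime]
    (hM : M = Ideal.span {(p : R), α}) (A : Type*) [CommRing A] [IsDomain A] [Algebra R A]
    [IsLocalization.AtPrime A M] [IsLocalRing A] (hA : IsAPVD A) :
    ¬p * p ∣ r ∧ ¬HasSimpleRoot T N p := by
  obtain ⟨ω, hω, -, hmax⟩ := h.exists_gen_of_isLocalization hr hp hpr M hM A (FractionRing A)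
  have hprim := hA _ (IsLocalRing.maximalIdeal.isMaximal A).isPrime
  rw [IsStronglyPrimary, hmax] at hprim
  exact ⟨hω.not_sq_dvd_of_strongly_primary hp hpr hprim,
    hω.not_hasSimpleRoot_of_strongly_primary hp hpr hprim⟩

theorem IsQuadOrderGen.of_isPVD (h : IsQuadOrderGen α (r * T) (r * r * N))
    (hr : r ≠ 0) (hp : Prime p) (hpr : p ∣ r) (M : Ideal R) [M.IsPrime]
    (hM : M = Ideal.span {(p : R), α}) (A : Type*) [CommRing A] [IsDomain A] [Algebra R A]
    [IsLocalization.AtPrime A M] [IsLocalRing A] (hA : IsPVD A) : HasNoRoot T N p := by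
  obtain ⟨ω, hω, -, hmax⟩ := h.exists_gen_of_isLocalization hr hp hpr M hM A (FractionRing A)
  have hprim := hA _ (IsLocalRing.maximalIdeal.isMaximal A).isPrime
  rw [IsStronglyPrime, hmax] at hprim
  exact hω.hasNoRoot_of_strongly_prime hp hpr hprim

theorem IsQuadOrderGen.of_isConducive (h : IsQuadOrderGen α (r * T) (r * r * N))
    (hr : r ≠ 0) (hp : Prime p) (hpr : p ∣ r) (M : Ideal R) [M.IsPrime]
    (hM : M = Ideal.span {(p : R), α}) (A : Type*) [CommRing A] [IsDomain A] [Algebra R A]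
    [IsLocalization.AtPrime A M] [IsLocalRing A] (hA : IsConducive A) : ¬HasSimpleRoot T N p := by
  obtain ⟨ω, hω, hrange, -⟩ := h.exists_gen_of_isLocalization hr hp hpr M hM A (FractionRing A)
  exact hω.not_hasSimpleRoot_of_isConducive hp hrange hA

theorem IsQuadOrderGen.of_isLAPVD (h : IsQuadOrderGen α (r * T) (r * r * N))
    (hr : r ≠ 0) (hp : Prime p) (hpr : p ∣ r) (hR : IsLAPVD R) :
    ¬p * p ∣ r ∧ ¬HasSimpleRoot T N p := by
  have hM := h.isMaximal_span_pair hp ((hpr.mul_right _).mul_right _)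
  exact h.of_isAPVD hr hp hpr _ rfl _ (hR (Ideal.span {(p : R), α}))

theorem IsLPVD.isLAPVD (hR : IsLPVD R) : IsLAPVD R := fun M _ => (hR M).isAPVD

theorem IsQuadOrderGen.of_isLPVD (h : IsQuadOrderGen α (r * T) (r * r * N))
    (hr : r ≠ 0) (hp : Prime p) (hpr : p ∣ r) (hR : IsLPVD R) : ¬p * p ∣ r ∧ HasNoRoot T N p := by
  have hM := h.isMaximal_span_pair hp ((hpr.mul_right _).mul_right _)
  exact ⟨(h.of_isLAPVD hr hp hpr hR.isLAPVD).1,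
    h.of_isPVD hr hp hpr _ rfl _ (hR (Ideal.span {(p : R), α}))⟩

theorem IsQuadOrderGen.of_isLocallyConducive (h : IsQuadOrderGen α (r * T) (r * r * N))
    (hr : r ≠ 0) (hp : Prime p) (hpr : p ∣ r) (hR : IsLocallyConducive R) :
    ¬HasSimpleRoot T N p := by
  have hM := h.isMaximal_span_pair hp ((hpr.mul_right _).mul_right _)
  exact h.of_isConducive hr hp hpr _ rfl _ (hR (Ideal.span {(p : R), α}))

end NecessaryLocal

/-! ### Globalized pseudo-valuation domains -/

section Globalized

/-- In an overring `S` whose localization at `Q` is a valuation ring, the extended prime ideal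
`Q S_Q` is strongly prime. -/
theorem exists_mul_mem_of_valuationRing {S K : Type*} [CommRing S] [IsDomain S] [Field K]
    [Algebra S K] [IsFractionRing S K] (Q : Ideal S) [Q.IsPrime]
    [ValuationRing (Localization.AtPrime Q)] {x y : K}
    (hxy : ∃ s ∉ Q, ∃ q ∈ Q, algebraMap S K s * (x * y) = algebraMap S K q) :
    (∃ s ∉ Q, ∃ q ∈ Q, algebraMap S K s * x = algebraMap S K q) ∨
      ∃ s ∉ Q, ∃ q ∈ Q, algebraMap S K s * y = algebraMap S K q := by
  have hQ : Q.IsPrime := inferInstance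
  have hloc : ∀ a b : S, (∃ c : Localization.AtPrime Q,
      algebraMap S _ a * c = algebraMap S _ b) → ∃ s ∉ Q, ∃ d, a * d = b * s := by
    rintro a b ⟨c, hc⟩
    obtain ⟨d, s, rfl⟩ := IsLocalization.exists_mk'_eq Q.primeCompl c
    refine ⟨s, s.2, d, IsLocalization.injective (Localization.AtPrime Q)
      Q.primeCompl_le_nonZeroDivisors ?_⟩
    rw [map_mul, map_mul, ← hc, mul_assoc, IsLocalization.mk'_spec]
  obtain ⟨u, v, hv, hx⟩ := IsFractionRing.div_surjective (A := S) x
  have hv0 : algebraMap S K v ≠ 0 := IsFractionRing.to_map_ne_zero_of_mem_nonZeroDivisors hv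
  obtain ⟨s₀, hs₀, q₀, hq₀, h₀⟩ := hxy
  obtain ⟨c, hc⟩ := ValuationRing.cond (algebraMap S (Localization.AtPrime Q) u)
    (algebraMap S (Localization.AtPrime Q) v)
  rcases hc with hc | hc
  -- Here x⁻¹ = a/s lies in S_Q, so y = x⁻¹(xy) lies in Q S_Q.
  · obtain ⟨s, hs, a, ha⟩ := hloc u v ⟨c, hc⟩
    right
    refine ⟨s₀ * s, fun hd => (hQ.mem_or_mem hd).elim hs₀ hs, a * q₀, Q.mul_mem_left _ hq₀, ?_⟩
    have h1 : x * algebraMap S K a = algebraMap S K s := by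
      have := congrArg (algebraMap S K) ha
      rw [map_mul, map_mul] at this
      rw [← hx]
      field_simp
      linear_combination this
    rw [map_mul, map_mul, ← h1, ← h₀]
    ring
  · obtain ⟨s, hs, a, ha⟩ := hloc v u ⟨c, hc⟩
    have h1 : algebraMap S K s * x = algebraMap S K a := by
      have := congrArg (algebraMap S K) ha
      rw [map_mul, map_mul] at this
      rw [← hx]
      field_simp
      linear_combination -this
    -- Here x = a/s lies in S_Q: it is in Q S_Q if a ∈ Q, and otherwise it is a unit and y inherits
    -- membership from xy.
    by_cases haQ : a ∈ Q
    · exact Or.inl ⟨s, hs, a, haQ, h1⟩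
    · right
      refine ⟨a * s₀, fun hd => (hQ.mem_or_mem hd).elim haQ hs₀, s * q₀, Q.mul_mem_left _ hq₀, ?_⟩
      rw [map_mul, map_mul, ← h1, ← h₀]
      ring

/-- If `Q` is the only prime ideal over the nonzero prime ideal `M` of a one-dimensional domain,
then every element outside `Q` has a multiple coming from outside `M`. -/
theorem IsUnibranched.exists_mul_eq {R S : Type*} [CommRing R] [IsDomain R] [CommRing S]
    [IsDomain S] [Algebra R S] [Ring.DimensionLEOne R]
    (hinj : Function.Injective (algebraMap R S)) (hu : IsUnibranched R S) {M : Ideal R}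
    (hM : M.IsPrime) {Q : Ideal S} (hQ : Q.IsPrime) (hQM : Q.comap (algebraMap R S) = M) {s : S}
    (hs : s ∉ Q) : ∃ (u : S) (g : R), g ∉ M ∧ u * s = algebraMap R S g := by
  by_contra! hcon
  have hdisj : Disjoint ((Ideal.span {s} : Ideal S) : Set S)
      (M.primeCompl.map (algebraMap R S) : Set S) := by
    rw [Set.disjoint_left]
    rintro z hz ⟨g, hg, rfl⟩
    obtain ⟨u, hu⟩ := Ideal.mem_span_singleton'.1 hz
    exact hcon u g hg hu
  -- If no multiple of s comes from outside M, some prime Q' containing s contracts into M. By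
  -- dimension one the contraction is 0 or M, so unibranchedness gives Q' = 0 or Q' = Q; both
  -- contradict s ∉ Q.
  obtain ⟨Q', hQ', hsQ', hdQ'⟩ := Ideal.exists_le_prime_disjoint _ _ hdisj
  rw [Ideal.span_singleton_le_iff_mem] at hsQ'
  have hle : Q'.comap (algebraMap R S) ≤ M := by
    intro g hg
    by_contra hgM
    exact Set.disjoint_left.1 hdQ' hg ⟨g, hgM, rfl⟩
  have hpr : (Q'.comap (algebraMap R S)).IsPrime := Q'.comap_isPrime _
  by_cases h0 : Q'.comap (algebraMap R S) = ⊥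
  · have hb : (⊥ : Ideal S).comap (algebraMap R S) = ⊥ := by
      rw [← RingHom.ker_eq_comap_bot]
      exact (RingHom.injective_iff_ker_eq_bot _).1 hinj
    have := (hu ⊥ Ideal.isPrime_bot).unique ⟨hQ', h0⟩ ⟨Ideal.isPrime_bot, hb⟩
    rw [this] at hsQ'
    exact hs ((Ideal.mem_bot.1 hsQ') ▸ Q.zero_mem)
  · have := (hpr.isMaximal h0).eq_of_le hM.ne_top hle
    rw [(hu M hM).unique ⟨hQ', this⟩ ⟨hQ, hQM⟩] at hsQ'
    exact hs hsQ'

/-- Over M the overring has a single prime Q, and the common radical ideal forces Q S_Q = M R_M. As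
S_Q is a valuation ring, this ideal is strongly prime, and the local obstructions apply. -/
theorem IsQuadOrderGen.of_isGPVD {R : Type*} [CommRing R] [IsDomain R] {α : R} {r T N p : ℤ}
    (h : IsQuadOrderGen α (r * T) (r * r * N)) (hr : r ≠ 0) (hp : Prime p) (hpr : p ∣ r)
    (hR : IsGPVD R) : ¬p * p ∣ r ∧ HasNoRoot T N p := by
  have hpT : p ∣ r * T := hpr.mul_right _
  have hpN : p ∣ r * r * N := (hpr.mul_right _).mul_right _
  have hinj := IsFractionRing.injective R (FractionRing R)
  have hrK : (r : FractionRing R) ≠ 0 := by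
    intro h0
    apply hr
    refine h.intCast_eq_zero (hinj ?_)
    rw [map_intCast, map_zero, h0]
  obtain ⟨ω, hω⟩ : ∃ ω : FractionRing R, algebraMap R (FractionRing R) α = r * ω :=
    ⟨algebraMap R (FractionRing R) α / r, by field_simp⟩
  have hgen : IsQuadFieldGen ω T N := by
    refine h.isQuadFieldGen hr _ hinj (fun z => ?_) hω
    obtain ⟨x, y, hy, rfl⟩ := IsFractionRing.div_surjective (A := R) z
    have := IsFractionRing.to_map_ne_zero_of_mem_nonZeroDivisors (K := FractionRing R) hy
    exact ⟨x, y, nonZeroDivisors.ne_zero hy, by field_simp⟩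
  have hdim := h.dimensionLEOne
  obtain ⟨S, hS, hu, A, B, hAB, hA0, -, hBrad, -, -⟩ := hR
  obtain ⟨M, hM⟩ : ∃ M, M = Ideal.span {(p : R), α} := ⟨_, rfl⟩
  have hMmax : M.IsMaximal := hM ▸ h.isMaximal_span_pair hp ((hpr.mul_right _).mul_right _)
  have hpM : (p : R) ∈ M := hM ▸ Ideal.subset_span (by simp)
  have hinjS : Function.Injective (algebraMap R S) := fun x y hxy =>
    hinj (congrArg (algebraMap S (FractionRing R)) hxy)
  obtain ⟨Q, ⟨hQ, hQM⟩, -⟩ := hu M hMmax.isPrime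
  have hQmax : Q.IsMaximal := by
    obtain ⟨Q', hQ', hle⟩ := Ideal.exists_le_maximal Q hQ.ne_top
    have hQp := hQ'.isPrime
    have : Q'.comap (algebraMap R S) = M :=
      (hMmax.eq_of_le (Q'.comap_isPrime (algebraMap R S)).ne_top
        (hQM ▸ Ideal.comap_mono hle)).symm
    rwa [(hu M hMmax.isPrime).unique ⟨hQ, hQM⟩ ⟨hQ'.isPrime, this⟩]
  have hmemQ : ∀ x : R, algebraMap R S x ∈ Q ↔ x ∈ M := fun x => by rw [← hQM, Ideal.mem_comap]
  have hval := hS Q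
  have hBA : ∀ b ∈ B, ∃ a ∈ A, algebraMap R S a = b := by
    intro b hb
    obtain ⟨a, ha, hab⟩ : algebraMap S (FractionRing R) b ∈ idealImage (FractionRing R) A :=
      hAB ▸ ⟨b, hb, rfl⟩
    exact ⟨a, ha, Subtype.ext hab⟩
  have hAB' : ∀ a ∈ A, algebraMap R S a ∈ B := by
    intro a ha
    obtain ⟨b, hb, hab⟩ : algebraMap R (FractionRing R) a ∈ idealImage (FractionRing R) B :=
      hAB ▸ ⟨a, ha, rfl⟩
    have : algebraMap R S a = b := Subtype.ext hab.symm
    rwa [this]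
  have hQA : ∀ q ∈ Q, ∃ g ∉ M, ∃ x ∈ M, algebraMap R S g * q = algebraMap R S x := by
    intro q hq
    -- If A ≤ M, then A contains an integer p^j m with p ∤ m. Every prime over B contains m or p,
    -- and in the second case it is Q; so mq lies in the radical ideal B, hence in R. Otherwise an
    -- element of A outside M carries q into R.
    by_cases hAM : A ≤ M
    · obtain ⟨c, hc, hcA⟩ := h.exists_intCast_mem hA0
      obtain ⟨j, m, hm, rfl⟩ := WfDvdMonoid.max_power_factor hc hp.irreducible
      have hmq : algebraMap R S m * q ∈ B := by
        have hB := hBrad.radical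
        rw [Ideal.radical_eq_sInf] at hB
        rw [← hB, Ideal.mem_sInf]
        rintro Q' ⟨hBQ', hQ'⟩
        have hcQ' := hBQ' (hAB' _ hcA)
        rw [Int.cast_mul, Int.cast_pow, map_mul, map_pow] at hcQ'
        rcases hQ'.mem_or_mem hcQ' with h1 | h1
        · have hpQ' : (p : R) ∈ Q'.comap (algebraMap R S) := hQ'.mem_of_pow_mem _ h1
          have := h.eq_span_pair_of_mem hp hpT hpN (Q'.comap_isPrime (algebraMap R S)) hpQ'
          rw [← hM] at this
          rw [(hu M hMmax.isPrime).unique ⟨hQ', this⟩ ⟨hQ, hQM⟩]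
          exact Q.mul_mem_left _ hq
        · exact Q'.mul_mem_right _ h1
      obtain ⟨a, ha, hab⟩ := hBA _ hmq
      refine ⟨m, ?_, a, hAM ha, hab.symm⟩
      have := (h.notMem_iff M hpN hM (a := m) (b := 0)).2 hm
      simpa using this
    · obtain ⟨g, hgA, hgM⟩ := Set.not_subset.1 hAM
      obtain ⟨a, -, hab⟩ := hBA _ (B.mul_mem_right q (hAB' g hgA))
      refine ⟨g, hgM, a, ?_, hab.symm⟩
      rw [← hmemQ, hab]
      exact Q.mul_mem_left _ hq
  have hlat : ∀ z : FractionRing R, (∃ s ∉ Q, ∃ q ∈ Q, algebraMap S (FractionRing R) s * z =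
      algebraMap S (FractionRing R) q) → z ∈ localLattice p ω p r := by
    rintro z ⟨s, hs, q, hq, hz⟩
    obtain ⟨u, g, hg, hug⟩ := hu.exists_mul_eq hinjS hMmax.isPrime hQ hQM hs
    obtain ⟨g', hg', x, hx, hgx⟩ := hQA (u * q) (Q.mul_mem_left _ hq)
    obtain ⟨y, n, hn, hy⟩ := h.exists_mul_eq_intCast M hp hpT hpN hM
      (fun hd => (hMmax.isPrime.mem_or_mem hd).elim hg' hg : g' * g ∉ M)
    have hxy : y * x ∈ M := M.mul_mem_left _ hx
    rw [hM] at hxy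
    obtain ⟨a, b, hab⟩ := (h.mem_span_pair hpN).1 hxy
    refine ⟨a, b, n, hn, ?_⟩
    have e1 := congrArg (algebraMap S (FractionRing R)) hug
    have e2 := congrArg (algebraMap S (FractionRing R)) hgx
    have e3 := congrArg (algebraMap R (FractionRing R)) hy
    have e4 := congrArg (algebraMap R (FractionRing R)) hab
    simp only [map_mul, map_add, map_intCast, ← IsScalarTower.algebraMap_apply, hω] at e1 e2 e3 e4
    rw [← e3]
    push_cast at e4 ⊢
    linear_combination e4 + algebraMap R (FractionRing R) y * e2 -
      algebraMap R (FractionRing R) y * algebraMap R (FractionRing R) g' * z * e1 +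
      algebraMap R (FractionRing R) y * algebraMap R (FractionRing R) g' *
        algebraMap S (FractionRing R) u * hz
  have hprime : ∀ x y : FractionRing R, x * y ∈ localLattice p ω p r →
      x ∈ localLattice p ω p r ∨ y ∈ localLattice p ω p r := by
    intro x y hxy
    have hSK : IsFractionRing S (FractionRing R) := inferInstance
    refine (exists_mul_mem_of_valuationRing Q ?_).imp (hlat x) (hlat y)
    obtain ⟨a, b, s, hs, hz⟩ := hxy
    refine ⟨algebraMap R S s, ?_, algebraMap R S ((p * a : ℤ) + b * α), ?_, ?_⟩
    · rw [hmemQ]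
      have := (h.notMem_iff M hpN hM (a := s) (b := 0)).2 hs
      simpa using this
    · rw [hmemQ, hM]
      exact (h.mem_span_pair hpN).2 ⟨a, b, rfl⟩
    · rw [← IsScalarTower.algebraMap_apply, ← IsScalarTower.algebraMap_apply, map_intCast, hz,
        map_add, map_mul, hω, map_intCast, map_intCast]
      push_cast; ring
  exact ⟨hgen.not_sq_dvd_of_strongly_primary hp hpr
    fun x y hxy => (hprime x y hxy).imp id fun hy => ⟨1, one_pos, by rwa [pow_one]⟩,
    hgen.hasNoRoot_of_strongly_prime hp hpr hprime⟩

theorem Int.dvd_of_forall_prime_dvd {r a : ℤ} (hr : r ≠ 0) (hsf : ∀ p : ℤ, Prime p → ¬p * p ∣ r)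
    (h : ∀ p : ℤ, Prime p → p ∣ r → p ∣ a) : r ∣ a := by
  obtain ⟨c, hc⟩ := gcd_dvd_left r a
  have hc0 : c ≠ 0 := by
    rintro rfl
    exact hr (by simpa using hc)
  have hcu : IsUnit c := by
    by_contra hcu
    obtain ⟨p, hp, hpc⟩ := WfDvdMonoid.exists_irreducible_factor hcu hc0
    have hpr : p ∣ r := hc ▸ hpc.mul_left _
    refine hsf p hp.prime ?_
    rw [hc]
    exact mul_dvd_mul (Int.dvd_coe_gcd hpr (h p hp.prime hpr)) hpc
  rw [hc]
  exact (hcu.mul_right_dvd).2 (gcd_dvd_right r a)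

theorem IsQuadOrderGen.isRadical_span {S : Type*} [CommRing S] {θ : S} {r T N : ℤ}
    (h : IsQuadOrderGen θ T N) (hr : r ≠ 0) (hsf : ∀ p : ℤ, Prime p → ¬p * p ∣ r)
    (hno : ∀ p : ℤ, Prime p → p ∣ r → HasNoRoot T N p) : (Ideal.span {(r : S)}).IsRadical := by
  rintro z ⟨n, hz⟩
  obtain ⟨a, b, rfl⟩ := h.span z
  have key : ∀ p : ℤ, Prime p → p ∣ r → p ∣ a ∧ p ∣ b := by
    intro p hp hpr
    rw [← h.mem_span_intCast]
    refine (h.isPrime_span hp (hno p hp hpr)).mem_of_pow_mem n ?_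
    refine Ideal.span_singleton_le_span_singleton.2 ?_ hz
    obtain ⟨c, rfl⟩ := hpr
    exact ⟨c, by push_cast; ring⟩
  rw [h.mem_span_intCast]
  exact ⟨Int.dvd_of_forall_prime_dvd hr hsf fun p hp hpr => (key p hp hpr).1,
    Int.dvd_of_forall_prime_dvd hr hsf fun p hp hpr => (key p hp hpr).2⟩

/-- Existence is lying over. For uniqueness, an inert p ∣ r generates the prime above it, and a
prime not containing r is recovered from its contraction because rS ⊆ R. -/
theorem IsQuadOrderGen.isUnibranched {R S : Type*} [CommRing R] [IsDomain R] [CommRing S]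
    [IsDomain S] [Algebra R S] (hinj : Function.Injective (algebraMap R S)) {θ : S} {r T N : ℤ}
    (hr : r ≠ 0) (hR : ∃ (α : R) (T' N' : ℤ), IsQuadOrderGen α T' N') (h : IsQuadOrderGen θ T N)
    (hrS : ∀ z : S, ∃ x : R, algebraMap R S x = r * z)
    (hno : ∀ p : ℤ, Prime p → p ∣ r → HasNoRoot T N p) : IsUnibranched R S := by
  obtain ⟨α, T', N', hα⟩ := hR
  intro P hP
  have hfin := h.finite_int
  have hint : Algebra.IsIntegral R S := Algebra.IsIntegral.tower_top ℤ
  have hle : ∀ Q Q' : Ideal S, Q.IsPrime → Q.comap (algebraMap R S) = P → Q'.IsPrime →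
      Q'.comap (algebraMap R S) = P → Q ≤ Q' := by
    intro Q Q' hQ hQP hQ' hQP' z hz
    by_cases hrP : (r : R) ∈ P
    · have hP0 : P ≠ ⊥ := by
        rintro rfl
        exact hr (hα.intCast_eq_zero hrP)
      obtain ⟨p, hp, hpP⟩ := hα.exists_prime_mem hP hP0
      have hpr : p ∣ r := by
        by_contra hpr
        exact hP.ne_top ((Ideal.eq_top_iff_one _).2 (Ideal.one_mem_of_isCoprime
          (Int.isCoprime_pow_of_prime hp hpr 1) hrP (by simpa using hpP)))
      have hpQ : (p : S) ∈ Q := by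
        rw [← hQP] at hpP
        simpa using hpP
      have hpQ' : (p : S) ∈ Q' := by
        rw [← hQP'] at hpP
        simpa using hpP
      obtain ⟨a, b, rfl⟩ := h.span z
      have hab : p ∣ quadNorm T N a b := by
        by_contra hab
        exact hQ.ne_top ((Ideal.eq_top_iff_one _).2 (Ideal.one_mem_of_isCoprime
          (Int.isCoprime_pow_of_prime hp hab 1) (h.quadNorm_mem hz) (by simpa using hpQ)))
      have := h.mem_span_intCast.2 ((hno p hp hpr).dvd_of_dvd_quadNorm hp hab)
      exact (Ideal.span_singleton_le_iff_mem _).2 hpQ' this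
    · obtain ⟨x, hx⟩ := hrS z
      have hxP : x ∈ P := by
        rw [← hQP, Ideal.mem_comap, hx]
        exact Q.mul_mem_left _ hz
      have : (r : S) * z ∈ Q' := by
        rw [← hx, ← Ideal.mem_comap, hQP']
        exact hxP
      refine (hQ'.mem_or_mem this).resolve_left fun hrQ' => hrP ?_
      rw [← hQP', Ideal.mem_comap, map_intCast]
      exact hrQ'
  obtain ⟨Q, hQ, hQP⟩ := Ideal.exists_ideal_over_prime_of_isIntegral_of_isDomain (S := S) P
    (by rw [(RingHom.injective_iff_ker_eq_bot _).1 hinj]; exact bot_le)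
  exact ⟨Q, ⟨hQ, hQP⟩, fun Q' hQ' => le_antisymm (hle Q' Q hQ'.1 hQ'.2 hQ hQP)
    (hle Q Q' hQ hQP hQ'.1 hQ'.2)⟩

/-- The overring is S = ℤ[ω] and the common ideal is rS, which lies in R and is radical because r is
a square-free product of inert primes. -/
theorem IsQuadOrderGen.isGPVD {R : Type*} [CommRing R] [IsDomain R] {α : R} {r T N : ℤ}
    (h : IsQuadOrderGen α (r * T) (r * r * N)) (hr : r ≠ 0)
    (hmax : ∀ p : ℤ, Prime p → ∀ t, p ^ 2 ∣ t * t + T * t + N → ¬p ∣ 2 * t + T)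
    (hsf : ∀ p : ℤ, Prime p → ¬p * p ∣ r)
    (hno : ∀ p : ℤ, Prime p → p ∣ r → HasNoRoot T N p) : IsGPVD R := by
  have hinj := IsFractionRing.injective R (FractionRing R)
  have hrK : (r : FractionRing R) ≠ 0 := by
    intro h0
    apply hr
    refine h.intCast_eq_zero (hinj ?_)
    rw [map_intCast, map_zero, h0]
  obtain ⟨ω, hω⟩ : ∃ ω : FractionRing R, algebraMap R (FractionRing R) α = r * ω :=
    ⟨algebraMap R (FractionRing R) α / r, by field_simp⟩
  have hgen : IsQuadFieldGen ω T N := by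
    refine h.isQuadFieldGen hr _ hinj (fun z => ?_) hω
    obtain ⟨x, y, hy, rfl⟩ := IsFractionRing.div_surjective (A := R) z
    have := IsFractionRing.to_map_ne_zero_of_mem_nonZeroDivisors (K := FractionRing R) hy
    exact ⟨x, y, nonZeroDivisors.ne_zero hy, by field_simp⟩
  let S : Subalgebra R (FractionRing R) :=
    { carrier := {z | ∃ a b : ℤ, z = a + b * ω}
      mul_mem' := by
        rintro _ _ ⟨a, b, rfl⟩ ⟨c, d, rfl⟩
        exact ⟨_, _, hgen.mul_eq a b c d⟩
      add_mem' := by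
        rintro _ _ ⟨a, b, rfl⟩ ⟨c, d, rfl⟩
        exact ⟨a + c, b + d, by push_cast; ring⟩
      algebraMap_mem' := by
        intro x
        obtain ⟨a, b, rfl⟩ := h.span x
        exact ⟨a, b * r, by
          rw [map_add, map_mul, hω, map_intCast, map_intCast]; push_cast; ring⟩ }
  let θ : S := ⟨ω, 0, 1, by simp⟩
  have hθ : IsQuadOrderGen θ T N := by
    refine ⟨⟨Subtype.ext ?_, fun a b hab => hgen.indep a b ?_⟩, ?_⟩
    · simpa [θ] using hgen.sq
    · simpa [θ] using congrArg (Subtype.val) hab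
    · rintro ⟨z, a, b, hz⟩
      exact ⟨a, b, Subtype.ext (by simpa [θ] using hz)⟩
  have hinjS : Function.Injective (algebraMap R S) := fun x y hxy =>
    hinj (congrArg (algebraMap S (FractionRing R)) hxy)
  have hrS : ∀ z : S, ∃ x : R, algebraMap R S x = r * z := by
    intro z
    obtain ⟨a, b, rfl⟩ := hθ.span z
    refine ⟨(r * a : ℤ) + b * α, Subtype.ext ?_⟩
    have : algebraMap R (FractionRing R) ((r * a : ℤ) + b * α) = r * (a + b * ω) := by
      rw [map_add, map_mul, hω, map_intCast, map_intCast]; push_cast; ring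
    simpa [θ] using this
  have hrR : (r : R) ≠ 0 := fun h0 => hr (h.intCast_eq_zero h0)
  have hrS0 : (r : S) ≠ 0 := fun h0 => hr (hθ.intCast_eq_zero h0)
  have hdim := h.dimensionLEOne
  have hdimS := hθ.dimensionLEOne
  have hrad := hθ.isRadical_span hr hsf hno
  refine ⟨S, ?_, hθ.isUnibranched hinjS hr ⟨α, _, _, h⟩ hrS hno,
    (Ideal.span {(r : S)}).comap (algebraMap R S), Ideal.span {(r : S)}, ?_, ?_,
    hrad.comap _, hrad, ?_, ?_⟩
  · intro M hM
    -- The ring S is the order with r = 1, so every maximal ideal is off the conductor.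
    have hθ' : IsQuadOrderGen θ (1 * T) (1 * 1 * N) := by simpa using hθ
    exact hθ'.valuationRing_of_notMem hmax M (by
      rw [Int.cast_one, ← Ideal.eq_top_iff_one]; exact hM.ne_top)
  · ext z
    constructor
    · rintro ⟨x, hx, rfl⟩
      exact ⟨algebraMap R S x, hx, rfl⟩
    · rintro ⟨b, hb, rfl⟩
      obtain ⟨c, rfl⟩ := Ideal.mem_span_singleton.1 hb
      obtain ⟨x, hx⟩ := hrS c
      refine ⟨x, ?_, ?_⟩
      · rw [SetLike.mem_coe, Ideal.mem_comap, hx]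
        exact hb
      · rw [← hx]; rfl
  · intro h0
    have : (r : R) ∈ (Ideal.span {(r : S)}).comap (algebraMap R S) := by
      rw [Ideal.mem_comap, map_intCast]
      exact Ideal.mem_span_singleton_self _
    rw [h0] at this
    exact hrR this
  · intro P hP hle
    refine hP.isMaximal ?_
    rintro rfl
    refine hrR (hle ?_)
    rw [Ideal.mem_comap, map_intCast]
    exact Ideal.mem_span_singleton_self _
  · intro Q hQ hle
    refine hQ.isMaximal ?_
    rintro rfl
    exact hrS0 (hle (Ideal.mem_span_singleton_self _))

end Globalized

end

noncomputable section

/-! ### The equivalences in terms of roots modulo p -/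

section Equivalences

variable {R : Type*} [CommRing R] [IsDomain R] {α : R} {r T N : ℤ}

theorem IsQuadOrderGen.hasAbsorbingFactorization_two (h : IsQuadOrderGen α (r * T) (r * r * N))
    (hr : r ≠ 0) (hmax : ∀ p : ℤ, Prime p → ∀ t, p ^ 2 ∣ t * t + T * t + N → ¬p ∣ 2 * t + T)
    (hsf : ∀ p : ℤ, Prime p → ¬p * p ∣ r)
    (hno : ∀ p : ℤ, Prime p → p ∣ r → HasNoRoot T N p) : HasAbsorbingFactorization R 2 := by
  -- For inert p one may take ε = 0, and square-freeness gives k ≤ 1, so 2k + ε ≤ 2.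
  refine h.hasAbsorbingFactorization hr hmax two_pos fun p hp hpr => ⟨0, ?_, fun k hk => ?_⟩
  · intro a b hab
    exact (hno p hp hpr).dvd_of_dvd_quadNorm hp (by simpa using hab)
  · by_contra! hlt
    exact hsf p hp ((dvd_of_eq (pow_two p).symm).trans
      ((pow_dvd_pow p (by omega : 2 ≤ k)).trans hk))

theorem IsQuadOrderGen.hasAbsorbingFactorization_three (h : IsQuadOrderGen α (r * T) (r * r * N))
    (hr : r ≠ 0) (hmax : ∀ p : ℤ, Prime p → ∀ t, p ^ 2 ∣ t * t + T * t + N → ¬p ∣ 2 * t + T)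
    (hsf : ∀ p : ℤ, Prime p → ¬p * p ∣ r)
    (hns : ∀ p : ℤ, Prime p → p ∣ r → ¬HasSimpleRoot T N p) : HasAbsorbingFactorization R 3 := by
  -- Ramified primes need ε = 1, which raises the bound to 3.
  refine h.hasAbsorbingFactorization hr hmax three_pos fun p hp hpr => ⟨1, ?_, fun k hk => ?_⟩
  · intro a b hab
    exact dvd_of_sq_dvd_quadNorm hp (hns p hp hpr) (hmax p hp) hab
  · by_contra! hlt
    exact hsf p hp ((dvd_of_eq (pow_two p).symm).trans
      ((pow_dvd_pow p (by omega : 2 ≤ k)).trans hk))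

theorem IsQuadOrderGen.exists_hasAbsorbingFactorization
    (h : IsQuadOrderGen α (r * T) (r * r * N))
    (hr : r ≠ 0) (hmax : ∀ p : ℤ, Prime p → ∀ t, p ^ 2 ∣ t * t + T * t + N → ¬p ∣ 2 * t + T)
    (hns : ∀ p : ℤ, Prime p → p ∣ r → ¬HasSimpleRoot T N p) :
    HasAbsorbingFactorization R (2 * r.natAbs + 1) := by
  refine h.hasAbsorbingFactorization hr hmax (by omega) fun p hp hpr => ⟨1, ?_, fun k hk => ?_⟩
  · intro a b hab
    exact dvd_of_sq_dvd_quadNorm hp (hns p hp hpr) (hmax p hp) hab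
  -- A crude bound suffices: p^k ∣ r gives k < |r|.
  · have h1 : p.natAbs ^ k ≤ r.natAbs := by
      rw [← Int.natAbs_pow]
      exact Nat.le_of_dvd (Int.natAbs_pos.2 hr) (Int.natAbs_dvd_natAbs.2 hk)
    have h2 := Nat.lt_pow_self (Int.prime_iff_natAbs_prime.1 hp).one_lt (n := k)
    omega

/-- The three characterizations for an order `R = ℤ[α]` of conductor `r` in the maximal order with
minimal polynomial `X² - T X + N`, in terms of roots of this polynomial modulo the primes
dividing `r`. -/
theorem IsQuadOrderGen.tfae (h : IsQuadOrderGen α (r * T) (r * r * N))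
    (hr : r ≠ 0) (hmax : ∀ p : ℤ, Prime p → ∀ t, p ^ 2 ∣ t * t + T * t + N → ¬p ∣ 2 * t + T) :
    List.TFAE [IsGPVD R, IsLPVD R, afDim R ≤ 2,
      (∀ p : ℤ, Prime p → ¬p * p ∣ r) ∧ ∀ p : ℤ, Prime p → p ∣ r → HasNoRoot T N p] ∧
    List.TFAE [IsLAPVD R, afDim R ≤ 3,
      (∀ p : ℤ, Prime p → ¬p * p ∣ r) ∧ ∀ p : ℤ, Prime p → p ∣ r → ¬HasSimpleRoot T N p] ∧
    List.TFAE [IsLocallyConducive R, afDim R < ⊤,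
      ∀ p : ℤ, Prime p → p ∣ r → ¬HasSimpleRoot T N p] := by
  have hsf : (∀ p : ℤ, Prime p → p ∣ r → ¬p * p ∣ r) → ∀ p : ℤ, Prime p → ¬p * p ∣ r :=
    fun hsf p hp hpp => hsf p hp ((Dvd.intro _ rfl).trans hpp) hpp
  refine ⟨?_, ?_, ?_⟩
  · tfae_have 4 → 1 := fun hc => h.isGPVD hr hmax hc.1 hc.2
    tfae_have 1 → 4 := fun hG => ⟨hsf fun p hp hpr => (h.of_isGPVD hr hp hpr hG).1,
      fun p hp hpr => (h.of_isGPVD hr hp hpr hG).2⟩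
    tfae_have 4 → 2 := fun hc => h.isLPVD hr hmax hc.1 hc.2
    tfae_have 2 → 4 := fun hG => ⟨hsf fun p hp hpr => (h.of_isLPVD hr hp hpr hG).1,
      fun p hp hpr => (h.of_isLPVD hr hp hpr hG).2⟩
    tfae_have 4 → 3 := fun hc =>
      (afDim_le_iff two_pos).2 (h.hasAbsorbingFactorization_two hr hmax hc.1 hc.2)
    tfae_have 3 → 4 := fun hd => by
      have hd := (afDim_le_iff two_pos).1 hd
      exact ⟨fun p hp => h.squarefree_of_hasAbsorbingFactorization (hd.mono (by omega)) hp,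
        fun p hp hpr => h.hasNoRoot_of_hasAbsorbingFactorization hd hp hpr⟩
    tfae_finish
  · tfae_have 3 → 1 := fun hc => h.isLAPVD hr hmax hc.1 hc.2
    tfae_have 1 → 3 := fun hG => ⟨hsf fun p hp hpr => (h.of_isLAPVD hr hp hpr hG).1,
      fun p hp hpr => (h.of_isLAPVD hr hp hpr hG).2⟩
    tfae_have 3 → 2 := fun hc =>
      (afDim_le_iff three_pos).2 (h.hasAbsorbingFactorization_three hr hmax hc.1 hc.2)
    tfae_have 2 → 3 := fun hd => by
      have hd := (afDim_le_iff three_pos).1 hd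
      exact ⟨fun p hp => h.squarefree_of_hasAbsorbingFactorization hd hp,
        fun p hp hpr => h.not_hasSimpleRoot_of_hasAbsorbingFactorization hd hp hpr⟩
    tfae_finish
  · tfae_have 3 → 1 := h.isLocallyConducive hr hmax
    tfae_have 1 → 3 := fun hG p hp hpr => h.of_isLocallyConducive hr hp hpr hG
    tfae_have 3 → 2 := fun hc => afDim_lt_top_iff.2
      ⟨_, by omega, h.exists_hasAbsorbingFactorization hr hmax hc⟩
    tfae_have 2 → 3 := fun hd p hp hpr => by
      obtain ⟨n, -, hn⟩ := afDim_lt_top_iff.1 hd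
      exact h.not_hasSimpleRoot_of_hasAbsorbingFactorization hn hp hpr
    tfae_finish

end Equivalences

/-! ### The generator ω, its maximality, and the Kronecker symbol -/

section QuadraticFields

/-- The trace of `quadOmega n`. -/
def quadTrace (n : ℤ) : ℤ := if n % 4 = 1 then 1 else 0

/-- The norm of `quadOmega n`. -/
def quadOmegaNorm (n : ℤ) : ℤ := if n % 4 = 1 then (1 - n) / 4 else -n

theorem quadTrace_sq_sub (n : ℤ) :
    quadTrace n * quadTrace n - 4 * quadOmegaNorm n = quadDisc n := by
  unfold quadTrace quadOmegaNorm quadDisc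
  split_ifs <;> omega

theorem Int.not_sq_dvd_of_squarefree {n p : ℤ} (hn : Squarefree n) (hp : Prime p) : ¬p * p ∣ n :=
  fun hd => hp.not_isUnit (hn p hd)

/-- Since f'(t)² - 4f(t) is the discriminant, p² would divide it. This contradicts square-freeness
of n, except when p = ±2 and the discriminant is 4n; there 4 ∣ t² - n is impossible for n ≡ 2, 3
modulo 4. -/
theorem not_dvd_of_sq_dvd_quadOmega {n : ℤ} (hn : Squarefree n) {p : ℤ} (hp : Prime p) (t : ℤ)
    (ht : p ^ 2 ∣ t * t + quadTrace n * t + quadOmegaNorm n) : ¬p ∣ 2 * t + quadTrace n := by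
  intro htr
  have hn4 : ¬(2 : ℤ) * 2 ∣ n := Int.not_sq_dvd_of_squarefree hn Int.prime_two
  have hd : p * p ∣ quadDisc n := by
    rw [← quadTrace_sq_sub]
    have h1 := dvd_sub (mul_dvd_mul htr htr) ((pow_two p ▸ ht).mul_left 4)
    rwa [show (2 * t + quadTrace n) * (2 * t + quadTrace n) -
      4 * (t * t + quadTrace n * t + quadOmegaNorm n) =
      quadTrace n * quadTrace n - 4 * quadOmegaNorm n by ring] at h1
  by_cases h4 : n % 4 = 1
  · rw [quadDisc, if_pos h4] at hd
    exact Int.not_sq_dvd_of_squarefree hn hp hd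
  · rw [quadDisc, if_neg h4] at hd
    by_cases hp2 : p ∣ 2
    · have h22 : (2 : ℤ) ∣ p := (hp.associated_of_dvd Int.prime_two hp2).symm.dvd
      have h44 : (4 : ℤ) ∣ t * t + quadTrace n * t + quadOmegaNorm n := by
        refine dvd_trans ?_ ht
        rw [pow_two]
        exact mul_dvd_mul h22 h22
      rw [quadTrace, quadOmegaNorm, if_neg h4, if_neg h4] at h44
      rcases Int.even_or_odd' t with ⟨k, rfl | rfl⟩
      · ring_nf at h44; omega
      · ring_nf at h44; omega
    · have hcop : IsCoprime (p * p) (4 : ℤ) := by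
        have : IsCoprime p 2 := (Prime.coprime_iff_not_dvd hp).2 hp2
        exact (this.mul_left this).mul_right (this.mul_left this)
      exact Int.not_sq_dvd_of_squarefree hn hp (hcop.dvd_of_dvd_mul_left hd)

theorem cpow_half_mul_self (n : ℤ) : (n : ℂ) ^ (2⁻¹ : ℂ) * (n : ℂ) ^ (2⁻¹ : ℂ) = n := by
  rw [← pow_two]
  exact Complex.cpow_ofNat_inv_pow (n : ℂ) 2

theorem quadOmega_mul_self (n : ℤ) :
    quadOmega n * quadOmega n = quadTrace n * quadOmega n - quadOmegaNorm n := by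
  have hs := cpow_half_mul_self n
  unfold quadOmega quadTrace quadOmegaNorm
  split_ifs with h
  · obtain ⟨m, hm⟩ : (4 : ℤ) ∣ 1 - n := by omega
    have hm' : (1 - n : ℂ) = 4 * m := by exact_mod_cast congrArg (Int.cast : ℤ → ℂ) hm
    rw [hm, Int.mul_ediv_cancel_left _ (by norm_num)]
    push_cast
    linear_combination (1 / 4 : ℂ) * hs - (1 / 4 : ℂ) * hm'
  · push_cast
    linear_combination hs

theorem Int.eq_zero_of_sq_eq_mul_sq {n : ℤ} (hn : Squarefree n) (hn1 : n ≠ 1) {a b : ℤ}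
    (h : a * a = n * (b * b)) : a = 0 ∧ b = 0 := by
  have hn0 := hn.ne_zero
  by_cases hb : b = 0
  · subst hb
    exact ⟨by simpa using h, rfl⟩
  exfalso
  have hba : b ∣ a := by
    have : b ^ 2 ∣ a ^ 2 := ⟨n, by rw [pow_two, h]; ring⟩
    exact (Int.pow_dvd_pow_iff two_ne_zero).1 this
  obtain ⟨c, rfl⟩ := hba
  have hc : n = c * c := by
    have : b * b ≠ 0 := mul_ne_zero hb hb
    refine mul_right_cancel₀ this ?_
    linear_combination -h
  have := hn c (dvd_of_eq hc.symm)
  rcases Int.isUnit_iff.1 this with rfl | rfl <;> exact hn1 (by simpa using hc)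

theorem isQuadElement_quadOmega {n : ℤ} (hn : Squarefree n) (hn1 : n ≠ 1) :
    IsQuadElement (quadOmega n) (quadTrace n) (quadOmegaNorm n) where
  sq := quadOmega_mul_self n
  indep := by
    have key : ∀ a b : ℤ, (a : ℂ) + b * (n : ℂ) ^ (2⁻¹ : ℂ) = 0 → a = 0 ∧ b = 0 := by
      intro a b hab
      refine Int.eq_zero_of_sq_eq_mul_sq hn hn1 ?_
      have hs := cpow_half_mul_self n
      have : (a : ℂ) * a = n * (b * b) := by
        linear_combination (a - b * (n : ℂ) ^ (2⁻¹ : ℂ)) * hab + (b : ℂ) * b * hs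
      exact_mod_cast this
    intro a b hab
    unfold quadOmega at hab
    split_ifs at hab
    · have := key (2 * a + b) b (by push_cast; linear_combination 2 * hab)
      omega
    · exact key a b hab

theorem isQuadOrderGen_quadOrder {n : ℤ} (hn : Squarefree n) (hn1 : n ≠ 1) {r : ℕ} (hr : 0 < r) :
    IsQuadOrderGen (⟨(r : ℂ) * quadOmega n, Algebra.subset_adjoin rfl⟩ : quadOrder n r)
      ((r : ℤ) * quadTrace n) ((r : ℤ) * r * quadOmegaNorm n) := by
  have hω := isQuadElement_quadOmega hn hn1
  have hsq : ((r : ℂ) * quadOmega n) * (r * quadOmega n) =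
      ((r * quadTrace n : ℤ) : ℂ) * (r * quadOmega n) - ((r * r * quadOmegaNorm n : ℤ) : ℂ) := by
    have := hω.sq
    push_cast
    linear_combination ((r : ℂ) * r) * this
  refine ⟨⟨Subtype.ext ?_, fun a b hab => ?_⟩, ?_⟩
  · simpa using hsq
  · have h1 : (a : ℂ) + b * (r * quadOmega n) = 0 := by simpa using congrArg Subtype.val hab
    have h2 := hω.indep a (b * r) (by push_cast; linear_combination h1)
    refine ⟨h2.1, (mul_eq_zero.1 h2.2).resolve_right (by omega)⟩
  · rintro ⟨z, hz⟩
    have : ∃ a b : ℤ, z = a + b * (r * quadOmega n) := by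
      induction hz using Algebra.adjoin_induction with
      | mem x hx =>
        rw [Set.mem_singleton_iff] at hx
        exact ⟨0, 1, by rw [hx]; simp⟩
      | algebraMap a => exact ⟨a, 0, by simp⟩
      | add x y _ _ hx hy =>
        obtain ⟨a, b, rfl⟩ := hx
        obtain ⟨c, d, rfl⟩ := hy
        exact ⟨a + c, b + d, by push_cast; ring⟩
      | mul x y _ _ hx hy =>
        obtain ⟨a, b, rfl⟩ := hx
        obtain ⟨c, d, rfl⟩ := hy
        refine ⟨a * c - b * d * (r * r * quadOmegaNorm n),
          a * d + b * c + b * d * (r * quadTrace n), ?_⟩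
        push_cast at hsq ⊢
        linear_combination ((b : ℂ) * d) * hsq
    obtain ⟨a, b, hab⟩ := this
    exact ⟨a, b, Subtype.ext (by simpa using hab)⟩

/-- Completing the square: 4(t² + Tt + N) = (2t + T)² - (T² - 4N). -/
theorem exists_root_iff_isSquare {T N : ℤ} {p : ℕ} [Fact p.Prime] (hp2 : p ≠ 2) :
    (∃ t : ℤ, (p : ℤ) ∣ t * t + T * t + N) ↔ IsSquare ((T * T - 4 * N : ℤ) : ZMod p) := by
  have hp : Prime (p : ℤ) := Nat.prime_iff_prime_int.1 Fact.out
  have hp2' : ¬(p : ℤ) ∣ 2 := by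
    intro hd
    have hd : p ∣ 2 := by exact_mod_cast hd
    exact hp2 ((Nat.prime_dvd_prime_iff_eq Fact.out Nat.prime_two).1 hd)
  constructor
  · rintro ⟨t, ht⟩
    refine ⟨((2 * t + T : ℤ) : ZMod p), ?_⟩
    rw [← Int.cast_mul, ZMod.intCast_eq_intCast_iff_dvd_sub]
    have := ht.mul_left 4
    rwa [show 4 * (t * t + T * t + N) = (2 * t + T) * (2 * t + T) - (T * T - 4 * N) by ring] at this
  · rintro ⟨s, hs⟩
    obtain ⟨s, rfl⟩ := ZMod.intCast_surjective s
    rw [← Int.cast_mul, ZMod.intCast_eq_intCast_iff_dvd_sub] at hs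
    obtain ⟨t, ht⟩ := Int.exists_dvd_add_mul hp hp2' 1 (T - s)
    rw [pow_one] at ht
    refine ⟨t, ?_⟩
    have h1 : (p : ℤ) ∣ 4 * (t * t + T * t + N) := by
      have := dvd_add hs (ht.mul_left (T + 2 * t + s))
      rwa [show s * s - (T * T - 4 * N) + (T + 2 * t + s) * (T - s + 2 * t) =
        4 * (t * t + T * t + N) by ring] at this
    refine (hp.dvd_or_dvd h1).resolve_left fun h4 => ?_
    rw [show (4 : ℤ) = 2 * 2 by norm_num] at h4
    exact hp2' ((hp.dvd_or_dvd h4).elim id id)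

theorem kroneckerSymbol_eq_neg_one_iff (n : ℤ) (p : ℕ) [Fact p.Prime] :
    kroneckerSymbol (quadDisc n) p = -1 ↔ HasNoRoot (quadTrace n) (quadOmegaNorm n) p := by
  by_cases hp2 : p = 2
  · subst hp2
    simp only [kroneckerSymbol, if_true, HasNoRoot, quadDisc, quadTrace, quadOmegaNorm]
    by_cases h4 : n % 4 = 1
    · simp only [if_pos h4]
      have hodd : ¬n % 2 = 0 := by omega
      rw [if_neg hodd]
      -- As t² + t is even, only the parity of the constant term (1 - n)/4 matters.
      have hroot : ∀ t : ℤ, (2 : ℤ) ∣ t * t + 1 * t + (1 - n) / 4 ↔ n % 8 = 1 := by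
        intro t
        have : (2 : ℤ) ∣ t * t + 1 * t := by
          rw [one_mul]; exact (Int.even_mul_succ_self t).two_dvd.trans (dvd_of_eq (by ring))
        rw [dvd_add_right this]
        omega
      constructor
      · intro hk t ht
        rw [Nat.cast_ofNat, hroot] at ht
        rw [if_pos (Or.inl ht)] at hk
        omega
      · intro hno
        have := hno 0
        rw [Nat.cast_ofNat, hroot] at this
        rw [if_neg (by omega)]
    · simp only [if_neg h4]
      rw [if_pos (by omega)]
      constructor
      · intro h0; omega
      · intro hno
        -- For n ≢ 1 modulo 4 the symbol at 2 is 0, and t = n is a root of t² - n modulo 2.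
        refine absurd ?_ (hno n)
        rw [Nat.cast_ofNat]
        exact (Int.even_mul_pred_self n).two_dvd.trans (dvd_of_eq (by ring))
  · rw [kroneckerSymbol, if_neg hp2, legendreSym.eq_neg_one_iff, ← quadTrace_sq_sub,
      ← exists_root_iff_isSquare hp2, not_exists]
    rfl

theorem kroneckerSymbol_eq_one_iff (n : ℤ) (p : ℕ) [Fact p.Prime] :
    kroneckerSymbol (quadDisc n) p = 1 ↔ HasSimpleRoot (quadTrace n) (quadOmegaNorm n) p := by
  by_cases hp2 : p = 2
  · subst hp2
    simp only [kroneckerSymbol, if_true, HasSimpleRoot, quadDisc, quadTrace, quadOmegaNorm]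
    by_cases h4 : n % 4 = 1
    · simp only [if_pos h4]
      have hodd : ¬n % 2 = 0 := by omega
      rw [if_neg hodd]
      have hroot : ∀ t : ℤ, (2 : ℤ) ∣ t * t + 1 * t + (1 - n) / 4 ↔ n % 8 = 1 := by
        intro t
        have : (2 : ℤ) ∣ t * t + 1 * t := by
          rw [one_mul]; exact (Int.even_mul_succ_self t).two_dvd.trans (dvd_of_eq (by ring))
        rw [dvd_add_right this]
        omega
      constructor
      · intro hk
        refine ⟨0, ?_, by norm_num⟩
        rw [Nat.cast_ofNat, hroot]
        by_contra h8
        rw [if_neg (by omega)] at hk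
        omega
      · rintro ⟨t, ht, -⟩
        rw [Nat.cast_ofNat, hroot] at ht
        rw [if_pos (Or.inl ht)]
    · simp only [if_neg h4]
      rw [if_pos (by omega)]
      constructor
      · intro h0; omega
      · rintro ⟨t, -, ht⟩
        exact absurd ⟨t, by push_cast; ring⟩ ht
  · have hdisc := quadTrace_sq_sub n
    have hp : Prime (p : ℤ) := Nat.prime_iff_prime_int.1 Fact.out
    -- At a root the square of the derivative is congruent to the discriminant, so the root is
    -- simple exactly when p does not divide the discriminant.
    have hroot : ∀ t : ℤ, (p : ℤ) ∣ t * t + quadTrace n * t + quadOmegaNorm n →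
        ((p : ℤ) ∣ 2 * t + quadTrace n ↔ ((quadDisc n : ℤ) : ZMod p) = 0) := by
      intro t ht
      rw [ZMod.intCast_zmod_eq_zero_iff_dvd]
      have h1 : (2 * t + quadTrace n) * (2 * t + quadTrace n) =
          4 * (t * t + quadTrace n * t + quadOmegaNorm n) + quadDisc n := by rw [← hdisc]; ring
      have h2 := dvd_add_right (c := quadDisc n) (ht.mul_left 4)
      rw [← h1] at h2
      rw [← h2]
      exact ⟨fun hd => hd.mul_left _, fun hd => (hp.dvd_or_dvd hd).elim id id⟩
    rw [kroneckerSymbol, if_neg hp2]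
    constructor
    · intro hk
      have h0 : ((quadDisc n : ℤ) : ZMod p) ≠ 0 := by
        intro h0
        rw [(legendreSym.eq_zero_iff p _).2 h0] at hk
        omega
      rw [legendreSym.eq_one_iff p h0, ← hdisc, ← exists_root_iff_isSquare hp2] at hk
      obtain ⟨t, ht⟩ := hk
      exact ⟨t, ht, fun hd => h0 ((hroot t ht).1 hd)⟩
    · rintro ⟨t, ht, ht'⟩
      have h0 : ((quadDisc n : ℤ) : ZMod p) ≠ 0 := fun h0 => ht' ((hroot t ht).2 h0)
      rw [legendreSym.eq_one_iff p h0, ← hdisc, ← exists_root_iff_isSquare hp2]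
      exact ⟨t, ht⟩

theorem forall_prime_int_iff {r : ℕ} {P : ℤ → Prop} (hP : ∀ p, P p ↔ P (p.natAbs : ℤ)) :
    (∀ p : ℤ, Prime p → p ∣ (r : ℤ) → P p) ↔ ∀ (p : ℕ) [Fact p.Prime], p ∣ r → P p := by
  constructor
  · intro h p hp hpr
    exact h p (Nat.prime_iff_prime_int.1 hp.out) (by exact_mod_cast hpr)
  · intro h p hp hpr
    have : Fact p.natAbs.Prime := ⟨Int.prime_iff_natAbs_prime.1 hp⟩
    rw [hP]
    exact h p.natAbs (Int.natAbs_dvd_natAbs.2 hpr)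

theorem squarefree_iff_forall_prime_int (r : ℕ) :
    Squarefree r ↔ ∀ p : ℤ, Prime p → ¬p * p ∣ (r : ℤ) := by
  rw [Nat.squarefree_iff_prime_squarefree]
  constructor
  · intro h p hp hpr
    refine h p.natAbs (Int.prime_iff_natAbs_prime.1 hp) ?_
    rw [← Int.natAbs_mul]
    exact Int.natAbs_dvd_natAbs.2 hpr
  · intro h p hp hpr
    exact h p (Nat.prime_iff_prime_int.1 hp) (by exact_mod_cast hpr)

end QuadraticFields

end

theorem corollary4p14 (n : ℤ) (hn : Squarefree n) (hn1 : n ≠ 1) (r : ℕ) (hr : 0 < r) :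
    List.TFAE [
      IsGPVD (quadOrder n r),
      IsLPVD (quadOrder n r),
      afDim (quadOrder n r) ≤ 2,
      Squarefree r ∧
        ∀ (p : ℕ) [Fact p.Prime], p ∣ r → kroneckerSymbol (quadDisc n) p = -1] ∧
    List.TFAE [
      IsLAPVD (quadOrder n r),
      afDim (quadOrder n r) ≤ 3,
      Squarefree r ∧
        ∀ (p : ℕ) [Fact p.Prime], p ∣ r → kroneckerSymbol (quadDisc n) p ≠ 1] ∧
    List.TFAE [
      IsLocallyConducive (quadOrder n r),
      afDim (quadOrder n r) < ⊤,
      ∀ (p : ℕ) [Fact p.Prime], p ∣ r → kroneckerSymbol (quadDisc n) p ≠ 1] := by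
  have key := (isQuadOrderGen_quadOrder hn hn1 hr).tfae (by omega)
    fun p hp t => not_dvd_of_sq_dvd_quadOmega hn hp t
  rw [forall_prime_int_iff (P := HasNoRoot (quadTrace n) (quadOmegaNorm n))
      (fun p => by simp only [HasNoRoot, Int.natAbs_dvd]),
    forall_prime_int_iff (P := fun p => ¬HasSimpleRoot (quadTrace n) (quadOmegaNorm n) p)
      (fun p => by simp only [HasSimpleRoot, Int.natAbs_dvd]),
    ← squarefree_iff_forall_prime_int] at key
  simpa only [ne_eq, kroneckerSymbol_eq_one_iff, kroneckerSymbol_eq_neg_one_iff] using key
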